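/- Setting. Let $\mathcal D$ be a probability distribution on $\mathcal X\times\{\pm1\}$, $\mathcal H$ a finite set of (measurable) classifiers $h:\mathcal X\to\{\pm1\}$, $\mathrm{err}(h)=\Pr_{(X,Y)\sim\mathcal D}(h(X)\ne Y)$, $h^*\in\arg\min_{h\in\mathcal H}\mathrm{err}(h)$, $\mathrm{reg}(h,h')=\mathrm{err}(h)-\mathrm{err}(h')$. For a finite multiset $S$ of weighted examples $(x,y,w)$ let $\mathrm{err}(h,S)=\frac1{|S|}\sum_{(x,y,w)\in S}w\,\mathbf 1(h(x)\ne y)$ and $\mathrm{reg}(h,h',S)=\mathrm{err}(h,S)-\mathrm{err}(h',S)$. For $A\subseteq\mathcal H$ let $\mathrm{DIS}(A)=\{x:\exists h,h'\in A,\ h(x)\neq h'(x)\}$. Let $M\ge1$, $0=\tau_0<3=\tau_1<\tau_2<\dots<\tau_M\le n$ be integers with $\tau_{m+1}\le2\tau_m$ for $m\ge1$, and $\epsilon_m=32(\log(|\mathcal H|/\delta)+\log\tau_m)/\tau_m$. Let the real constants satisfy $$\alpha\ge1,\quad \eta\ge864,\quad \xi\le\frac1{8n\epsilon_M\log n},\quad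 \beta^2\le\frac{\eta}{864\gamma n\epsilon_M\log n},\quad \gamma\ge\frac\eta4,\quad c_1\ge2\alpha\sqrt6,\quad c_2\ge\frac{\eta c_1^2}4,\quad c_3\ge1 .$$ Algorithm (Active Cover). The examples $(X_i,Y_i)$, $1\le i\le n$, are i.i.d. from $\mathcal D$. The first three labels are queried: $\tilde Z_1=\{(X_i,Y_i,1)\}_{i\le3}$; and $A_1=\mathcal H$. For $m=1,\dots,M$, once the sample $\tilde Z_m$ of epochs $1,\dots,m$ is complete, put $$h_{m+1}\in\arg\min_{h\in\mathcal H}\mathrm{err}(h,\tilde Z_m),\qquad \Delta_m=c_1\sqrt{\epsilon_m\,\mathrm{err}(h_{m+1},\tilde Z_m)}+c_2\epsilon_m\log\tau_m,$$ $$A_{m+1}=\{h\in\mathcal H:\mathrm{reg}(h,h_{m+1},\tilde Z_m)\le\gamma\Delta_m\}.$$ Let $D_m=\mathrm{DIS}(A_m)$. For epochs $2\le m\le M$, $P_m:\mathcal X\to[0,1]$ minimizes $\mathbb E_X[1/(1-P(X))]$ over the (measurable) functions $P:\mathcal X\to[0,1]$ with $P(x)\ge P_{\min,m}$ for $x\in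 D_m$ and, for all $h\in\mathcal H$, with $I_h(x)=\mathbf 1(h(x)\ne h_m(x)\wedge x\in D_m)$, $$\mathbb E_X\Big[\frac{I_h(X)}{P(X)}\Big]\le2\alpha^2\mathbb E_X[I_h(X)]+2\beta^2\gamma\,\mathrm{reg}(h,h_m,\tilde Z_{m-1})\,\tau_{m-1}\Delta_{m-1}+\xi\tau_{m-1}\Delta_{m-1}^2,$$ where $$P_{\min,m}=\min\Big(c_3\Big/\Big(\sqrt{\tau_{m-1}\mathrm{err}(h_m,\tilde Z_{m-1})/(n\epsilon_M)}+\log\tau_{m-1}\Big),\ \tfrac12\Big).$$ In epoch $m\ge2$, each $i$ with $\tau_{m-1}<i\le\tau_m$ adds one weighted example to $\tilde Z_{m-1}$ in forming $\tilde Z_m$: if $X_i\in D_m$, then $Q_i\sim\mathrm{Bernoulli}(P_m(X_i))$ is drawn (independently of everything else given the past and $X_i$), and $(X_i,Y_i,1/P_m(X_i))$ is added if $Q_i=1$, and $(X_i,1,0)$ if $Q_i=0$; if $X_i\notin D_m$, then $(X_i,h_m(X_i),1)$ is added. Finally, for $m\ge1$, let $$\overline{\mathrm{err}}_m(h)=\frac1{\tau_m}\sum_{j=1}^m(\tau_j-\tau_{j-1})\Pr_{(X,Y)\sim\mathcal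 D}\big(h(X)\ne Y\wedge X\in D_j\big),\qquad \Delta^*_m=c_1\sqrt{\epsilon_m\overline{\mathrm{err}}_m(h^*)}+c_2\epsilon_m\log\tau_m .$$ Theorem. Let $0<\delta<1/e$ with $|\mathcal H|/\delta>\sqrt{192}$. Then with probability at least $1-\delta$, simultaneously for all epochs $m=1,\dots,M$, $$\mathrm{reg}(h,h^*)\le16\gamma\Delta^*_m\ \text{ for all }h\in A_{m+1},\qquad\text{and}\qquad \mathrm{reg}(h^*,h_{m+1},\tilde Z_m)\le\frac{\eta\Delta_m}4,$$ and $h^*\in A_m$ for all $1\le m\le M+1$. -/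

import Mathlib

open MeasureTheory ProbabilityTheory

namespace ActiveCover

noncomputable section

/-- An importance weighted labelled example `(x, y, w)`. The two labels `±1` are the two
elements of `Bool`. -/
abbrev WExample (𝒳 : Type*) := 𝒳 × Bool × ℝ

/-- Importance weighted empirical error of `h` on the multiset `S`:
`∑_{(x,y,w) ∈ S} w · 1(h x ≠ y) / |S|`. -/
def empErr {𝒳 : Type*} (h : 𝒳 → Bool) (S : Multiset (WExample 𝒳)) : ℝ :=
  (S.map fun e => if h e.1 ≠ e.2.1 then e.2.2 else 0).sum / (Multiset.card S : ℝ)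

/-- Empirical regret of `h` relative to `h'` on `S`. -/
def empReg {𝒳 : Type*} (h h' : 𝒳 → Bool) (S : Multiset (WExample 𝒳)) : ℝ :=
  empErr h S - empErr h' S

/-- Expected error of `h`: the probability that `h X ≠ Y`. -/
def err {𝒳 : Type*} [MeasurableSpace 𝒳] (D : Measure (𝒳 × Bool)) (h : 𝒳 → Bool) : ℝ :=
  D.real {z | h z.1 ≠ z.2}

/-- Regret of `h` relative to `h'`. -/
def reg {𝒳 : Type*} [MeasurableSpace 𝒳] (D : Measure (𝒳 × Bool)) (h h' : 𝒳 → Bool) : ℝ :=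
  err D h - err D h'

/-- The disagreement region of a set of classifiers. -/
def DIS {𝒳 : Type*} (A : Set (𝒳 → Bool)) : Set 𝒳 :=
  {x | ∃ h ∈ A, ∃ h' ∈ A, h x ≠ h' x}

/-- The inputs of the algorithm: the number `n` of examples, the number `M` of epochs, the epoch
schedule `τ`, and the numerical constants (`η` is used only in the conditions on the constants and
in the guarantee). -/
structure Params where
  n : ℕ
  M : ℕ
  τ : ℕ → ℕ
  δ : ℝ
  γ : ℝ
  α : ℝ
  β : ℝ
  ξ : ℝ
  η : ℝ
  c₁ : ℝ
  c₂ : ℝ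
  c₃ : ℝ

/-- `ε_m = 32 (log (N / δ) + log τ_m) / τ_m`, where `N` is the number of classifiers. -/
def Params.eps (p : Params) (N : ℕ) (m : ℕ) : ℝ :=
  32 * (Real.log (N / p.δ) + Real.log (p.τ m)) / p.τ m

/-- The epoch schedule `0 = τ_0 < 3 = τ_1 < τ_2 < ⋯ < τ_M` with `τ_{m+1} ≤ 2 τ_m` for `m ≥ 1`;
the `n` examples cover all the epochs. -/
structure Params.ScheduleOK (p : Params) : Prop where
  one_le_M : 1 ≤ p.M
  tau_zero : p.τ 0 = 0
  tau_one : p.τ 1 = 3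
  tau_lt : ∀ m < p.M, p.τ m < p.τ (m + 1)
  tau_le : ∀ m, 1 ≤ m → m < p.M → p.τ (m + 1) ≤ 2 * p.τ m
  tau_M_le : p.τ p.M ≤ p.n

/-- The conditions on the constants, for `N` classifiers. -/
structure Params.ConstantsOK (p : Params) (N : ℕ) : Prop where
  alpha : 1 ≤ p.α
  eta : 864 ≤ p.η
  xi : p.ξ ≤ 1 / (8 * p.n * p.eps N p.M * Real.log p.n)
  beta : p.β ^ 2 ≤ p.η / (864 * p.γ * p.n * p.eps N p.M * Real.log p.n)
  gamma : p.η / 4 ≤ p.γ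
  c₁ : 2 * p.α * √6 ≤ p.c₁
  c₂ : p.η * p.c₁ ^ 2 / 4 ≤ p.c₂
  c₃ : 1 ≤ p.c₃

/-- The radius `Δ_m` as a function of the empirical error `e` of the empirical risk minimizer:
`Δ_0 = c₁ √ε_1 + c₂ ε_1 log 3`, and `Δ_m = c₁ √(ε_m e) + c₂ ε_m log τ_m` for `m ≥ 1`. -/
def Params.radius (p : Params) (N : ℕ) (m : ℕ) (e : ℝ) : ℝ :=
  if m = 0 then p.c₁ * √(p.eps N 1) + p.c₂ * p.eps N 1 * Real.log 3
  else p.c₁ * √(p.eps N m * e) + p.c₂ * p.eps N m * Real.log (p.τ m)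

/-- The classifiers in `H` whose empirical regret on `S` relative to `g` is at most `γ` times the
radius `Δ_m` computed from `S` and `g`. -/
def goodSet {𝒳 : Type*} (p : Params) (H : Finset (𝒳 → Bool)) (m : ℕ) (g : 𝒳 → Bool)
    (S : Multiset (WExample 𝒳)) : Set (𝒳 → Bool) :=
  {h | h ∈ H ∧ empReg h g S ≤ p.γ * p.radius H.card m (empErr g S)}

/-- What one execution produces: the examples `(X_i, Y_i)` and query decisions `Q_i`
(`i = 1, …, n`), and, at the start of each epoch `m ≥ 2`, the classifier `h_m` and the query
probability function `P_m`. -/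
structure Trajectory (𝒳 : Type*) where
  X : ℕ → 𝒳
  Y : ℕ → Bool
  Q : ℕ → Bool
  h : ℕ → 𝒳 → Bool
  P : ℕ → 𝒳 → ℝ

open Classical in
/-- The biased sample `Z̃_m` collected in epochs `1, …, m`. The labels in the first epoch (the
first three examples) are all queried. In a later epoch `m`, an example in the disagreement region
`D_m` of the version space `A_m` is added with its true label and weight `1 / P_m(X_i)` if it is
queried and with weight `0` otherwise; an example outside `D_m` is added with the label predicted
by `h_m` and weight `1`. -/
def Trajectory.sample {𝒳 : Type*} (T : Trajectory 𝒳) (p : Params) (H : Finset (𝒳 → Bool)) :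
    ℕ → Multiset (WExample 𝒳)
  | 0 => 0
  | 1 => (Finset.Ioc (p.τ 0) (p.τ 1)).val.map fun i => (T.X i, T.Y i, (1 : ℝ))
  | m + 2 =>
      T.sample p H (m + 1) +
        (Finset.Ioc (p.τ (m + 1)) (p.τ (m + 2))).val.map fun i =>
          if T.X i ∈ DIS (goodSet p H (m + 1) (T.h (m + 2)) (T.sample p H (m + 1))) then
            if T.Q i = true then (T.X i, T.Y i, 1 / T.P (m + 2) (T.X i))
            else (T.X i, true, (0 : ℝ))
          else (T.X i, T.h (m + 2) (T.X i), (1 : ℝ))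

/-- The version space `A_m`: `A_1 = H`, and
`A_{m+1} = {h ∈ H | err(h, Z̃_m) - err(h_{m+1}, Z̃_m) ≤ γ Δ_m}` for `m ≥ 1`. -/
def Trajectory.A {𝒳 : Type*} (T : Trajectory 𝒳) (p : Params) (H : Finset (𝒳 → Bool)) (m : ℕ) :
    Set (𝒳 → Bool) :=
  if m ≤ 1 then {h | h ∈ H} else goodSet p H (m - 1) (T.h m) (T.sample p H (m - 1))

/-- The disagreement region `D_m = DIS(A_m)` of epoch `m`. -/
def Trajectory.region {𝒳 : Type*} (T : Trajectory 𝒳) (p : Params) (H : Finset (𝒳 → Bool))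
    (m : ℕ) : Set 𝒳 :=
  DIS (T.A p H m)

/-- The radius `Δ_m`. -/
def Trajectory.Delta {𝒳 : Type*} (T : Trajectory 𝒳) (p : Params) (H : Finset (𝒳 → Bool))
    (m : ℕ) : ℝ :=
  p.radius H.card m (empErr (T.h (m + 1)) (T.sample p H m))

/-- The average over epochs `1, …, m` of the error of `h` restricted to the disagreement regions:
`(1/τ_m) ∑_{j=1}^m (τ_j - τ_{j-1}) Pr(h X ≠ Y ∧ X ∈ D_j)`. -/
def Trajectory.errAvg {𝒳 : Type*} [MeasurableSpace 𝒳] (T : Trajectory 𝒳) (p : Params)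
    (H : Finset (𝒳 → Bool)) (D : Measure (𝒳 × Bool)) (m : ℕ) (h : 𝒳 → Bool) : ℝ :=
  1 / (p.τ m : ℝ) * ∑ j ∈ Finset.Icc 1 m,
    ((p.τ j : ℝ) - p.τ (j - 1)) * D.real {z | h z.1 ≠ z.2 ∧ z.1 ∈ T.region p H j}

/-- The radius `Δ*_m`, computed from the average restricted error of `hstar`. -/
def Trajectory.DeltaStar {𝒳 : Type*} [MeasurableSpace 𝒳] (T : Trajectory 𝒳) (p : Params)
    (H : Finset (𝒳 → Bool)) (D : Measure (𝒳 × Bool)) (hstar : 𝒳 → Bool) (m : ℕ) : ℝ :=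
  p.radius H.card m (T.errAvg p H D m hstar)

/-- The minimum query probability `P_{min,m}` on the disagreement region, for `m ≥ 2`. -/
def Trajectory.Pmin {𝒳 : Type*} (T : Trajectory 𝒳) (p : Params) (H : Finset (𝒳 → Bool))
    (m : ℕ) : ℝ :=
  min (p.c₃ / (√(p.τ (m - 1) * empErr (T.h m) (T.sample p H (m - 1)) /
      (p.n * p.eps H.card p.M)) + Real.log (p.τ (m - 1)))) (1 / 2)

/-- The set of points of `D_m` on which `h` disagrees with `h_m`. -/
def Trajectory.disagree {𝒳 : Type*} (T : Trajectory 𝒳) (p : Params) (H : Finset (𝒳 → Bool))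
    (m : ℕ) (h : 𝒳 → Bool) : Set 𝒳 :=
  {x | h x ≠ T.h m x ∧ x ∈ T.region p H m}

/-- The bound `b_m(h)` on the variance term, for `m ≥ 2`. -/
def Trajectory.b {𝒳 : Type*} [MeasurableSpace 𝒳] (T : Trajectory 𝒳) (p : Params)
    (H : Finset (𝒳 → Bool)) (D : Measure (𝒳 × Bool)) (m : ℕ) (h : 𝒳 → Bool) : ℝ :=
  2 * p.α ^ 2 * D.fst.real (T.disagree p H m h)
    + 2 * p.β ^ 2 * p.γ * empReg h (T.h m) (T.sample p H (m - 1)) * p.τ (m - 1)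
        * T.Delta p H (m - 1)
    + p.ξ * p.τ (m - 1) * T.Delta p H (m - 1) ^ 2

/-- `P` satisfies the constraints of the optimization problem of epoch `m`. -/
structure Trajectory.IsFeasible {𝒳 : Type*} [MeasurableSpace 𝒳] (T : Trajectory 𝒳) (p : Params)
    (H : Finset (𝒳 → Bool)) (D : Measure (𝒳 × Bool)) (m : ℕ) (P : 𝒳 → ℝ) : Prop where
  measurable : Measurable P
  variance : ∀ h ∈ H, ∫ x, (T.disagree p H m h).indicator (fun x => 1 / P x) x ∂D.fst
    ≤ T.b p H D m h
  mem_Icc : ∀ x, 0 ≤ P x ∧ P x ≤ 1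
  min_le : ∀ x ∈ T.region p H m, T.Pmin p H m ≤ P x

/-- The objective `E[1 / (1 - P(X))]`, which is infinite if `P(X) = 1` with positive
probability. -/
def objective {𝒳 : Type*} [MeasurableSpace 𝒳] (D : Measure (𝒳 × Bool)) (P : 𝒳 → ℝ) : ENNReal :=
  ∫⁻ x, (ENNReal.ofReal (1 - P x))⁻¹ ∂D.fst

/-- `P` is a solution of the optimization problem of epoch `m`: it minimizes `E[1 / (1 - P(X))]`
subject to the constraints. -/
structure Trajectory.IsSolution {𝒳 : Type*} [MeasurableSpace 𝒳] (T : Trajectory 𝒳) (p : Params)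
    (H : Finset (𝒳 → Bool)) (D : Measure (𝒳 × Bool)) (m : ℕ) (P : 𝒳 → ℝ) : Prop where
  feasible : T.IsFeasible p H D m P
  minimal : ∀ P', T.IsFeasible p H D m P' → objective D P ≤ objective D P'

/-- The `i`-th labelled example of a random trajectory. -/
def obs {𝒳 Ω : Type*} (T : Ω → Trajectory 𝒳) (i : ℕ) (ω : Ω) : 𝒳 × Bool :=
  ((T ω).X i, (T ω).Y i)

/-- The random trajectory `T` is an execution of the algorithm on i.i.d. examples from `D`.
The σ-algebra `ℱ i` describes what has happened up to and including example `i`; it is generated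
by the examples and the query decisions so far, and possibly by further randomness (which may be
used to break ties). Each example has law `D` and is independent of the past. At the start of each
epoch `m ≥ 2`, `h_m` is an empirical risk minimizer on `Z̃_{m-1}` and `P_m` is a solution of the
optimization problem. If `X_i ∈ D_m`, then, conditionally on the past and on the `i`-th example,
`Q_i` is a Bernoulli variable with parameter `P_m(X_i)`. The last classifier is `h_{M+1}`. -/
structure IsRun {𝒳 Ω : Type*} [MeasurableSpace 𝒳] [mΩ : MeasurableSpace Ω]
    (p : Params) (H : Finset (𝒳 → Bool)) (D : Measure (𝒳 × Bool)) (μ : Measure Ω)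
    (ℱ : Filtration ℕ mΩ) (T : Ω → Trajectory 𝒳) : Prop where
  measurable_obs : ∀ i ∈ Finset.Icc 1 p.n, Measurable[ℱ i] (obs T i)
  measurable_query : ∀ i ∈ Finset.Icc 1 p.n, Measurable[ℱ i] fun ω => (T ω).Q i
  law_obs : ∀ i ∈ Finset.Icc 1 p.n, μ.map (obs T i) = D
  indep_obs : ∀ i ∈ Finset.Icc 1 p.n,
    Indep (MeasurableSpace.comap (obs T i) inferInstance) (ℱ (i - 1)) μ
  erm_mem : ∀ m ∈ Finset.Icc 2 (p.M + 1), ∀ ω, (T ω).h m ∈ H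
  erm_min : ∀ m ∈ Finset.Icc 2 (p.M + 1), ∀ ω, ∀ g ∈ H,
    empErr ((T ω).h m) ((T ω).sample p H (m - 1)) ≤ empErr g ((T ω).sample p H (m - 1))
  measurable_erm : ∀ m ∈ Finset.Icc 2 (p.M + 1), ∀ g ∈ H,
    MeasurableSet[ℱ (p.τ (m - 1))] {ω | (T ω).h m = g}
  prob_solution : ∀ m ∈ Finset.Icc 2 p.M, ∀ ω, (T ω).IsSolution p H D m ((T ω).P m)
  measurable_prob : ∀ m ∈ Finset.Icc 2 p.M,
    Measurable[(ℱ (p.τ (m - 1))).prod inferInstance] fun q : Ω × 𝒳 => (T q.1).P m q.2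
  query_law : ∀ m ∈ Finset.Icc 2 p.M, ∀ i ∈ Finset.Ioc (p.τ (m - 1)) (p.τ m),
    ∀ᵐ ω ∂μ, (T ω).X i ∈ (T ω).region p H m →
      (μ[({ω' | (T ω').Q i = true} : Set Ω).indicator (fun _ => (1 : ℝ)) |
          ℱ (i - 1) ⊔ MeasurableSpace.comap (obs T i) inferInstance]) ω
        = (T ω).P m ((T ω).X i)

end

end ActiveCover

namespace ActiveCover

noncomputable section

/-! Multiplying by `τ m` turns empirical errors into sums of weighted losses. By importance
weighting, the loss of `g` in epoch `j` has conditional mean `meanLoss`: its error against the true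
label on `D_j` and against the label of `h_j` elsewhere (in the first epoch, against the true label
everywhere). While `hstar` lies in `A_j` it agrees with `h_j` off `D_j`, so the predicted labels can
only favour `hstar`, and the true regret is at most the gap of conditional means
(`reg_le_meanLoss_sub`). It remains to keep `hstar` in the version spaces and to compare the gap of
losses with the gap of means.

The deviations are controlled by an exponential supermartingale (`integral_exp_sum_le_one`): if all
weights are at most `k`, a deviation is at most `V / k + 3 k L`, with `V` the sum of conditional
second moments and `L` the logarithmic term. The bound on the weights and `V` are random, so this is
made to hold for all integers `k ≤ 3 τ_m` at once (`exists_event`), and `k` is chosen afterwards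
(`exists_balanced_scale`). The result is of order `√(L V) + L q`, where `q` bounds the weights. The
lower limit on the query probabilities makes `L q` no larger than the scaled radius `B = τ_m Δ_m` in
order (`eps_mul_invPmin_le`).

The constraints of the optimization problem bound `V` by regrets, the error of `hstar` on the
regions `D_j`, and the radii (`secondMoment_le`). This closes an induction over epochs on the
statement `GapClose`: if it holds earlier, then `L V` is at most a quadratic form in the mean gap
`R`, in `η B`, and in the excess loss `X` of `hstar` over the empirical minimizer. Applying the
deviation bound to the minimizer bounds `X`, and the constants leave room to absorb `R`
(`gapClose_of_forall_lt`). Both `hstar ∈ A_{m+1}` and the regret bounds follow, the latter with `Δ_m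
≤ 2 Δ*_m` (`scaledDelta_le`). -/

/-! ### Exponential supermartingale for coin-weighted sums -/

theorem exp_le_one_add_add_sq {x : ℝ} (hx : |x| ≤ 1) : Real.exp x ≤ 1 + x + x ^ 2 := by
  have := (abs_le.1 (Real.abs_exp_sub_one_sub_id_le hx)).2
  linarith

theorem integrable_of_measurable_of_abs_le {Ω : Type*} [MeasurableSpace Ω] {μ : Measure Ω}
    [IsFiniteMeasure μ] {f : Ω → ℝ} (hf : Measurable f) {C : ℝ} (hC : ∀ ω, |f ω| ≤ C) :
    Integrable f μ :=
  Integrable.of_bound hf.aestronglyMeasurable C (Filter.Eventually.of_forall hC)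

/-- The mean of `U` given the past `w`, if the coin has success probability `π`. -/
def coinMean {Ω' 𝒵 : Type*} [MeasurableSpace 𝒵] (D : Measure 𝒵) (U : Bool → Ω' × 𝒵 → ℝ)
    (π : Ω' × 𝒵 → ℝ) (w : Ω') : ℝ :=
  ∫ z, (π (w, z) * U true (w, z) + (1 - π (w, z)) * U false (w, z)) ∂D



theorem measurable_coinMean {Ω' 𝒵 : Type*} [MeasurableSpace Ω'] [MeasurableSpace 𝒵]
    {D : Measure 𝒵} [IsProbabilityMeasure D] {U : Bool → Ω' × 𝒵 → ℝ}
    (hU : ∀ b, Measurable (U b)) {π : Ω' × 𝒵 → ℝ} (hπ : Measurable π) :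
    Measurable (coinMean D U π) := by
  have : Measurable fun q : Ω' × 𝒵 => π q * U true q + (1 - π q) * U false q := by
    have := hU true; have := hU false; fun_prop
  exact (this.stronglyMeasurable.integral_prod_right (ν := D)).measurable

theorem abs_mix_le {p a b C : ℝ} (h0 : 0 ≤ p) (h1 : p ≤ 1) (ha : |a| ≤ C) (hb : |b| ≤ C) :
    |p * a + (1 - p) * b| ≤ C := by
  rw [abs_le] at *
  constructor <;> nlinarith

theorem abs_coinMean_le {Ω' 𝒵 : Type*} [MeasurableSpace 𝒵]
    {D : Measure 𝒵} [IsProbabilityMeasure D] {U : Bool → Ω' × 𝒵 → ℝ}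
    {C : ℝ} (hC : ∀ b q, |U b q| ≤ C) {π : Ω' × 𝒵 → ℝ} (h0 : ∀ q, 0 ≤ π q) (h1 : ∀ q, π q ≤ 1)
    (w : Ω') : |coinMean D U π w| ≤ C := by
  have := norm_integral_le_of_norm_le_const (μ := D) (C := C)
    (f := fun z => π (w, z) * U true (w, z) + (1 - π (w, z)) * U false (w, z))
    (Filter.Eventually.of_forall fun z => abs_mix_le (h0 _) (h1 _) (hC _ _) (hC _ _))
  simpa [coinMean] using this

/-- The pull-out property. Where `ψ` vanishes the conditional expectation need not be known, which
accommodates examples for which no coin is flipped. -/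
theorem integral_mul_eq_of_condExp {Ω : Type*} {m mΩ : MeasurableSpace Ω} (hm : m ≤ mΩ)
    {μ : Measure Ω} [IsFiniteMeasure μ] {ψ g p : Ω → ℝ} (hψ : Measurable[m] ψ)
    (hψg : Integrable (fun ω => ψ ω * g ω) μ) (hg : Integrable g μ)
    (hq : ∀ᵐ ω ∂μ, ψ ω = 0 ∨ (μ[g | m]) ω = p ω) :
    ∫ ω, ψ ω * g ω ∂μ = ∫ ω, ψ ω * p ω ∂μ := by
  have h2 := condExp_mul_of_stronglyMeasurable_left hψ.stronglyMeasurable hψg hg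
  rw [← integral_condExp hm]
  refine integral_congr_ae ?_
  filter_upwards [h2, hq] with ω h2 hq
  have : (μ[fun ω => ψ ω * g ω | m]) ω = ψ ω * (μ[g | m]) ω := h2
  rw [this]
  rcases hq with hq | hq
  · simp [hq]
  · rw [hq]

theorem integral_indep_pair {Ω Ω' 𝒵 : Type*} [MeasurableSpace Ω]
    [MeasurableSpace Ω'] [MeasurableSpace 𝒵] {μ : Measure Ω} [IsProbabilityMeasure μ] {f : Ω → Ω'}
    (hf : Measurable f) {obs : Ω → 𝒵} (hobs : Measurable obs) {D : Measure 𝒵}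
    [IsProbabilityMeasure D] (law : μ.map obs = D) (indep : IndepFun f obs μ)
    {Φ : Ω' × 𝒵 → ℝ} (hΦ : Measurable Φ) {C : ℝ} (hC : ∀ q, |Φ q| ≤ C) :
    ∫ ω, Φ (f ω, obs ω) ∂μ = ∫ ω, ∫ z, Φ (f ω, z) ∂D ∂μ := by
  have hpair := (indepFun_iff_map_prod_eq_prod_map_map hf.aemeasurable hobs.aemeasurable).1 indep
  rw [law] at hpair
  have := Measure.isProbabilityMeasure_map (μ := μ) hf.aemeasurable
  rw [← integral_map (φ := fun ω => (f ω, obs ω)) (hf.prodMk hobs).aemeasurable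
    hΦ.aestronglyMeasurable, hpair, integral_prod _ (integrable_of_measurable_of_abs_le hΦ hC),
    integral_map hf.aemeasurable
      (hΦ.stronglyMeasurable.integral_prod_right' (ν := D)).aestronglyMeasurable]

/-- One step of the supermartingale. Conditioning on the past and the observation replaces the coin
by its bias, independence integrates out the observation, and `exp x ≤ 1 + x + x²` followed by `1 +
y ≤ exp y` restores an exponential. Where the two values of `U` coincide the coin has no effect, so
its law is not needed there. -/
theorem integral_mul_exp_coin_le {Ω Ω' 𝒵 : Type*} [MeasurableSpace Ω]
    [MeasurableSpace Ω'] [MeasurableSpace 𝒵] {μ : Measure Ω} [IsProbabilityMeasure μ] {f : Ω → Ω'}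
    (hf : Measurable f) {obs : Ω → 𝒵} (hobs : Measurable obs) {D : Measure 𝒵}
    [IsProbabilityMeasure D] (law : μ.map obs = D) (indep : IndepFun f obs μ)
    {Q : Ω → Bool} (hQ : Measurable Q)
    {U : Bool → Ω' × 𝒵 → ℝ} (hU : ∀ b, Measurable (U b)) (hU1 : ∀ b q, |U b q| ≤ 1)
    {π : Ω' × 𝒵 → ℝ} (hπ : Measurable π) (h0 : ∀ q, 0 ≤ π q) (h1 : ∀ q, π q ≤ 1)
    (hq : ∀ᵐ ω ∂μ, U true (f ω, obs ω) = U false (f ω, obs ω) ∨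
      (μ[({ω' | Q ω' = true} : Set Ω).indicator (fun _ => (1 : ℝ)) |
        MeasurableSpace.comap f inferInstance ⊔ MeasurableSpace.comap obs inferInstance]) ω
        = π (f ω, obs ω))
    {W : Ω' → ℝ} (hW : Measurable W) (hW0 : ∀ w, 0 ≤ W w) {C : ℝ} (hWC : ∀ w, W w ≤ C) :
    ∫ ω, W (f ω) * Real.exp (U (Q ω) (f ω, obs ω)) ∂μ ≤
      ∫ ω, W (f ω) * Real.exp (coinMean D U π (f ω)
        + coinMean D (fun b q => U b q ^ 2) π (f ω)) ∂μ := by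
  have hUt := hU true
  have hUf := hU false
  have hfm : Measurable[MeasurableSpace.comap f inferInstance ⊔
      MeasurableSpace.comap obs inferInstance] f :=
    (comap_measurable f).mono le_sup_left le_rfl
  have hom : Measurable[MeasurableSpace.comap f inferInstance ⊔
      MeasurableSpace.comap obs inferInstance] obs :=
    (comap_measurable obs).mono le_sup_right le_rfl
  have hle : MeasurableSpace.comap f inferInstance ⊔ MeasurableSpace.comap obs inferInstance ≤
      (inferInstance : MeasurableSpace Ω) := sup_le hf.comap_le hobs.comap_le
  have hC0 : 0 ≤ C := by
    obtain ⟨ω⟩ := nonempty_of_isProbabilityMeasure μ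
    exact (hW0 (f ω)).trans (hWC _)
  have hexp : ∀ b q, Real.exp (U b q) ≤ Real.exp 1 := fun b q =>
    Real.exp_le_exp.2 (abs_le.1 (hU1 b q)).2
  -- Writing `exp (U Q) = exp (U false) + 1(Q) (exp (U true) - exp (U false))` makes the coin enter
  -- linearly.
  let ψ : Ω' × 𝒵 → ℝ := fun q => W q.1 * (Real.exp (U true q) - Real.exp (U false q))
  let φ : Ω' × 𝒵 → ℝ := fun q => W q.1 * Real.exp (U false q)
  have hψ : Measurable ψ := by fun_prop
  have hφ : Measurable φ := by fun_prop
  have hφC : ∀ q, |φ q| ≤ C * Real.exp 1 := fun q => by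
    rw [abs_of_nonneg (mul_nonneg (hW0 _) (Real.exp_pos _).le)]
    exact mul_le_mul (hWC _) (hexp _ _) (Real.exp_pos _).le hC0
  have hψC : ∀ q, |ψ q| ≤ C * Real.exp 1 := fun q => by
    rw [abs_mul, abs_of_nonneg (hW0 _)]
    refine mul_le_mul (hWC _) ?_ (abs_nonneg _) hC0
    have := hexp true q; have := hexp false q
    have := Real.exp_pos (U true q); have := Real.exp_pos (U false q)
    rw [abs_le]; constructor <;> linarith
  let ind : Ω → ℝ := ({ω' | Q ω' = true} : Set Ω).indicator (fun _ => (1 : ℝ))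
  have hind : Measurable ind := measurable_const.indicator (hQ (measurableSet_singleton true))
  have hind1 : ∀ ω, |ind ω| ≤ 1 := fun ω => by
    by_cases h : Q ω = true <;> simp [ind, h]
  have hfo : Measurable fun ω => (f ω, obs ω) := hf.prodMk hobs
  have hiψ : Integrable (fun ω => ψ (f ω, obs ω) * ind ω) μ :=
    integrable_of_measurable_of_abs_le ((hψ.comp hfo).mul hind) (C := C * Real.exp 1) fun ω => by
      rw [abs_mul]
      simpa using mul_le_mul (hψC (f ω, obs ω)) (hind1 ω) (abs_nonneg _)
        ((abs_nonneg _).trans (hψC (f ω, obs ω)))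
  have hpull : ∫ ω, ψ (f ω, obs ω) * ind ω ∂μ = ∫ ω, ψ (f ω, obs ω) * π (f ω, obs ω) ∂μ := by
    refine integral_mul_eq_of_condExp hle (hψ.comp (hfm.prodMk hom)) hiψ
      (integrable_of_measurable_of_abs_le hind hind1) ?_
    filter_upwards [hq] with ω hq
    exact hq.imp (fun hq => by simp [ψ, hq]) id
  have hiφ : Integrable (fun ω => φ (f ω, obs ω)) μ :=
    integrable_of_measurable_of_abs_le (hφ.comp hfo) fun ω => hφC _
  have hπ1 : ∀ q, |π q| ≤ 1 := fun q => by rw [abs_of_nonneg (h0 q)]; exact h1 q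
  have hψπC : ∀ q, |ψ q * π q| ≤ C * Real.exp 1 := fun q => by
    rw [abs_mul]
    exact (mul_le_of_le_one_right (abs_nonneg _) (hπ1 q)).trans (hψC q)
  have hΦC : ∀ q, |φ q + ψ q * π q| ≤ C * Real.exp 1 + C * Real.exp 1 := fun q =>
    (abs_add_le _ _).trans (add_le_add (hφC q) (hψπC q))
  have hiψπ : Integrable (fun ω => ψ (f ω, obs ω) * π (f ω, obs ω)) μ :=
    integrable_of_measurable_of_abs_le ((hψ.mul hπ).comp hfo) fun ω => hψπC _
  have hsplit : ∀ ω, W (f ω) * Real.exp (U (Q ω) (f ω, obs ω))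
      = φ (f ω, obs ω) + ψ (f ω, obs ω) * ind ω := fun ω => by
    cases h : Q ω <;> simp [φ, ψ, ind, h]
    ring
  simp_rw [hsplit]
  rw [integral_add hiφ hiψ, hpull, ← integral_add hiφ hiψπ,
    integral_indep_pair hf hobs law indep (Φ := fun q => φ q + ψ q * π q)
      (hφ.add (hψ.mul hπ)) hΦC]
  have hmean := measurable_coinMean (D := D) hU hπ
  have hvar := measurable_coinMean (D := D) (U := fun b q => U b q ^ 2)
    (fun b => (hU b).pow_const 2) hπ
  have hU2 : ∀ b q, |U b q ^ 2| ≤ 1 := fun b q => by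
    rw [abs_pow]; exact pow_le_one₀ (abs_nonneg _) (hU1 b q)
  have hpt : ∀ w, ∫ z, (φ (w, z) + ψ (w, z) * π (w, z)) ∂D ≤
      W w * Real.exp (coinMean D U π w + coinMean D (fun b q => U b q ^ 2) π w) := fun w => by
    have hs : Measurable fun z : 𝒵 => (w, z) := measurable_prodMk_left
    have e1 : ∀ z, φ (w, z) + ψ (w, z) * π (w, z) ≤ W w * (1 +
        (π (w, z) * U true (w, z) + (1 - π (w, z)) * U false (w, z)) +
        (π (w, z) * U true (w, z) ^ 2 + (1 - π (w, z)) * U false (w, z) ^ 2)) := fun z => by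
      have a1 := exp_le_one_add_add_sq (hU1 true (w, z))
      have a2 := exp_le_one_add_add_sq (hU1 false (w, z))
      have a3 : φ (w, z) + ψ (w, z) * π (w, z) = W w * (π (w, z) * Real.exp (U true (w, z)) +
        (1 - π (w, z)) * Real.exp (U false (w, z))) := by simp only [φ, ψ]; ring
      rw [a3]
      refine mul_le_mul_of_nonneg_left ?_ (hW0 w)
      have := mul_le_mul_of_nonneg_left a1 (h0 (w, z))
      have := mul_le_mul_of_nonneg_left a2 (sub_nonneg.2 (h1 (w, z)))
      linarith
    have m1 : Measurable fun z =>
        (π (w, z) * U true (w, z) + (1 - π (w, z)) * U false (w, z)) := by fun_prop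
    have m2 : Measurable fun z =>
        (π (w, z) * U true (w, z) ^ 2 + (1 - π (w, z)) * U false (w, z) ^ 2) := by fun_prop
    have i1 : Integrable (fun z =>
        (π (w, z) * U true (w, z) + (1 - π (w, z)) * U false (w, z))) D :=
      integrable_of_measurable_of_abs_le m1 (C := 1) fun z =>
        abs_mix_le (h0 _) (h1 _) (hU1 _ _) (hU1 _ _)
    have i2 : Integrable (fun z =>
        (π (w, z) * U true (w, z) ^ 2 + (1 - π (w, z)) * U false (w, z) ^ 2)) D :=
      integrable_of_measurable_of_abs_le m2 (C := 1) fun z =>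
        abs_mix_le (h0 _) (h1 _) (hU2 _ _) (hU2 _ _)
    have i0 : Integrable (fun z => φ (w, z) + ψ (w, z) * π (w, z)) D :=
      integrable_of_measurable_of_abs_le ((hφ.add (hψ.mul hπ)).comp hs) fun q => hΦC _
    calc ∫ z, (φ (w, z) + ψ (w, z) * π (w, z)) ∂D
        ≤ ∫ z, W w * (1 + (π (w, z) * U true (w, z) + (1 - π (w, z)) * U false (w, z)) +
        (π (w, z) * U true (w, z) ^ 2 + (1 - π (w, z)) * U false (w, z) ^ 2)) ∂D :=
          integral_mono i0 (((integrable_const 1).add i1).add i2 |>.const_mul _) e1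
      _ = W w * (1 + coinMean D U π w + coinMean D (fun b q => U b q ^ 2) π w) := by
          rw [integral_const_mul]
          congr 1
          have e2 := integral_add (f := fun z => 1 +
            (π (w, z) * U true (w, z) + (1 - π (w, z)) * U false (w, z)))
            ((integrable_const 1).add i1) i2
          have e3 := integral_add (integrable_const (μ := D) (1 : ℝ)) i1
          simp only [integral_const, probReal_univ, smul_eq_mul, mul_one] at e3
          rw [e2, e3]
          rfl
      _ ≤ _ := by
          refine mul_le_mul_of_nonneg_left ?_ (hW0 w)
          have := Real.add_one_le_exp (coinMean D U π w + coinMean D (fun b q => U b q ^ 2) π w)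
          linarith
  have hΦm : Measurable fun q => φ q + ψ q * π q := hφ.add (hψ.mul hπ)
  refine integral_mono ?_ ?_ fun ω => hpt (f ω)
  · refine integrable_of_measurable_of_abs_le
      (((hΦm.stronglyMeasurable.integral_prod_right' (ν := D)).measurable).comp hf)
      (C := C * Real.exp 1 + C * Real.exp 1) fun ω => ?_
    have := norm_integral_le_of_norm_le_const (μ := D) (C := C * Real.exp 1 + C * Real.exp 1)
      (f := fun z => φ (f ω, z) + ψ (f ω, z) * π (f ω, z))
      (Filter.Eventually.of_forall fun z => hΦC _)
    simpa using this
  · refine integrable_of_measurable_of_abs_le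
      ((hW.mul (Real.measurable_exp.comp (hmean.add hvar))).comp hf)
      (C := C * Real.exp 2) fun ω => ?_
    have hb : coinMean D U π (f ω) + coinMean D (fun b q => U b q ^ 2) π (f ω) ≤ 2 := by
      have := (abs_le.1 (abs_coinMean_le (D := D) hU1 h0 h1 (f ω))).2
      have := (abs_le.1 (abs_coinMean_le (D := D) (U := fun b q => U b q ^ 2) hU2 h0 h1 (f ω))).2
      linarith
    change |W (f ω) * Real.exp (coinMean D U π (f ω) +
      coinMean D (fun b q => U b q ^ 2) π (f ω))| ≤ _
    rw [abs_of_nonneg (mul_nonneg (hW0 _) (Real.exp_pos _).le)]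
    exact mul_le_mul (hWC _) (Real.exp_le_exp.2 hb) (Real.exp_pos _).le hC0

/-- An exponential supermartingale bound for a sum of bounded variables, each depending on the past,
a fresh independent observation and a coin whose bias depends on both. -/
theorem integral_exp_sum_le_one {Ω 𝒵 : Type*} [mΩ : MeasurableSpace Ω] [MeasurableSpace 𝒵]
    {μ : Measure Ω} [IsProbabilityMeasure μ] {ℱ : Filtration ℕ mΩ} {D : Measure 𝒵}
    [IsProbabilityMeasure D] {n : ℕ} {obs : ℕ → Ω → 𝒵} {Q : ℕ → Ω → Bool}
    (hobs : ∀ i ∈ Finset.Icc 1 n, Measurable[ℱ i] (obs i))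
    (hQ : ∀ i ∈ Finset.Icc 1 n, Measurable[ℱ i] (Q i))
    (law : ∀ i ∈ Finset.Icc 1 n, μ.map (obs i) = D)
    (indep : ∀ i ∈ Finset.Icc 1 n,
      Indep (MeasurableSpace.comap (obs i) inferInstance) (ℱ (i - 1)) μ)
    {U : ℕ → Bool → Ω × 𝒵 → ℝ}
    (hU : ∀ i ∈ Finset.Icc 1 n, ∀ b, Measurable[(ℱ (i - 1)).prod inferInstance] (U i b))
    (hU1 : ∀ i ∈ Finset.Icc 1 n, ∀ b q, |U i b q| ≤ 1)
    {π : ℕ → Ω × 𝒵 → ℝ}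
    (hπ : ∀ i ∈ Finset.Icc 1 n, Measurable[(ℱ (i - 1)).prod inferInstance] (π i))
    (h0 : ∀ i ∈ Finset.Icc 1 n, ∀ q, 0 ≤ π i q) (h1 : ∀ i ∈ Finset.Icc 1 n, ∀ q, π i q ≤ 1)
    (hq : ∀ i ∈ Finset.Icc 1 n, ∀ᵐ ω ∂μ, U i true (ω, obs i ω) = U i false (ω, obs i ω) ∨
      (μ[({ω' | Q i ω' = true} : Set Ω).indicator (fun _ => (1 : ℝ)) |
        ℱ (i - 1) ⊔ MeasurableSpace.comap (obs i) inferInstance]) ω = π i (ω, obs i ω))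
    (t : ℕ) (ht : t ≤ n) :
    (∀ ω, ∑ i ∈ Finset.Ioc 0 t, (U i (Q i ω) (ω, obs i ω)
      - coinMean D (U i) (π i) ω - coinMean D (fun b q => U i b q ^ 2) (π i) ω) ≤ t * 3) ∧
    (Measurable[ℱ t] fun ω => ∑ i ∈ Finset.Ioc 0 t, (U i (Q i ω) (ω, obs i ω)
      - coinMean D (U i) (π i) ω - coinMean D (fun b q => U i b q ^ 2) (π i) ω)) ∧
    ∫ ω, Real.exp (∑ i ∈ Finset.Ioc 0 t, (U i (Q i ω) (ω, obs i ω)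
      - coinMean D (U i) (π i) ω - coinMean D (fun b q => U i b q ^ 2) (π i) ω)) ∂μ ≤ 1 := by
  have hU2 : ∀ i ∈ Finset.Icc 1 n, ∀ b q, |U i b q ^ 2| ≤ 1 := fun i hi b q => by
    rw [abs_pow]; exact pow_le_one₀ (abs_nonneg _) (hU1 i hi b q)
  have hm1 : ∀ i ∈ Finset.Icc 1 n, Measurable[ℱ (i - 1)] (coinMean D (U i) (π i)) := fun i hi =>
    @measurable_coinMean Ω 𝒵 (ℱ (i - 1)) _ D _ (U i) (hU i hi) (π i) (hπ i hi)
  have hm2 : ∀ i ∈ Finset.Icc 1 n,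
      Measurable[ℱ (i - 1)] (coinMean D (fun b q => U i b q ^ 2) (π i)) := fun i hi =>
    @measurable_coinMean Ω 𝒵 (ℱ (i - 1)) _ D _ _ (fun b => (hU i hi b).pow_const 2)
      (π i) (hπ i hi)
  have hbd : ∀ t ≤ n, ∀ ω, ∑ i ∈ Finset.Ioc 0 t, (U i (Q i ω) (ω, obs i ω)
      - coinMean D (U i) (π i) ω - coinMean D (fun b q => U i b q ^ 2) (π i) ω) ≤ t * 3 := by
    intro t ht ω
    have : ∀ i ∈ Finset.Ioc 0 t, (U i (Q i ω) (ω, obs i ω)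
        - coinMean D (U i) (π i) ω - coinMean D (fun b q => U i b q ^ 2) (π i) ω) ≤ 3 :=
      fun i hi' => by
        have hin : i ∈ Finset.Icc 1 n := by
          simp only [Finset.mem_Ioc, Finset.mem_Icc] at *; omega
        have a1 := (abs_le.1 (hU1 i hin (Q i ω) (ω, obs i ω))).2
        have a2 := (abs_le.1 (abs_coinMean_le (D := D) (hU1 i hin) (h0 i hin) (h1 i hin) ω)).1
        have a3 := (abs_le.1 (abs_coinMean_le (D := D) (hU2 i hin) (h0 i hin) (h1 i hin) ω)).1
        linarith
    simpa using Finset.sum_le_card_nsmul _ _ _ this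
  refine ⟨hbd t ht, ?_⟩
  induction t with
  | zero => simp
  | succ t ih =>
    obtain ⟨ihm, ihe⟩ := ih (by omega)
    have hi : t + 1 ∈ Finset.Icc 1 n := by simp; omega
    have hUm : ∀ b, Measurable[ℱ (t + 1)] fun ω => U (t + 1) b (ω, obs (t + 1) ω) := fun b => by
      have e1 : @Measurable Ω Ω (ℱ (t + 1)) (ℱ t) id :=
        measurable_id'' (ℱ.mono (Nat.le_succ t))
      exact (hU _ hi b).comp (e1.prodMk (hobs _ hi))
    have hUQ : Measurable[ℱ (t + 1)] fun ω => U (t + 1) (Q (t + 1) ω) (ω, obs (t + 1) ω) := by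
      have : (fun ω => U (t + 1) (Q (t + 1) ω) (ω, obs (t + 1) ω)) = fun ω =>
          if Q (t + 1) ω = true then U (t + 1) true (ω, obs (t + 1) ω)
            else U (t + 1) false (ω, obs (t + 1) ω) := by
        funext ω; cases Q (t + 1) ω <;> simp
      rw [this]
      exact Measurable.ite (hQ _ hi (measurableSet_singleton true)) (hUm true) (hUm false)
    have hsum : ∀ ω, ∑ i ∈ Finset.Ioc 0 (t + 1), (U i (Q i ω) (ω, obs i ω)
        - coinMean D (U i) (π i) ω - coinMean D (fun b q => U i b q ^ 2) (π i) ω)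
        = ∑ i ∈ Finset.Ioc 0 t, (U i (Q i ω) (ω, obs i ω)
        - coinMean D (U i) (π i) ω - coinMean D (fun b q => U i b q ^ 2) (π i) ω)
        + (U (t + 1) (Q (t + 1) ω) (ω, obs (t + 1) ω) - coinMean D (U (t + 1)) (π (t + 1)) ω
          - coinMean D (fun b q => U (t + 1) b q ^ 2) (π (t + 1)) ω) := fun ω => by
      rw [Finset.sum_Ioc_succ_top (Nat.zero_le t)]
    have hbound := hbd t (by omega)
    generalize hS : (fun ω => ∑ i ∈ Finset.Ioc 0 t, (U i (Q i ω) (ω, obs i ω)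
        - coinMean D (U i) (π i) ω - coinMean D (fun b q => U i b q ^ 2) (π i) ω)) = S at *
    have hS' : ∀ ω, ∑ i ∈ Finset.Ioc 0 t, (U i (Q i ω) (ω, obs i ω)
        - coinMean D (U i) (π i) ω - coinMean D (fun b q => U i b q ^ 2) (π i) ω) = S ω :=
      fun ω => congrFun hS ω
    simp only [hsum, hS'] at hbound ihe ⊢
    have hm1' : Measurable[ℱ t] (coinMean D (U (t + 1)) (π (t + 1))) := hm1 _ hi
    have hm2' : Measurable[ℱ t] (coinMean D (fun b q => U (t + 1) b q ^ 2) (π (t + 1))) :=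
      hm2 _ hi
    refine ⟨?_, ?_⟩
    · exact (ihm.mono (ℱ.mono (Nat.le_succ t)) le_rfl).add
        ((hUQ.sub (hm1'.mono (ℱ.mono (Nat.le_succ t)) le_rfl)).sub
          (hm2'.mono (ℱ.mono (Nat.le_succ t)) le_rfl))
    -- The compensators of step `t + 1` are known at time `t`, so they belong to the weight; the
    -- one-step bound then cancels them exactly and leaves `exp S`.
    · let W : Ω → ℝ := fun ω => Real.exp (S ω - coinMean D (U (t + 1)) (π (t + 1)) ω
          - coinMean D (fun b q => U (t + 1) b q ^ 2) (π (t + 1)) ω)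
      have hWm : Measurable[ℱ t] W := Real.measurable_exp.comp ((ihm.sub hm1').sub hm2')
      have hWC : ∀ ω, W ω ≤ Real.exp (t * 3 + 2) := fun ω => Real.exp_le_exp.2 (by
        have a2 := (abs_le.1 (abs_coinMean_le (D := D) (hU1 _ hi) (h0 _ hi) (h1 _ hi) ω)).1
        have a3 := (abs_le.1 (abs_coinMean_le (D := D) (hU2 _ hi) (h0 _ hi) (h1 _ hi) ω)).1
        have := hbound ω
        linarith)
      -- The past is encoded as the identity map into `Ω` carrying the σ-algebra `ℱ t`.
      have hindep : @IndepFun Ω Ω 𝒵 mΩ (ℱ t) _ (fun ω => ω) (obs (t + 1)) μ := by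
        refine Indep.symm ?_
        have := indep _ hi
        rwa [show MeasurableSpace.comap (fun ω : Ω => ω) (ℱ t) = ℱ t from
          MeasurableSpace.comap_id]
      have key := @integral_mul_exp_coin_le Ω Ω 𝒵 mΩ (ℱ t) _ μ _ (fun ω => ω)
        (measurable_id'' (ℱ.le t)) (obs (t + 1)) ((hobs _ hi).mono (ℱ.le _) le_rfl) D _
        (law _ hi) hindep (Q (t + 1)) ((hQ _ hi).mono (ℱ.le _) le_rfl) (U (t + 1))
        (hU _ hi) (hU1 _ hi) (π (t + 1)) (hπ _ hi) (h0 _ hi) (h1 _ hi)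
        (by
          rw [show MeasurableSpace.comap (fun ω : Ω => ω) (ℱ t) = ℱ t from
            MeasurableSpace.comap_id]
          exact hq _ hi) W hWm (fun _ => (Real.exp_pos _).le)
        _ hWC
      calc _ = ∫ ω, W ω * Real.exp (U (t + 1) (Q (t + 1) ω) (ω, obs (t + 1) ω)) ∂μ := by
            congr 1; funext ω; simp only [W]; rw [← Real.exp_add]; congr 1; ring
        _ ≤ _ := key
        _ = ∫ ω, Real.exp (S ω) ∂μ := by
            congr 1; funext ω; simp only [W]; rw [← Real.exp_add]; congr 1; ring
        _ ≤ 1 := ihe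

/-- The tail bound corresponding to `integral_exp_sum_le_one`. -/
theorem measureReal_le_exp_neg_of_integral_exp_le_one {Ω : Type*} [MeasurableSpace Ω]
    {μ : Measure Ω} [IsProbabilityMeasure μ] {S : Ω → ℝ} (hS : Measurable S) {C : ℝ}
    (hC : ∀ ω, S ω ≤ C) (h1 : ∫ ω, Real.exp (S ω) ∂μ ≤ 1) (t : ℝ) :
    μ.real {ω | t ≤ S ω} ≤ Real.exp (-t) := by
  have hint : Integrable (fun ω => Real.exp (S ω)) μ :=
    integrable_of_measurable_of_abs_le hS.exp (C := Real.exp C) fun ω => by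
      rw [Real.abs_exp]; exact Real.exp_le_exp.2 (hC ω)
  have := mul_meas_ge_le_integral_of_nonneg
    (Filter.Eventually.of_forall fun ω => (Real.exp_pos (S ω)).le) hint (Real.exp t)
  simp only [Real.exp_le_exp] at this
  rw [Real.exp_neg, ← one_div, le_div_iff₀' (Real.exp_pos t)]
  exact this.trans h1

/-! ### Epoch schedule -/

section Params

variable {p : Params} {N : ℕ}

theorem Params.ScheduleOK.tau_mono (hs : p.ScheduleOK) {i j : ℕ} (hij : i ≤ j) (hj : j ≤ p.M) :
    p.τ i ≤ p.τ j := by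
  induction j, hij using Nat.le_induction with
  | base => exact le_rfl
  | succ j hij ih => exact (ih (by omega)).trans (hs.tau_lt j (by omega)).le

/-- Linear growth is all that the union bound over epochs needs: it makes the sum of `1 / τ_m²` at
most one. -/
theorem Params.ScheduleOK.add_two_le_tau (hs : p.ScheduleOK) {m : ℕ} (h1 : 1 ≤ m)
    (hm : m ≤ p.M) : m + 2 ≤ p.τ m := by
  induction m, h1 using Nat.le_induction with
  | base => rw [hs.tau_one]
  | succ j hij ih =>
    have := ih (by omega)
    have := hs.tau_lt j (by omega)
    omega

theorem Params.ScheduleOK.tau_pred_le (hs : p.ScheduleOK) {j : ℕ} (hj : j ≤ p.M) :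
    p.τ (j - 1) ≤ p.τ j := hs.tau_mono (Nat.sub_le j 1) hj

end Params

/-! ### Weighted losses of an execution -/

namespace Trajectory

variable {𝒳 : Type*} (T : Trajectory 𝒳) (p : Params) (H : Finset (𝒳 → Bool))

/-- In epoch `j`, the label of `x` is queried at random. -/
def Querying (j : ℕ) (x : 𝒳) : Prop := 2 ≤ j ∧ x ∈ T.region p H j

open Classical in
/-- The probability with which the label of `x` is queried in epoch `j`, and `1` if no coin is
flipped. -/
def queryProb (j : ℕ) (x : 𝒳) : ℝ := if T.Querying p H j x then T.P j x else 1

open Classical in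
/-- The label given in epoch `j` to the example `z`, if it has nonzero weight. -/
def label (j : ℕ) (z : 𝒳 × Bool) : Bool :=
  if j ≤ 1 ∨ z.1 ∈ T.region p H j then z.2 else T.h j z.1

/-- The error of `g` with respect to the label used in epoch `j`. -/
def mistake (j : ℕ) (g : 𝒳 → Bool) (z : 𝒳 × Bool) : ℝ :=
  if g z.1 ≠ T.label p H j z then 1 else 0

open Classical in
/-- The weighted error of `g` on the example `z` of epoch `j` with query decision `q`. -/
def loss (j : ℕ) (g : 𝒳 → Bool) (q : Bool) (z : 𝒳 × Bool) : ℝ :=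
  if T.Querying p H j z.1 ∧ q = false then 0 else T.mistake p H j g z / T.queryProb p H j z.1

/-- The sum of the weighted errors of `g` over the first `m` epochs. -/
def cumLoss (m : ℕ) (g : 𝒳 → Bool) : ℝ :=
  ∑ j ∈ Finset.Icc 1 m, ∑ i ∈ Finset.Ioc (p.τ (j - 1)) (p.τ j),
    T.loss p H j g (T.Q i) (T.X i, T.Y i)

variable {T p H}

theorem A_succ_succ (m : ℕ) :
    T.A p H (m + 2) = goodSet p H (m + 1) (T.h (m + 2)) (T.sample p H (m + 1)) := by
  simp [A]

theorem mem_A_one {g : 𝒳 → Bool} : g ∈ T.A p H 1 ↔ g ∈ H := by simp [A]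

theorem A_subset {m : ℕ} {g : 𝒳 → Bool} (hg : g ∈ T.A p H m) : g ∈ H := by
  unfold A at hg
  split_ifs at hg with h
  · exact hg
  · exact hg.1

open Classical in
theorem loss_succ_succ (m : ℕ) (g : 𝒳 → Bool) (q : Bool) (z : 𝒳 × Bool) :
    T.loss p H (m + 2) g q z =
      if z.1 ∈ DIS (goodSet p H (m + 1) (T.h (m + 2)) (T.sample p H (m + 1))) then
        if q = true then if g z.1 ≠ z.2 then 1 / T.P (m + 2) z.1 else 0 else 0
      else if g z.1 ≠ T.h (m + 2) z.1 then 1 else 0 := by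
  simp only [loss, mistake, label, queryProb, Querying, region, A_succ_succ]
  by_cases hx : z.1 ∈ DIS (goodSet p H (m + 1) (T.h (m + 2)) (T.sample p H (m + 1)))
  · cases q
    · simp [hx]
    · simp [hx, ite_div]
  · simp [hx]

/-- The bridge from multisets to sums over examples. An unqueried example has weight zero, so its
placeholder label `true` is harmless. -/
theorem sum_sample (g : 𝒳 → Bool) (m : ℕ) :
    ((T.sample p H m).map fun e => if g e.1 ≠ e.2.1 then e.2.2 else 0).sum
      = T.cumLoss p H m g := by
  induction m with
  | zero => simp [sample, cumLoss]
  | succ m ih =>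
    have hc : T.cumLoss p H (m + 1) g = T.cumLoss p H m g +
        ∑ i ∈ Finset.Ioc (p.τ m) (p.τ (m + 1)), T.loss p H (m + 1) g (T.Q i) (T.X i, T.Y i) := by
      rw [cumLoss, Finset.sum_Icc_succ_top (by omega)]
      rfl
    rw [hc, ← ih]
    rcases m with _ | m
    · simp only [sample, Multiset.map_zero, Multiset.sum_zero, zero_add, Multiset.map_map]
      refine Finset.sum_congr rfl fun i _ => ?_
      simp [loss, mistake, label, queryProb, Querying]
    · simp only [sample, Multiset.map_add, Multiset.sum_add, Multiset.map_map]
      congr 1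
      refine Finset.sum_congr rfl fun i _ => ?_
      change _ = T.loss p H (m + 2) g (T.Q i) (T.X i, T.Y i)
      rw [loss_succ_succ, Function.comp_apply]
      split_ifs with h1 h2 <;> simp

theorem card_sample (hs : p.ScheduleOK) {m : ℕ} (hm : m ≤ p.M) :
    Multiset.card (T.sample p H m) = p.τ m := by
  induction m with
  | zero => simp [sample, hs.tau_zero]
  | succ m ih =>
    rcases m with _ | m
    · simp [sample, hs.tau_zero]
    · have : p.τ (m + 1) < p.τ (m + 2) := hs.tau_lt (m + 1) (by omega)
      simp only [sample, Multiset.card_add, ih (by omega), Multiset.card_map, Finset.card_val,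
        Nat.card_Ioc]
      exact Nat.add_sub_cancel' this.le

theorem empErr_sample (hs : p.ScheduleOK) {m : ℕ} (hm : m ≤ p.M) (g : 𝒳 → Bool) :
    empErr g (T.sample p H m) = T.cumLoss p H m g / p.τ m := by
  rw [empErr, sum_sample, card_sample hs hm]

end Trajectory

/-! ### Measurability of the random regions and losses -/

section Measurability

variable {𝒳 Ω : Type*}

/-- A random classifier takes values in a finite set, so every event splits over its fibres and no
σ-algebra on classifiers is needed. -/
theorem measurable_apply_of_mem {ι : Type*} [MeasurableSpace Ω] {H : Finset ι} {h : Ω → ι}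
    (hmem : ∀ ω, h ω ∈ H) (hh : ∀ g ∈ H, MeasurableSet {ω | h ω = g}) {F : ι → Ω → ℝ}
    (hF : ∀ g ∈ H, Measurable (F g)) : Measurable fun ω => F (h ω) ω := by
  intro s hs
  have : (fun ω => F (h ω) ω) ⁻¹' s = ⋃ g ∈ H, ({ω | h ω = g} ∩ F g ⁻¹' s) := by
    ext ω
    simp only [Set.mem_preimage, Set.mem_iUnion, Set.mem_inter_iff, Set.mem_ofPred_eq]
    constructor
    · exact fun hω => ⟨_, hmem ω, rfl, hω⟩
    · rintro ⟨g, -, rfl, hω⟩; exact hω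
  rw [this]
  exact Finset.measurableSet_biUnion _ fun g hg => (hh g hg).inter (hF g hg hs)

theorem Params.measurable_radius (p : Params) (N m : ℕ) : Measurable (p.radius N m) := by
  unfold Params.radius
  split_ifs
  · exact measurable_const
  · fun_prop

variable {p : Params} {H : Finset (𝒳 → Bool)} {T : Ω → Trajectory 𝒳}

theorem measurableSet_ne_apply [MeasurableSpace 𝒳] {g g' : 𝒳 → Bool}
    (hg : Measurable g) (hg' : Measurable g') :
    MeasurableSet {x | g x ≠ g' x} :=
  (measurableSet_eq_fun hg hg').compl

theorem measurableSet_mem_A [MeasurableSpace Ω] (hs : p.ScheduleOK) {j : ℕ} (hj : 1 ≤ j)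
    (hjM : j ≤ p.M + 1) (hmem : 2 ≤ j → ∀ ω, (T ω).h j ∈ H)
    (hh : 2 ≤ j → ∀ g ∈ H, MeasurableSet {ω | (T ω).h j = g})
    (hS : 2 ≤ j → ∀ g ∈ H, Measurable fun ω => (T ω).cumLoss p H (j - 1) g) (g : 𝒳 → Bool)
    (hg : g ∈ H) : MeasurableSet {ω | g ∈ (T ω).A p H j} := by
  obtain rfl | ⟨m, rfl⟩ : j = 1 ∨ ∃ m, j = m + 2 := by
    rcases j with _ | _ | m
    · omega
    · simp
    · exact Or.inr ⟨m, rfl⟩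
  · simp [Trajectory.mem_A_one]
  · simp only [Trajectory.A_succ_succ, goodSet, empReg,
      Trajectory.empErr_sample hs (show m + 1 ≤ p.M by omega), Set.mem_ofPred_eq, hg, true_and]
    have e0 := hS (by omega)
    have e1 : Measurable fun ω => (T ω).cumLoss p H (m + 1) ((T ω).h (m + 2)) :=
      measurable_apply_of_mem (F := fun g ω => (T ω).cumLoss p H (m + 1) g) (hmem (by omega))
        (hh (by omega)) e0
    exact measurableSet_le (((e0 g hg).div_const _).sub (e1.div_const _))
      (((p.measurable_radius _ _).comp (e1.div_const _)).const_mul _)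

/-- The graph of the random region is a finite union, over pairs of classifiers, of rectangles: both
belong to the version space, times the points where they differ. -/
theorem measurableSet_mem_region [MeasurableSpace 𝒳] [MeasurableSpace Ω]
    (hH : ∀ h ∈ H, Measurable h) {j : ℕ}
    (hA : ∀ g ∈ H, MeasurableSet {ω | g ∈ (T ω).A p H j}) :
    MeasurableSet {w : Ω × 𝒳 | w.2 ∈ (T w.1).region p H j} := by
  have : {w : Ω × 𝒳 | w.2 ∈ (T w.1).region p H j} = ⋃ g ∈ H, ⋃ g' ∈ H,
      ({ω | g ∈ (T ω).A p H j} ∩ {ω | g' ∈ (T ω).A p H j}) ×ˢ {x | g x ≠ g' x} := by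
    ext ⟨ω, x⟩
    simp only [Trajectory.region, DIS, Set.mem_ofPred_eq, Set.mem_iUnion, Set.mem_prod,
      Set.mem_inter_iff]
    constructor
    · rintro ⟨g, hg, g', hg', hne⟩
      exact ⟨g, Trajectory.A_subset hg, g', Trajectory.A_subset hg', ⟨hg, hg'⟩, hne⟩
    · rintro ⟨g, -, g', -, ⟨hg, hg'⟩, hne⟩
      exact ⟨g, hg, g', hg', hne⟩
  rw [this]
  exact Finset.measurableSet_biUnion _ fun g hg => Finset.measurableSet_biUnion _ fun g' hg' =>
    ((hA g hg).inter (hA g' hg')).prod (measurableSet_ne_apply (hH g hg) (hH g' hg'))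

theorem measurableSet_querying [MeasurableSpace 𝒳] [MeasurableSpace Ω] {j : ℕ}
    (hR : MeasurableSet {w : Ω × 𝒳 | w.2 ∈ (T w.1).region p H j}) :
    MeasurableSet {w : Ω × 𝒳 | (T w.1).Querying p H j w.2} := by
  by_cases hj : 2 ≤ j
  · simpa [Trajectory.Querying, hj] using hR
  · simp [Trajectory.Querying, hj]

theorem measurable_queryProb [MeasurableSpace 𝒳] [MeasurableSpace Ω] {j : ℕ}
    (hR : MeasurableSet {w : Ω × 𝒳 | w.2 ∈ (T w.1).region p H j})
    (hP : 2 ≤ j → Measurable fun w : Ω × 𝒳 => (T w.1).P j w.2) :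
    Measurable fun w : Ω × 𝒳 => (T w.1).queryProb p H j w.2 := by
  by_cases hj : 2 ≤ j
  · exact Measurable.ite (measurableSet_querying hR) (hP hj) measurable_const
  · simp [Trajectory.queryProb, Trajectory.Querying, hj]

open Classical in
theorem measurable_mistake [MeasurableSpace 𝒳] [MeasurableSpace Ω]
    (hH : ∀ h ∈ H, Measurable h) {j : ℕ}
    (hR : MeasurableSet {w : Ω × 𝒳 | w.2 ∈ (T w.1).region p H j})
    (hmem : 2 ≤ j → ∀ ω, (T ω).h j ∈ H)
    (hh : 2 ≤ j → ∀ g ∈ H, MeasurableSet {ω | (T ω).h j = g})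
    {g : 𝒳 → Bool} (hg : g ∈ H) :
    Measurable fun w : Ω × (𝒳 × Bool) => (T w.1).mistake p H j g w.2 := by
  have hfst : Measurable fun w : Ω × (𝒳 × Bool) => (w.1, w.2.1) := by fun_prop
  have hgm := hH g hg
  have s1 : MeasurableSet {w : Ω × (𝒳 × Bool) | g w.2.1 ≠ w.2.2} :=
    measurableSet_ne_apply (hgm.comp (by fun_prop)) (by fun_prop)
  by_cases hj : j ≤ 1
  · simp only [Trajectory.mistake, Trajectory.label, hj, true_or, if_true]
    exact Measurable.ite s1 measurable_const measurable_const
  · have s2 : MeasurableSet {w : Ω × (𝒳 × Bool) | g w.2.1 ≠ (T w.1).h j w.2.1} := by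
      have : {w : Ω × (𝒳 × Bool) | g w.2.1 ≠ (T w.1).h j w.2.1} =
          ⋃ g' ∈ H, {ω | (T ω).h j = g'} ×ˢ (Prod.fst ⁻¹' {x | g x ≠ g' x}) := by
        ext ⟨ω, z⟩
        simp only [Set.mem_ofPred_eq, Set.mem_iUnion, Set.mem_prod, Set.mem_preimage]
        constructor
        · exact fun hne => ⟨_, hmem (by omega) ω, rfl, hne⟩
        · rintro ⟨g', -, rfl, hne⟩; exact hne
      rw [this]
      exact Finset.measurableSet_biUnion _ fun g' hg' => (hh (by omega) g' hg').prod
        (measurable_fst (measurableSet_ne_apply hgm (hH g' hg')))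
    have s3 := hfst hR
    have : (fun w : Ω × (𝒳 × Bool) => (T w.1).mistake p H j g w.2) =
        fun w => if w ∈ ((fun w : Ω × (𝒳 × Bool) => (w.1, w.2.1)) ⁻¹'
            {w | w.2 ∈ (T w.1).region p H j}) ∩ {w | g w.2.1 ≠ w.2.2} ∪
          ((fun w : Ω × (𝒳 × Bool) => (w.1, w.2.1)) ⁻¹'
            {w | w.2 ∈ (T w.1).region p H j})ᶜ ∩ {w | g w.2.1 ≠ (T w.1).h j w.2.1}
          then 1 else 0 := by
      funext w
      by_cases hx : w.2.1 ∈ (T w.1).region p H j <;>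
        simp [Trajectory.mistake, Trajectory.label, hj, hx]
    rw [this]
    exact Measurable.ite ((s3.inter s1).union (s3.compl.inter s2)) measurable_const
      measurable_const

theorem measurable_loss [MeasurableSpace 𝒳] [MeasurableSpace Ω]
    (hH : ∀ h ∈ H, Measurable h) {j : ℕ}
    (hR : MeasurableSet {w : Ω × 𝒳 | w.2 ∈ (T w.1).region p H j})
    (hmem : 2 ≤ j → ∀ ω, (T ω).h j ∈ H)
    (hh : 2 ≤ j → ∀ g ∈ H, MeasurableSet {ω | (T ω).h j = g})
    (hP : 2 ≤ j → Measurable fun w : Ω × 𝒳 => (T w.1).P j w.2)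
    {g : 𝒳 → Bool} (hg : g ∈ H) (q : Bool) :
    Measurable fun w : Ω × (𝒳 × Bool) => (T w.1).loss p H j g q w.2 := by
  have hfst : Measurable fun w : Ω × (𝒳 × Bool) => (w.1, w.2.1) := by fun_prop
  have s1 : MeasurableSet {w : Ω × (𝒳 × Bool) | (T w.1).Querying p H j w.2.1 ∧ q = false} :=
    (hfst (measurableSet_querying hR)).inter (MeasurableSet.const _)
  unfold Trajectory.loss
  refine Measurable.ite s1 measurable_const ?_
  have h1 := measurable_mistake hH hR hmem hh hg
  have h2 := (measurable_queryProb hR hP).comp hfst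
  exact h1.fun_div h2

theorem measurable_apply_coin {𝒵 : Type*} [MeasurableSpace Ω] {F : Bool → 𝒵 → ℝ} {Q : Ω → Bool}
    {z : Ω → 𝒵} (hQ : Measurable Q) (hF : ∀ b, Measurable fun ω => F b (z ω)) :
    Measurable fun ω => F (Q ω) (z ω) := by
  have : (fun ω => F (Q ω) (z ω)) = fun ω => if Q ω = true then F true (z ω)
      else F false (z ω) := by
    funext ω; cases Q ω <;> simp
  rw [this]
  exact Measurable.ite (hQ (measurableSet_singleton true)) (hF true) (hF false)

end Measurability

section Run

variable {𝒳 Ω : Type*} [MeasurableSpace 𝒳] [mΩ : MeasurableSpace Ω]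
  {D : Measure (𝒳 × Bool)} {H : Finset (𝒳 → Bool)} {p : Params}
  {μ : Measure Ω} {ℱ : Filtration ℕ mΩ} {T : Ω → Trajectory 𝒳}

/-- The measurability of earlier losses is an assumption here because the two facts are proved
alternately: the losses up to epoch `j - 1` determine `D_j`, which determines the losses of epoch
`j`. -/
theorem IsRun.measurableSet_region_of_cumLoss (hrun : IsRun p H D μ ℱ T)
    (hH : ∀ h ∈ H, Measurable h) (hs : p.ScheduleOK) {j : ℕ} (hj : 1 ≤ j) (hjM : j ≤ p.M)
    (hS : 2 ≤ j → ∀ g ∈ H, Measurable[ℱ (p.τ (j - 1))] fun ω => (T ω).cumLoss p H (j - 1) g) :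
    MeasurableSet[(ℱ (p.τ (j - 1))).prod inferInstance]
      {w : Ω × 𝒳 | w.2 ∈ (T w.1).region p H j} :=
  @measurableSet_mem_region 𝒳 Ω p H T _ (ℱ (p.τ (j - 1))) hH j
    (@measurableSet_mem_A 𝒳 Ω p H T (ℱ (p.τ (j - 1))) hs j hj (by omega)
      (fun h => hrun.erm_mem j (by simp; omega))
      (fun h => hrun.measurable_erm j (by simp; omega)) hS)

theorem IsRun.measurable_loss_of_region (hrun : IsRun p H D μ ℱ T)
    (hH : ∀ h ∈ H, Measurable h) {j : ℕ} (hjM : j ≤ p.M)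
    (hR : MeasurableSet[(ℱ (p.τ (j - 1))).prod inferInstance]
      {w : Ω × 𝒳 | w.2 ∈ (T w.1).region p H j}) {g : 𝒳 → Bool} (hg : g ∈ H) (q : Bool) :
    Measurable[(ℱ (p.τ (j - 1))).prod inferInstance]
      fun w : Ω × (𝒳 × Bool) => (T w.1).loss p H j g q w.2 :=
  @measurable_loss 𝒳 Ω p H T _ (ℱ (p.τ (j - 1))) hH j hR
    (fun h => hrun.erm_mem j (by simp; omega))
    (fun h => hrun.measurable_erm j (by simp; omega))
    (fun h => hrun.measurable_prob j (by simp; omega)) g hg q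

theorem IsRun.measurable_cumLoss (hrun : IsRun p H D μ ℱ T)
    (hH : ∀ h ∈ H, Measurable h) (hs : p.ScheduleOK) {m : ℕ} (hm : m ≤ p.M) {g : 𝒳 → Bool}
    (hg : g ∈ H) : Measurable[ℱ (p.τ m)] fun ω => (T ω).cumLoss p H m g := by
  induction m generalizing g with
  | zero => simp [Trajectory.cumLoss]
  | succ m ih =>
    have hc : (fun ω => (T ω).cumLoss p H (m + 1) g) = fun ω => (T ω).cumLoss p H m g +
        ∑ i ∈ Finset.Ioc (p.τ m) (p.τ (m + 1)),
          (T ω).loss p H (m + 1) g ((T ω).Q i) (obs T i ω) := by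
      funext ω
      rw [Trajectory.cumLoss, Finset.sum_Icc_succ_top (by omega)]
      rfl
    have hle : p.τ m ≤ p.τ (m + 1) := (hs.tau_lt m (by omega)).le
    rw [hc]
    refine ((ih (by omega) hg).mono (ℱ.mono hle) le_rfl).add
      (Finset.measurable_sum _ fun i hi => ?_)
    have hR := hrun.measurableSet_region_of_cumLoss hH hs (j := m + 1) (by omega) hm
      fun _ g hg => ih (by omega) hg
    have hL := fun q => hrun.measurable_loss_of_region hH hm hR hg q
    have hi' := Finset.mem_Ioc.1 hi
    have hin : i ∈ Finset.Icc 1 p.n := by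
      have := hs.tau_M_le
      have := hs.tau_mono hm le_rfl
      simp; omega
    have e1 : @Measurable Ω Ω (ℱ i) (ℱ (p.τ m)) (fun ω => ω) := measurable_id'' (ℱ.mono hi'.1.le)
    have e2 : ∀ q, Measurable[ℱ i] fun ω => (T ω).loss p H (m + 1) g q (obs T i ω) := fun q =>
      @Measurable.comp Ω (Ω × (𝒳 × Bool)) ℝ (ℱ i) ((ℱ (p.τ m)).prod inferInstance) _
        (fun w => (T w.1).loss p H (m + 1) g q w.2) (fun ω => (ω, obs T i ω)) (hL q)
        (e1.prodMk (hrun.measurable_obs i hin))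
    have e3 := @measurable_apply_coin Ω (Ω × (𝒳 × Bool)) (ℱ i)
      (fun q w => (T w.1).loss p H (m + 1) g q w.2) (fun ω => (T ω).Q i)
      (fun ω => (ω, obs T i ω)) (hrun.measurable_query i hin) e2
    exact e3.mono (ℱ.mono hi'.2) le_rfl

theorem IsRun.measurableSet_region (hrun : IsRun p H D μ ℱ T)
    (hH : ∀ h ∈ H, Measurable h) (hs : p.ScheduleOK) {j : ℕ} (hj : 1 ≤ j) (hjM : j ≤ p.M) :
    MeasurableSet[(ℱ (p.τ (j - 1))).prod inferInstance]
      {w : Ω × 𝒳 | w.2 ∈ (T w.1).region p H j} :=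
  hrun.measurableSet_region_of_cumLoss hH hs hj hjM fun _ _ hg =>
    hrun.measurable_cumLoss hH hs (by omega) hg

theorem IsRun.measurable_loss (hrun : IsRun p H D μ ℱ T)
    (hH : ∀ h ∈ H, Measurable h) (hs : p.ScheduleOK) {j : ℕ} (hj : 1 ≤ j) (hjM : j ≤ p.M)
    {g : 𝒳 → Bool} (hg : g ∈ H) (q : Bool) :
    Measurable[(ℱ (p.τ (j - 1))).prod inferInstance]
      fun w : Ω × (𝒳 × Bool) => (T w.1).loss p H j g q w.2 :=
  hrun.measurable_loss_of_region hH hjM (hrun.measurableSet_region hH hs hj hjM) hg q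

theorem IsRun.measurable_queryProb (hrun : IsRun p H D μ ℱ T)
    (hH : ∀ h ∈ H, Measurable h) (hs : p.ScheduleOK) {j : ℕ} (hj : 1 ≤ j) (hjM : j ≤ p.M) :
    Measurable[(ℱ (p.τ (j - 1))).prod inferInstance]
      fun w : Ω × 𝒳 => (T w.1).queryProb p H j w.2 :=
  @ActiveCover.measurable_queryProb 𝒳 Ω p H T _ (ℱ (p.τ (j - 1))) j
    (hrun.measurableSet_region hH hs hj hjM) (fun h => hrun.measurable_prob j (by simp; omega))

theorem IsRun.measurable_Pmin (hrun : IsRun p H D μ ℱ T)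
    (hH : ∀ h ∈ H, Measurable h) (hs : p.ScheduleOK) {j : ℕ} (hj : 2 ≤ j) (hjM : j ≤ p.M) :
    Measurable[ℱ (p.τ (j - 1))] fun ω => (T ω).Pmin p H j := by
  have e1 : Measurable[ℱ (p.τ (j - 1))] fun ω => (T ω).cumLoss p H (j - 1) ((T ω).h j) :=
    @measurable_apply_of_mem Ω _ (ℱ (p.τ (j - 1))) H (fun ω => (T ω).h j)
      (hrun.erm_mem j (by simp; omega)) (hrun.measurable_erm j (by simp; omega))
      (fun g ω => (T ω).cumLoss p H (j - 1) g)
      (fun g hg => hrun.measurable_cumLoss hH hs (by omega) hg)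
  simp only [Trajectory.Pmin, Trajectory.empErr_sample hs (show j - 1 ≤ p.M by omega)]
  exact Measurable.min (measurable_const.div
    ((Real.continuous_sqrt.measurable.comp
      (((e1.div_const _).const_mul _).div_const _)).add_const _)) measurable_const

end Run

/-! ### Size of the importance weights -/

namespace Params

variable {p : Params} {N : ℕ}

/-- The logarithmic factor `log (N / δ) + log τ_m` of `ε_m`. -/
def logTerm (p : Params) (N m : ℕ) : ℝ := Real.log (N / p.δ) + Real.log (p.τ m)

theorem ScheduleOK.three_le_tau (hs : p.ScheduleOK) {m : ℕ} (h1 : 1 ≤ m) (hm : m ≤ p.M) :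
    (3 : ℝ) ≤ p.τ m := by
  have := hs.tau_mono h1 hm
  rw [hs.tau_one] at this
  exact_mod_cast this

theorem ScheduleOK.one_le_log_tau (hs : p.ScheduleOK) {m : ℕ} (h1 : 1 ≤ m) (hm : m ≤ p.M) :
    1 ≤ Real.log (p.τ m) := by
  have := hs.three_le_tau h1 hm
  rw [Real.le_log_iff_exp_le (by linarith)]
  have := Real.exp_one_lt_d9
  linarith

theorem ScheduleOK.log_tau_le (hs : p.ScheduleOK) {i j : ℕ} (h1 : 1 ≤ i) (hij : i ≤ j)
    (hj : j ≤ p.M) : Real.log (p.τ i) ≤ Real.log (p.τ j) := by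
  have := hs.three_le_tau h1 (hij.trans hj)
  exact Real.log_le_log (by linarith) (by exact_mod_cast hs.tau_mono hij hj)

theorem tau_mul_eps (hs : p.ScheduleOK) {m : ℕ} (h1 : 1 ≤ m) (hm : m ≤ p.M) :
    p.τ m * p.eps N m = 32 * p.logTerm N m := by
  have := hs.three_le_tau h1 hm
  rw [eps, logTerm]
  field_simp

theorem three_le_logTerm (hs : p.ScheduleOK) (hN : 2 ≤ Real.log (N / p.δ)) {m : ℕ} (h1 : 1 ≤ m)
    (hm : m ≤ p.M) : 3 ≤ p.logTerm N m := by
  have := hs.one_le_log_tau h1 hm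
  rw [logTerm]; linarith

theorem eps_pos (hs : p.ScheduleOK) (hN : 2 ≤ Real.log (N / p.δ)) {m : ℕ} (h1 : 1 ≤ m)
    (hm : m ≤ p.M) : 0 < p.eps N m := by
  have h3 := three_le_logTerm hs hN h1 hm
  have h4 := hs.three_le_tau h1 hm
  have := tau_mul_eps (N := N) hs h1 hm
  by_contra h
  push Not at h
  nlinarith

/-- `τ_m ε_m` is 32 times a logarithmic term that increases with `m`. This transfers conditions
stated with `n ε_M` to every epoch. -/
theorem tau_mul_eps_le (hs : p.ScheduleOK) (hN : 2 ≤ Real.log (N / p.δ)) {m : ℕ} (h1 : 1 ≤ m)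
    (hm : m ≤ p.M) : p.τ m * p.eps N m ≤ p.n * p.eps N p.M := by
  have e1 : p.τ m * p.eps N m ≤ p.τ p.M * p.eps N p.M := by
    rw [tau_mul_eps hs h1 hm, tau_mul_eps hs hs.one_le_M le_rfl, logTerm, logTerm]
    have := hs.log_tau_le h1 hm le_rfl
    linarith
  have e2 : (p.τ p.M : ℝ) ≤ p.n := by exact_mod_cast hs.tau_M_le
  exact e1.trans (mul_le_mul_of_nonneg_right e2 (eps_pos hs hN hs.one_le_M le_rfl).le)

theorem le_n_mul_eps (hs : p.ScheduleOK) (hN : 2 ≤ Real.log (N / p.δ)) :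
    96 ≤ p.n * p.eps N p.M := by
  have h1 := tau_mul_eps_le hs hN le_rfl hs.one_le_M
  rw [tau_mul_eps hs le_rfl hs.one_le_M] at h1
  have := three_le_logTerm hs hN le_rfl hs.one_le_M
  linarith

end Params

namespace Trajectory

variable {𝒳 : Type*} {T : Trajectory 𝒳} {p : Params} {H : Finset (𝒳 → Bool)}

/-- An upper bound on the inverses of the query probabilities in epoch `j`. -/
def invPmin (T : Trajectory 𝒳) (p : Params) (H : Finset (𝒳 → Bool)) (j : ℕ) : ℝ :=
  if j ≤ 1 then 1 else 1 / T.Pmin p H j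

theorem invPmin_one : T.invPmin p H 1 = 1 := by simp [invPmin]

/-- The cumulative weighted error of the empirical risk minimizer after `m` epochs. -/
def minLoss (T : Trajectory 𝒳) (p : Params) (H : Finset (𝒳 → Bool)) (m : ℕ) : ℝ :=
  T.cumLoss p H m (T.h (m + 1))

theorem mistake_nonneg (j : ℕ) (g : 𝒳 → Bool) (z : 𝒳 × Bool) : 0 ≤ T.mistake p H j g z := by
  unfold mistake; split_ifs <;> norm_num

theorem mistake_le_one (j : ℕ) (g : 𝒳 → Bool) (z : 𝒳 × Bool) : T.mistake p H j g z ≤ 1 := by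
  unfold mistake; split_ifs <;> norm_num

theorem one_div_min {a b : ℝ} (ha : 0 < a) (hb : 0 < b) : 1 / min a b = max (1 / a) (1 / b) := by
  rcases le_total a b with h | h
  · rw [min_eq_left h, max_eq_left (one_div_le_one_div_of_le ha h)]
  · rw [min_eq_right h, max_eq_right (one_div_le_one_div_of_le hb h)]

theorem Pmin_pos_and_invPmin_eq (hs : p.ScheduleOK) (hc : 1 ≤ p.c₃)
    {m : ℕ} (h1 : 1 ≤ m) (hm : m < p.M) :
    0 < T.Pmin p H (m + 1) ∧ T.invPmin p H (m + 1) =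
      max ((√(T.minLoss p H m / (p.n * p.eps H.card p.M)) + Real.log (p.τ m)) / p.c₃) 2 := by
  have hτ := hs.three_le_tau h1 hm.le
  have hl := hs.one_le_log_tau h1 hm.le
  have e1 : T.Pmin p H (m + 1) =
      min (p.c₃ / (√(T.minLoss p H m / (p.n * p.eps H.card p.M)) + Real.log (p.τ m))) (1 / 2) := by
    rw [Pmin, Nat.add_sub_cancel, empErr_sample hs hm.le, mul_div_cancel₀ _ (by linarith), minLoss]
  have h0 : 0 < p.c₃ / (√(T.minLoss p H m / (p.n * p.eps H.card p.M)) + Real.log (p.τ m)) :=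
    div_pos (by linarith) (by positivity)
  refine ⟨?_, ?_⟩
  · rw [e1]; exact lt_min h0 (by norm_num)
  · rw [invPmin, if_neg (by omega), e1, one_div_min h0 (by norm_num), one_div_div]
    norm_num

theorem one_le_invPmin (hs : p.ScheduleOK) (hc : 1 ≤ p.c₃) {j : ℕ} (hj : j ≤ p.M) :
    1 ≤ T.invPmin p H j := by
  rcases j with _ | _ | m
  · simp [invPmin]
  · simp [invPmin]
  · rw [(Pmin_pos_and_invPmin_eq (T := T) (H := H) hs hc (by omega) (by omega)).2]
    exact le_trans (by norm_num) (le_max_right _ _)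

/-- The pointwise properties of an execution. -/
structure IsValid [MeasurableSpace 𝒳] (T : Trajectory 𝒳) (p : Params) (H : Finset (𝒳 → Bool))
    (D : Measure (𝒳 × Bool)) : Prop where
  erm_mem : ∀ m ∈ Finset.Icc 2 (p.M + 1), T.h m ∈ H
  erm_min : ∀ m ∈ Finset.Icc 2 (p.M + 1), ∀ g ∈ H,
    empErr (T.h m) (T.sample p H (m - 1)) ≤ empErr g (T.sample p H (m - 1))
  feasible : ∀ m ∈ Finset.Icc 2 p.M, T.IsFeasible p H D m (T.P m)

variable [MeasurableSpace 𝒳] {D : Measure (𝒳 × Bool)}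

theorem IsValid.queryProb_mem_Icc (hv : T.IsValid p H D) {j : ℕ} (hj : j ≤ p.M) (x : 𝒳) :
    0 ≤ T.queryProb p H j x ∧ T.queryProb p H j x ≤ 1 := by
  unfold queryProb
  split_ifs with h
  · exact (hv.feasible j (Finset.mem_Icc.2 ⟨h.1, hj⟩)).mem_Icc x
  · norm_num

theorem IsValid.loss_nonneg (hv : T.IsValid p H D) {j : ℕ} (hj : j ≤ p.M) (g : 𝒳 → Bool)
    (q : Bool) (z : 𝒳 × Bool) : 0 ≤ T.loss p H j g q z := by
  unfold loss
  split_ifs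
  · exact le_rfl
  · exact div_nonneg (mistake_nonneg _ _ _) (hv.queryProb_mem_Icc hj _).1

theorem IsValid.cumLoss_mono (hv : T.IsValid p H D) {i j : ℕ} (hij : i ≤ j) (hj : j ≤ p.M)
    (g : 𝒳 → Bool) : T.cumLoss p H i g ≤ T.cumLoss p H j g := by
  refine Finset.sum_le_sum_of_subset_of_nonneg (Finset.Icc_subset_Icc_right hij) fun k hk _ => ?_
  exact Finset.sum_nonneg fun _ _ =>
    hv.loss_nonneg ((Finset.mem_Icc.1 hk).2.trans hj) _ _ _

theorem IsValid.cumLoss_nonneg (hv : T.IsValid p H D) {j : ℕ} (hj : j ≤ p.M)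
    (g : 𝒳 → Bool) : 0 ≤ T.cumLoss p H j g :=
  Finset.sum_nonneg fun _ hk => Finset.sum_nonneg fun _ _ =>
    hv.loss_nonneg ((Finset.mem_Icc.1 hk).2.trans hj) _ _ _

theorem IsValid.minLoss_le (hv : T.IsValid p H D) (hs : p.ScheduleOK) {m : ℕ} (h1 : 1 ≤ m)
    (hm : m ≤ p.M) {g : 𝒳 → Bool} (hg : g ∈ H) : T.minLoss p H m ≤ T.cumLoss p H m g := by
  have h := hv.erm_min (m + 1) (Finset.mem_Icc.2 ⟨by omega, by omega⟩) g hg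
  rw [Nat.add_sub_cancel, empErr_sample hs hm, empErr_sample hs hm,
    div_le_div_iff_of_pos_right (by linarith [hs.three_le_tau h1 hm])] at h
  exact h

theorem IsValid.erm_mem_succ (hv : T.IsValid p H D) {m : ℕ} (h1 : 1 ≤ m) (hm : m ≤ p.M) :
    T.h (m + 1) ∈ H := hv.erm_mem (m + 1) (Finset.mem_Icc.2 ⟨by omega, by omega⟩)

/-- The later minimizer had at least the minimal loss at the earlier time, and losses only
accumulate. -/
theorem IsValid.minLoss_mono (hv : T.IsValid p H D) (hs : p.ScheduleOK) {i j : ℕ} (h1 : 1 ≤ i)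
    (hij : i ≤ j) (hj : j ≤ p.M) : T.minLoss p H i ≤ T.minLoss p H j :=
  (hv.minLoss_le hs h1 (hij.trans hj) (hv.erm_mem_succ (h1.trans hij) hj)).trans
    (hv.cumLoss_mono hij hj _)

/-- `minLoss` and `log τ` grow, so the floor on the query probabilities never rises. A bound on the
weights of epoch `m` therefore holds in all earlier epochs. -/
theorem IsValid.invPmin_mono (hv : T.IsValid p H D) (hs : p.ScheduleOK)
    (hc : 1 ≤ p.c₃) (hN : 2 ≤ Real.log (H.card / p.δ)) {i j : ℕ} (h1 : 1 ≤ i) (hij : i ≤ j)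
    (hj : j ≤ p.M) : T.invPmin p H i ≤ T.invPmin p H j := by
  obtain rfl | h2 := h1.eq_or_lt
  · rw [invPmin_one]; exact one_le_invPmin (T := T) (H := H) hs hc hj
  obtain ⟨i, rfl⟩ : ∃ k, i = k + 1 := ⟨i - 1, by omega⟩
  obtain ⟨j, rfl⟩ : ∃ k, j = k + 1 := ⟨j - 1, by omega⟩
  rw [(Pmin_pos_and_invPmin_eq (T := T) (H := H) hs hc (by omega) (by omega)).2,
    (Pmin_pos_and_invPmin_eq (T := T) (H := H) hs hc (by omega) (by omega)).2]
  have e1 := hv.minLoss_mono hs (show 1 ≤ i by omega) (show i ≤ j by omega) (by omega)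
  have e2 := hs.log_tau_le (show 1 ≤ i by omega) (show i ≤ j by omega) (by omega)
  have e3 := Params.le_n_mul_eps hs hN
  have e4 : √(T.minLoss p H i / (p.n * p.eps H.card p.M)) ≤
      √(T.minLoss p H j / (p.n * p.eps H.card p.M)) :=
    Real.sqrt_le_sqrt (div_le_div_of_nonneg_right e1 (by linarith))
  exact max_le_max (div_le_div_of_nonneg_right (by linarith) (by linarith)) le_rfl

theorem IsValid.queryProb_pos_and_inv_le (hv : T.IsValid p H D) (hs : p.ScheduleOK)
    (hc : 1 ≤ p.c₃) {j : ℕ} (hj : j ≤ p.M) (x : 𝒳) :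
    0 < T.queryProb p H j x ∧ 1 / T.queryProb p H j x ≤ T.invPmin p H j := by
  unfold queryProb
  split_ifs with h
  · obtain ⟨m, rfl⟩ : ∃ k, j = k + 1 := ⟨j - 1, by have := h.1; omega⟩
    have h2 := h.1
    have e0 := (Pmin_pos_and_invPmin_eq (T := T) (H := H) hs hc (show 1 ≤ m by omega) (by omega)).1
    have e1 := (hv.feasible _ (Finset.mem_Icc.2 ⟨h2, hj⟩)).min_le x h.2
    refine ⟨e0.trans_le e1, ?_⟩
    rw [invPmin, if_neg (by omega)]
    exact one_div_le_one_div_of_le e0 e1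
  · simpa using one_le_invPmin (T := T) (H := H) hs hc hj

/-- Both losses share the factor `1 / queryProb`, and mistakes are 0 or 1, so the numerator is one
of `0`, `a`, `b`, `a + b`. -/
theorem IsValid.abs_loss_comb_le (hv : T.IsValid p H D) (hs : p.ScheduleOK)
    (hc : 1 ≤ p.c₃) {j : ℕ} (hj : j ≤ p.M) {a b : ℝ} (ha : |a| ≤ 1) (hb : |b| ≤ 1)
    (hab : |a + b| ≤ 1) (g g' : 𝒳 → Bool) (q : Bool) (z : 𝒳 × Bool) :
    |a * T.loss p H j g q z + b * T.loss p H j g' q z| ≤ T.invPmin p H j := by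
  have h1 := one_le_invPmin (T := T) (H := H) hs hc hj
  obtain ⟨h2, h3⟩ := hv.queryProb_pos_and_inv_le hs hc hj z.1
  unfold loss
  split_ifs
  · simp; linarith
  · have e : a * (T.mistake p H j g z / T.queryProb p H j z.1) +
        b * (T.mistake p H j g' z / T.queryProb p H j z.1) =
        (a * T.mistake p H j g z + b * T.mistake p H j g' z) * (1 / T.queryProb p H j z.1) := by
      ring
    have e2 : |a * T.mistake p H j g z + b * T.mistake p H j g' z| ≤ 1 := by
      unfold mistake; split_ifs <;> simp [ha, hb, hab]
    rw [e, abs_mul, abs_of_pos (one_div_pos.2 h2)]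
    exact (mul_le_of_le_one_left (one_div_pos.2 h2).le e2).trans h3

theorem IsValid.cumLoss_le (hv : T.IsValid p H D) (hs : p.ScheduleOK)
    (hc : 1 ≤ p.c₃) (hN : 2 ≤ Real.log (H.card / p.δ)) {m : ℕ}
    (hm : m ≤ p.M) (g : 𝒳 → Bool) : T.cumLoss p H m g ≤ p.τ m * T.invPmin p H m := by
  have key : ∀ k ≤ m, T.cumLoss p H k g ≤ p.τ k * T.invPmin p H m := by
    intro k hk
    induction k with
    | zero => simp [cumLoss, hs.tau_zero]
    | succ k ih =>
      have hc' : T.cumLoss p H (k + 1) g = T.cumLoss p H k g + ∑ i ∈ Finset.Ioc (p.τ k)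
          (p.τ (k + 1)), T.loss p H (k + 1) g (T.Q i) (T.X i, T.Y i) := by
        rw [cumLoss, Finset.sum_Icc_succ_top (by omega)]
        rfl
      have hle : p.τ k ≤ p.τ (k + 1) := (hs.tau_lt k (by omega)).le
      have hb : ∑ i ∈ Finset.Ioc (p.τ k) (p.τ (k + 1)),
          T.loss p H (k + 1) g (T.Q i) (T.X i, T.Y i) ≤
          ((p.τ (k + 1) : ℝ) - p.τ k) * T.invPmin p H m := by
        have := Finset.sum_le_card_nsmul (Finset.Ioc (p.τ k) (p.τ (k + 1)))
          (fun i => T.loss p H (k + 1) g (T.Q i) (T.X i, T.Y i)) (T.invPmin p H m) fun i _ => by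
            have := hv.abs_loss_comb_le hs hc (j := k + 1) (by omega) (a := 1) (b := 0)
              (by simp) (by simp) (by simp) g g (T.Q i) (T.X i, T.Y i)
            simp only [one_mul, zero_mul, add_zero] at this
            exact (le_abs_self _).trans (this.trans
              (hv.invPmin_mono hs hc hN (by omega) hk hm))
        rwa [Nat.card_Ioc, nsmul_eq_mul, Nat.cast_sub hle] at this
      rw [hc']
      have := ih (by omega)
      linarith
  exact key m le_rfl

/-- This confines the useful scales `k` to a range of length `3 τ_m`. By induction, weights at most
`τ_m` give `minLoss ≤ τ_m²`; since `n ε_M ≥ 96`, the root is at most `τ_m / 2`, and so is the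
logarithm. -/
theorem IsValid.invPmin_le_tau (hv : T.IsValid p H D) (hs : p.ScheduleOK)
    (hc : 1 ≤ p.c₃) (hN : 2 ≤ Real.log (H.card / p.δ)) {m : ℕ} (h1 : 1 ≤ m)
    (hm : m ≤ p.M) : T.invPmin p H m ≤ p.τ m := by
  induction m, h1 using Nat.le_induction with
  | base => rw [invPmin_one, hs.tau_one]; norm_num
  | succ m h1 ih =>
    have hi := ih (by omega)
    rw [(Pmin_pos_and_invPmin_eq (T := T) (H := H) hs hc h1 (by omega)).2]
    have hτ := hs.three_le_tau h1 (show m ≤ p.M by omega)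
    have hτ' : (p.τ m : ℝ) ≤ p.τ (m + 1) := by exact_mod_cast (hs.tau_lt m (by omega)).le
    have hn := Params.le_n_mul_eps hs hN
    have hmin : T.minLoss p H m ≤ p.τ m * p.τ m :=
      (hv.cumLoss_le hs hc hN (by omega) _).trans
        (mul_le_mul_of_nonneg_left hi (by linarith))
    have hsq : √(T.minLoss p H m / (p.n * p.eps H.card p.M)) ≤ p.τ m / 2 := by
      refine Real.sqrt_le_iff.2 ⟨by linarith, ?_⟩
      rw [div_le_iff₀ (by linarith)]
      nlinarith [mul_self_nonneg (p.τ m : ℝ)]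
    have hlog : Real.log (p.τ m) ≤ p.τ m / 2 := by
      have e1 := Real.log_le_sub_one_of_pos (x := p.τ m / Real.exp 1) (by positivity)
      rw [Real.log_div (by linarith) (Real.exp_pos 1).ne', Real.log_exp] at e1
      have e2 : (p.τ m : ℝ) / Real.exp 1 ≤ p.τ m / 2 :=
        div_le_div_of_nonneg_left (by linarith) (by norm_num) (by
          have := Real.exp_one_gt_d9; linarith)
      linarith
    have hnn : 0 ≤ √(T.minLoss p H m / (p.n * p.eps H.card p.M)) + Real.log (p.τ m) := by
      have := hs.one_le_log_tau h1 (show m ≤ p.M by omega)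
      positivity
    exact max_le ((div_le_self hnn hc).trans (by linarith)) (by linarith)

/-- The purpose of `P_min`: the largest weight contributes to the deviation bound no more than the
order of `Δ_m`. The bound rests on `τ_m ε_m ≤ n ε_M` and the monotonicity of `minLoss`; the factor 2
accounts for the cap `1/2` in `P_min`. -/
theorem IsValid.eps_mul_invPmin_le (hv : T.IsValid p H D) (hs : p.ScheduleOK)
    (hc : 1 ≤ p.c₃) (hN : 2 ≤ Real.log (H.card / p.δ)) {m : ℕ} (h1 : 1 ≤ m)
    (hm : m ≤ p.M) : p.eps H.card m * T.invPmin p H m ≤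
      √(p.eps H.card m * (T.minLoss p H m / p.τ m))
        + 2 * p.eps H.card m * Real.log (p.τ m) := by
  have he := Params.eps_pos hs hN h1 hm
  have hl := hs.one_le_log_tau h1 hm
  have hs0 := Real.sqrt_nonneg (p.eps H.card m * (T.minLoss p H m / p.τ m))
  have hel := mul_le_mul_of_nonneg_left hl he.le
  obtain rfl | h2 := h1.eq_or_lt
  · rw [invPmin_one]; nlinarith
  obtain ⟨i, rfl⟩ : ∃ k, m = k + 1 := ⟨m - 1, by omega⟩
  rw [(Pmin_pos_and_invPmin_eq (T := T) (H := H) hs hc (by omega) (by omega)).2]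
  have hτ := hs.three_le_tau h1 hm
  have hn := Params.tau_mul_eps_le hs hN h1 hm
  have hmono := hv.minLoss_mono hs (show 1 ≤ i by omega) (Nat.le_succ i) hm
  have hlm := hs.log_tau_le (show 1 ≤ i by omega) (Nat.le_succ i) hm
  have hli := hs.one_le_log_tau (show 1 ≤ i by omega) (show i ≤ p.M by omega)
  have hL0 : 0 ≤ T.minLoss p H (i + 1) := hv.cumLoss_nonneg hm _
  have hpos : 0 < p.τ (i + 1) * p.eps H.card (i + 1) := by positivity
  have hsq : √(T.minLoss p H i / (p.n * p.eps H.card p.M)) ≤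
      √(T.minLoss p H (i + 1) / (p.τ (i + 1) * p.eps H.card (i + 1))) :=
    Real.sqrt_le_sqrt (div_le_div₀ hL0 hmono hpos hn)
  have heq : p.eps H.card (i + 1) *
      √(T.minLoss p H (i + 1) / (p.τ (i + 1) * p.eps H.card (i + 1))) =
      √(p.eps H.card (i + 1) * (T.minLoss p H (i + 1) / p.τ (i + 1))) := by
    conv_lhs => rw [← Real.sqrt_sq he.le, ← Real.sqrt_mul (sq_nonneg _), Real.sqrt_sq he.le]
    congr 1
    field_simp
  have hdiv : (√(T.minLoss p H i / (p.n * p.eps H.card p.M)) + Real.log (p.τ i)) / p.c₃ ≤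
      √(T.minLoss p H i / (p.n * p.eps H.card p.M)) + Real.log (p.τ i) :=
    div_le_self (by positivity) hc
  rw [mul_max_of_nonneg _ _ he.le]
  refine max_le ?_ (by linarith)
  calc _ ≤ p.eps H.card (i + 1) *
      (√(T.minLoss p H (i + 1) / (p.τ (i + 1) * p.eps H.card (i + 1)))
        + 2 * Real.log (p.τ (i + 1))) := by
        refine mul_le_mul_of_nonneg_left ?_ he.le
        linarith
    _ = _ := by rw [mul_add, heq]; ring

end Trajectory

/-! ### Sums over epochs and conditional moments of the losses -/

section Epoch

variable {p : Params}

/-- The epoch of example `i`. -/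
def Params.epoch (p : Params) (i : ℕ) : ℕ := sInf {j | i ≤ p.τ j}

theorem Params.ScheduleOK.epoch_eq (hs : p.ScheduleOK) {i j : ℕ} (hj : 1 ≤ j) (hjM : j ≤ p.M)
    (hi : i ∈ Finset.Ioc (p.τ (j - 1)) (p.τ j)) : p.epoch i = j := by
  obtain ⟨h1, h2⟩ := Finset.mem_Ioc.1 hi
  have hmem : j ∈ {j | i ≤ p.τ j} := h2
  have hle : p.epoch i ≤ j := Nat.sInf_le hmem
  have hin : i ≤ p.τ (p.epoch i) := Nat.sInf_mem ⟨j, hmem⟩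
  by_contra hne
  have := hs.tau_mono (show p.epoch i ≤ j - 1 by omega) (by omega)
  omega

theorem Params.ScheduleOK.exists_epoch (hs : p.ScheduleOK) {i : ℕ}
    (hi : i ∈ Finset.Icc 1 (p.τ p.M)) : ∃ j, 1 ≤ j ∧ j ≤ p.M ∧ p.epoch i = j ∧
      i ∈ Finset.Ioc (p.τ (j - 1)) (p.τ j) := by
  obtain ⟨h1, h2⟩ := Finset.mem_Icc.1 hi
  have hmem : p.M ∈ {j | i ≤ p.τ j} := h2
  have hle : p.epoch i ≤ p.M := Nat.sInf_le hmem
  have hin : i ≤ p.τ (p.epoch i) := Nat.sInf_mem ⟨p.M, hmem⟩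
  have hpos : 1 ≤ p.epoch i := by
    by_contra h
    have h0 : p.epoch i = 0 := by omega
    rw [h0, hs.tau_zero] at hin
    omega
  have hlt : p.τ (p.epoch i - 1) < i := by
    have := Nat.notMem_of_lt_sInf (s := {j | i ≤ p.τ j}) (m := p.epoch i - 1)
      (show p.epoch i - 1 < p.epoch i by omega)
    simpa using this
  exact ⟨_, hpos, hle, rfl, Finset.mem_Ioc.2 ⟨hlt, hin⟩⟩

theorem Params.ScheduleOK.sum_epoch (hs : p.ScheduleOK) (F : ℕ → ℕ → ℝ) {m : ℕ} (hm : m ≤ p.M) :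
    ∑ i ∈ Finset.Ioc 0 (p.τ m), F (p.epoch i) i =
      ∑ j ∈ Finset.Icc 1 m, ∑ i ∈ Finset.Ioc (p.τ (j - 1)) (p.τ j), F j i := by
  induction m with
  | zero => simp [hs.tau_zero]
  | succ m ih =>
    rw [Finset.sum_Icc_succ_top (by omega), ← ih (by omega), Nat.add_sub_cancel,
      ← Finset.sum_Ioc_consecutive _ (Nat.zero_le _) (hs.tau_lt m (by omega)).le]
    congr 1
    refine Finset.sum_congr rfl fun i hi => ?_
    rw [hs.epoch_eq (j := m + 1) (by omega) hm hi]

end Epoch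

namespace Trajectory

variable {𝒳 : Type*}

section

variable {T : Trajectory 𝒳} {p : Params} {H : Finset (𝒳 → Bool)}

theorem loss_comb_eq (j : ℕ) (a b : ℝ) (g g' : 𝒳 → Bool) (q : Bool) (z : 𝒳 × Bool)
    [Decidable (T.Querying p H j z.1 ∧ q = false)] :
    a * T.loss p H j g q z + b * T.loss p H j g' q z =
      if T.Querying p H j z.1 ∧ q = false then 0
      else (a * T.mistake p H j g z + b * T.mistake p H j g' z) / T.queryProb p H j z.1 := by
  unfold loss
  split_ifs
  · ring
  · ring

/-- Importance weighting is unbiased: the chance of a query cancels the weight. -/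
theorem mix_loss_eq {j : ℕ} {z : 𝒳 × Bool} (h0 : T.queryProb p H j z.1 ≠ 0) (a b : ℝ)
    (g g' : 𝒳 → Bool) :
    T.queryProb p H j z.1 * (a * T.loss p H j g true z + b * T.loss p H j g' true z) +
      (1 - T.queryProb p H j z.1) * (a * T.loss p H j g false z + b * T.loss p H j g' false z) =
      a * T.mistake p H j g z + b * T.mistake p H j g' z := by
  classical
  rw [loss_comb_eq, loss_comb_eq]
  by_cases hq : T.Querying p H j z.1
  · simp only [hq]
    simp
    field_simp
  · have : T.queryProb p H j z.1 = 1 := by simp [queryProb, hq]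
    simp [hq, this]

/-- In the second moment only one of the two inverse probabilities cancels. -/
theorem mix_loss_sq_eq {j : ℕ} {z : 𝒳 × Bool} (h0 : T.queryProb p H j z.1 ≠ 0) (a b : ℝ)
    (g g' : 𝒳 → Bool) :
    T.queryProb p H j z.1 * (a * T.loss p H j g true z + b * T.loss p H j g' true z) ^ 2 +
      (1 - T.queryProb p H j z.1) *
        (a * T.loss p H j g false z + b * T.loss p H j g' false z) ^ 2 =
      (a * T.mistake p H j g z + b * T.mistake p H j g' z) ^ 2 / T.queryProb p H j z.1 := by
  classical
  rw [loss_comb_eq, loss_comb_eq]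
  by_cases hq : T.Querying p H j z.1
  · simp only [hq]
    simp
    field_simp
  · have : T.queryProb p H j z.1 = 1 := by simp [queryProb, hq]
    simp [hq, this]

end

variable [MeasurableSpace 𝒳]

/-- The mean of the weighted error of `g` in epoch `j`, given the past. -/
def meanLoss (T : Trajectory 𝒳) (p : Params) (H : Finset (𝒳 → Bool)) (D : Measure (𝒳 × Bool))
    (j : ℕ) (g : 𝒳 → Bool) : ℝ := ∫ z, T.mistake p H j g z ∂D

/-- The second moment, given the past, of a combination of weighted errors in epoch `j`. -/
def secondMoment (T : Trajectory 𝒳) (p : Params) (H : Finset (𝒳 → Bool)) (D : Measure (𝒳 × Bool))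
    (a b : ℝ) (g g' : 𝒳 → Bool) (j : ℕ) : ℝ :=
  ∫ z, (a * T.mistake p H j g z + b * T.mistake p H j g' z) ^ 2 / T.queryProb p H j z.1 ∂D

/-- The sum over all examples of the first `m` epochs of an epochwise quantity. -/
def _root_.ActiveCover.Params.cumSum (p : Params) (f : ℕ → ℝ) (m : ℕ) : ℝ :=
  ∑ j ∈ Finset.Icc 1 m, ((p.τ j : ℝ) - p.τ (j - 1)) * f j

variable {T : Trajectory 𝒳} {p : Params} {H : Finset (𝒳 → Bool)} {D : Measure (𝒳 × Bool)}

/-- A fixed trajectory is a random one over `Unit`, so the joint statement specializes. -/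
theorem measurableSet_region (hH : ∀ h ∈ H, Measurable h) (j : ℕ) :
    MeasurableSet (T.region p H j) :=
  (measurable_prodMk_left (x := ())) (measurableSet_mem_region (Ω := Unit) (T := fun _ => T)
    (p := p) (j := j) hH fun _ _ => MeasurableSet.of_discrete)

theorem IsValid.measurable_mistake (hv : T.IsValid p H D) (hH : ∀ h ∈ H, Measurable h) {j : ℕ}
    (hj : j ≤ p.M) {g : 𝒳 → Bool} (hg : g ∈ H) : Measurable (T.mistake p H j g) :=
  (ActiveCover.measurable_mistake (Ω := Unit) (T := fun _ => T) (p := p) (j := j) hH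
    (measurableSet_mem_region (Ω := Unit) (T := fun _ => T) hH
      fun _ _ => MeasurableSet.of_discrete)
    (fun h _ => hv.erm_mem j (Finset.mem_Icc.2 ⟨h, by omega⟩))
    (fun _ _ _ => MeasurableSet.of_discrete) hg).comp (measurable_prodMk_left (x := ()))

theorem IsValid.integrable_mistake [IsFiniteMeasure D] (hv : T.IsValid p H D)
    (hH : ∀ h ∈ H, Measurable h) {j : ℕ} (hj : j ≤ p.M) {g : 𝒳 → Bool} (hg : g ∈ H) :
    Integrable (T.mistake p H j g) D :=
  integrable_of_measurable_of_abs_le (hv.measurable_mistake hH hj hg) (C := 1) fun z => by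
    rw [abs_of_nonneg (mistake_nonneg _ _ _)]; exact mistake_le_one _ _ _

end Trajectory

theorem IsRun.isValid {𝒳 Ω : Type*} [MeasurableSpace 𝒳] [mΩ : MeasurableSpace Ω]
    {D : Measure (𝒳 × Bool)} {H : Finset (𝒳 → Bool)} {p : Params} {μ : Measure Ω}
    {ℱ : Filtration ℕ mΩ} {T : Ω → Trajectory 𝒳} (hrun : IsRun p H D μ ℱ T) (ω : Ω) :
    (T ω).IsValid p H D where
  erm_mem m hm := hrun.erm_mem m hm ω
  erm_min m hm := hrun.erm_min m hm ω
  feasible m hm := (hrun.prob_solution m hm ω).feasible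

open Classical in
/-- A combination of weighted errors in epoch `j`, scaled by `1 / k`, and set to zero if it is not
known to be bounded by one. -/
def scaledLoss {𝒳 Ω : Type*} (T : Ω → Trajectory 𝒳) (p : Params) (H : Finset (𝒳 → Bool)) (k : ℕ)
    (a b : ℝ) (g g' : 𝒳 → Bool) (j : ℕ) (q : Bool) (w : Ω × (𝒳 × Bool)) : ℝ :=
  if (T w.1).invPmin p H j ≤ k then
    1 / k * (a * (T w.1).loss p H j g q w.2 + b * (T w.1).loss p H j g' q w.2) else 0

section CoinMean

variable {𝒳 Ω : Type*} [MeasurableSpace 𝒳] {D : Measure (𝒳 × Bool)} {H : Finset (𝒳 → Bool)}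
  {p : Params} {T : Ω → Trajectory 𝒳}

theorem coinMean_scaledLoss {ω : Ω} [IsProbabilityMeasure D] (hv : (T ω).IsValid p H D)
    (hH : ∀ h ∈ H, Measurable h)
    (hs : p.ScheduleOK) (hc : 1 ≤ p.c₃) {j : ℕ} (hj : j ≤ p.M) {k : ℕ}
    (hk : (T ω).invPmin p H j ≤ k) (a b : ℝ) {g g' : 𝒳 → Bool} (hg : g ∈ H) (hg' : g' ∈ H) :
    coinMean D (scaledLoss T p H k a b g g' j) (fun w => (T w.1).queryProb p H j w.2.1) ω =
      1 / k * (a * (T ω).meanLoss p H D j g + b * (T ω).meanLoss p H D j g') := by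
  have e : ∀ z : 𝒳 × Bool, (T ω).queryProb p H j z.1 * scaledLoss T p H k a b g g' j true (ω, z)
      + (1 - (T ω).queryProb p H j z.1) * scaledLoss T p H k a b g g' j false (ω, z)
      = 1 / k * (a * (T ω).mistake p H j g z + b * (T ω).mistake p H j g' z) := fun z => by
    rw [← Trajectory.mix_loss_eq (hv.queryProb_pos_and_inv_le hs hc hj z.1).1.ne' a b g g']
    simp only [scaledLoss, hk, if_true]
    ring
  simp only [coinMean, e]
  rw [integral_const_mul, integral_add ((hv.integrable_mistake hH hj hg).const_mul a)
    ((hv.integrable_mistake hH hj hg').const_mul b), integral_const_mul, integral_const_mul]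
  rfl

theorem coinMean_scaledLoss_sq {ω : Ω} (hv : (T ω).IsValid p H D) (hs : p.ScheduleOK)
    (hc : 1 ≤ p.c₃) {j : ℕ} (hj : j ≤ p.M) {k : ℕ} (hk : (T ω).invPmin p H j ≤ k) (a b : ℝ)
    (g g' : 𝒳 → Bool) :
    coinMean D (fun q w => scaledLoss T p H k a b g g' j q w ^ 2)
        (fun w => (T w.1).queryProb p H j w.2.1) ω =
      1 / (k : ℝ) ^ 2 * (T ω).secondMoment p H D a b g g' j := by
  have e : ∀ z : 𝒳 × Bool,
      (T ω).queryProb p H j z.1 * scaledLoss T p H k a b g g' j true (ω, z) ^ 2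
      + (1 - (T ω).queryProb p H j z.1) * scaledLoss T p H k a b g g' j false (ω, z) ^ 2
      = 1 / (k : ℝ) ^ 2 * ((a * (T ω).mistake p H j g z + b * (T ω).mistake p H j g' z) ^ 2
        / (T ω).queryProb p H j z.1) := fun z => by
    rw [← Trajectory.mix_loss_sq_eq (hv.queryProb_pos_and_inv_le hs hc hj z.1).1.ne' a b g g']
    simp only [scaledLoss, hk, if_true]
    ring
  simp only [coinMean, e]
  rw [integral_const_mul]
  rfl

end CoinMean

/-! ### Tail bounds and the good event -/

section Tail

variable {𝒳 Ω : Type*} [MeasurableSpace 𝒳] [mΩ : MeasurableSpace Ω]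
  {D : Measure (𝒳 × Bool)} {H : Finset (𝒳 → Bool)} {p : Params}
  {μ : Measure Ω} {ℱ : Filtration ℕ mΩ} {T : Ω → Trajectory 𝒳}

theorem IsRun.measurable_invPmin (hrun : IsRun p H D μ ℱ T)
    (hH : ∀ h ∈ H, Measurable h) (hs : p.ScheduleOK) {j : ℕ} (hjM : j ≤ p.M) :
    Measurable[ℱ (p.τ (j - 1))] fun ω => (T ω).invPmin p H j := by
  by_cases hj : j ≤ 1
  · simp [Trajectory.invPmin, hj]
  · simp only [Trajectory.invPmin, hj, if_false]
    exact (hrun.measurable_Pmin hH hs (by omega) hjM).const_div 1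

theorem IsRun.measurable_scaledLoss (hrun : IsRun p H D μ ℱ T)
    (hH : ∀ h ∈ H, Measurable h) (hs : p.ScheduleOK) {j : ℕ} (hj : 1 ≤ j) (hjM : j ≤ p.M)
    (k : ℕ) (a b : ℝ) {g g' : 𝒳 → Bool} (hg : g ∈ H) (hg' : g' ∈ H) (q : Bool) :
    Measurable[(ℱ (p.τ (j - 1))).prod inferInstance] (scaledLoss T p H k a b g g' j q) := by
  have h1 : Measurable[(ℱ (p.τ (j - 1))).prod inferInstance]
      fun w : Ω × (𝒳 × Bool) => (T w.1).invPmin p H j :=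
    (hrun.measurable_invPmin hH hs hjM).comp (@measurable_fst Ω (𝒳 × Bool) (ℱ (p.τ (j - 1))) _)
  exact Measurable.ite (measurableSet_le h1 measurable_const)
    ((((hrun.measurable_loss hH hs hj hjM hg q).const_mul a).add
      ((hrun.measurable_loss hH hs hj hjM hg' q).const_mul b)).const_mul _) measurable_const

/-- The supermartingale is applied to the losses divided by `k`, truncated where the weights may
exceed `k`. The truncation is decided before the epoch begins, hence predictable, and on the event
in question the monotonicity of `invPmin` makes it void in every epoch up to `m`. -/
theorem IsRun.tail_bound [IsProbabilityMeasure D] [IsProbabilityMeasure μ]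
    (hrun : IsRun p H D μ ℱ T) (hH : ∀ h ∈ H, Measurable h) (hs : p.ScheduleOK)
    (hc : 1 ≤ p.c₃) (hN : 2 ≤ Real.log (H.card / p.δ)) {m : ℕ} (hm : m ≤ p.M)
    {k : ℕ} (hk : 1 ≤ k) {a b : ℝ} (ha : |a| ≤ 1) (hb : |b| ≤ 1) (hab : |a + b| ≤ 1)
    {g g' : 𝒳 → Bool} (hg : g ∈ H) (hg' : g' ∈ H) (t : ℝ) :
    μ.real {ω | (T ω).invPmin p H m ≤ k ∧ t ≤
      1 / k * (a * ((T ω).cumLoss p H m g - p.cumSum (fun j => (T ω).meanLoss p H D j g) m)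
        + b * ((T ω).cumLoss p H m g' - p.cumSum (fun j => (T ω).meanLoss p H D j g') m))
      - 1 / (k : ℝ) ^ 2 * p.cumSum ((T ω).secondMoment p H D a b g g') m} ≤ Real.exp (-t) := by
  let U : ℕ → Bool → Ω × (𝒳 × Bool) → ℝ := fun i => scaledLoss T p H k a b g g' (p.epoch i)
  let π : ℕ → Ω × (𝒳 × Bool) → ℝ := fun i w => (T w.1).queryProb p H (p.epoch i) w.2.1
  have hsub : ∀ i ∈ Finset.Icc 1 (p.τ p.M), i ∈ Finset.Icc 1 p.n := fun i hi => by
    have := hs.tau_M_le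
    simp only [Finset.mem_Icc] at *; omega
  have hk0 : (0 : ℝ) < k := by exact_mod_cast hk
  have hle : ∀ {i j : ℕ}, i ∈ Finset.Ioc (p.τ (j - 1)) (p.τ j) → p.τ (j - 1) ≤ i - 1 :=
    fun hi => by have := (Finset.mem_Ioc.1 hi).1; omega
  have prodmono : ∀ {i i' : ℕ}, i ≤ i' → (ℱ i).prod (inferInstance : MeasurableSpace (𝒳 × Bool)) ≤
      (ℱ i').prod inferInstance := fun h =>
    sup_le_sup (MeasurableSpace.comap_mono (ℱ.mono h)) le_rfl
  obtain ⟨hS3, hSm, hSe⟩ := integral_exp_sum_le_one (μ := μ) (ℱ := ℱ) (D := D) (n := p.τ p.M)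
    (obs := obs T) (Q := fun i ω => (T ω).Q i)
    (fun i hi => hrun.measurable_obs i (hsub i hi))
    (fun i hi => hrun.measurable_query i (hsub i hi))
    (fun i hi => hrun.law_obs i (hsub i hi))
    (fun i hi => hrun.indep_obs i (hsub i hi))
    (U := U)
    (fun i hi q => by
      obtain ⟨j, h1, h2, h3, h4⟩ := hs.exists_epoch hi
      simp only [U, h3]
      exact (hrun.measurable_scaledLoss hH hs h1 h2 k a b hg hg' q).mono
        (prodmono (hle h4)) le_rfl)
    (fun i hi q w => by
      obtain ⟨j, h1, h2, h3, h4⟩ := hs.exists_epoch hi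
      simp only [U, h3, scaledLoss]
      split_ifs with hkk
      · rw [abs_mul, abs_of_pos (one_div_pos.2 hk0), one_div_mul_eq_div, div_le_one hk0]
        exact ((hrun.isValid w.1).abs_loss_comb_le hs hc h2 ha hb hab g g' q w.2).trans hkk
      · simp)
    (π := π)
    (fun i hi => by
      obtain ⟨j, h1, h2, h3, h4⟩ := hs.exists_epoch hi
      simp only [π, h3]
      have e1 : @Measurable _ _ ((ℱ (p.τ (j - 1))).prod inferInstance)
          ((ℱ (p.τ (j - 1))).prod inferInstance) fun w : Ω × (𝒳 × Bool) => (w.1, w.2.1) :=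
        (@measurable_fst Ω (𝒳 × Bool) (ℱ (p.τ (j - 1))) _).prodMk
          (measurable_fst.comp (@measurable_snd Ω (𝒳 × Bool) (ℱ (p.τ (j - 1))) _))
      exact ((hrun.measurable_queryProb hH hs h1 h2).comp e1).mono
        (prodmono (hle h4)) le_rfl)
    (fun i hi w => by
      obtain ⟨j, h1, h2, h3, h4⟩ := hs.exists_epoch hi
      simp only [π, h3]
      exact ((hrun.isValid w.1).queryProb_mem_Icc h2 _).1)
    (fun i hi w => by
      obtain ⟨j, h1, h2, h3, h4⟩ := hs.exists_epoch hi
      simp only [π, h3]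
      exact ((hrun.isValid w.1).queryProb_mem_Icc h2 _).2)
    (fun i hi => by
      obtain ⟨j, h1, h2, h3, h4⟩ := hs.exists_epoch hi
      simp only [U, π, h3]
      have hq : ∀ᵐ ω ∂μ, (T ω).Querying p H j ((T ω).X i) →
          (μ[({ω' | (T ω').Q i = true} : Set Ω).indicator (fun _ => (1 : ℝ)) |
          ℱ (i - 1) ⊔ MeasurableSpace.comap (obs T i) inferInstance]) ω
            = (T ω).P j ((T ω).X i) := by
        by_cases hj : 2 ≤ j
        · filter_upwards [hrun.query_law j (Finset.mem_Icc.2 ⟨hj, h2⟩) i h4] with ω hω h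
          exact hω h.2
        · exact Filter.Eventually.of_forall fun ω h => absurd h.1 hj
      filter_upwards [hq] with ω hω
      by_cases h : (T ω).Querying p H j ((T ω).X i)
      · right
        rw [hω h]
        simp [Trajectory.queryProb, obs, h]
      -- No coin is flipped for this example, so the loss does not depend on `Q_i`.
      · left
        simp [scaledLoss, Trajectory.loss, obs, h])
    (p.τ m) (hs.tau_mono hm le_rfl)
  refine le_trans (measureReal_mono (fun ω hω => ?_) (measure_ne_top μ _))
    (measureReal_le_exp_neg_of_integral_exp_le_one (hSm.mono (ℱ.le _) le_rfl) hS3 hSe t)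
  obtain ⟨hω1, hω2⟩ := hω
  change t ≤ _
  refine hω2.trans (le_of_eq ?_)
  have hv := hrun.isValid ω
  have hS := hs.sum_epoch (fun j i => scaledLoss T p H k a b g g' j ((T ω).Q i) (ω, obs T i ω)
    - coinMean D (scaledLoss T p H k a b g g' j) (fun w => (T w.1).queryProb p H j w.2.1) ω
    - coinMean D (fun q w => scaledLoss T p H k a b g g' j q w ^ 2)
        (fun w => (T w.1).queryProb p H j w.2.1) ω) hm
  refine Eq.trans ?_ hS.symm
  simp only [Trajectory.cumLoss, Params.cumSum]
  simp only [← Finset.sum_sub_distrib, Finset.mul_sum, ← Finset.sum_add_distrib]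
  refine Finset.sum_congr rfl fun j hj => ?_
  obtain ⟨hj1, hj2⟩ := Finset.mem_Icc.1 hj
  have hkj := (hv.invPmin_mono hs hc hN hj1 hj2 hm).trans hω1
  rw [coinMean_scaledLoss hv hH hs hc (hj2.trans hm) hkj a b hg hg',
    coinMean_scaledLoss_sq hv hs hc (hj2.trans hm) hkj a b g g']
  have hl : p.τ (j - 1) ≤ p.τ j := hs.tau_pred_le (hj2.trans hm)
  simp only [scaledLoss, hkj, if_true, Finset.sum_sub_distrib, Finset.sum_const, Nat.card_Ioc,
    nsmul_eq_mul, Nat.cast_sub hl, ← Finset.mul_sum, Finset.sum_add_distrib]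
  simp only [obs]
  ring

end Tail

/-- The coefficients of the combinations of losses whose deviations are controlled. -/
def coefficients : Finset (ℝ × ℝ) := {(1, -1), (-1, 1), (0, 1), (0, -1)}

theorem card_coefficients_le : coefficients.card ≤ 4 := Finset.card_le_four

theorem abs_le_one_of_mem_coefficients {c : ℝ × ℝ} (hc : c ∈ coefficients) :
    |c.1| ≤ 1 ∧ |c.2| ≤ 1 ∧ |c.1 + c.2| ≤ 1 := by
  simp only [coefficients, Finset.mem_insert, Finset.mem_singleton] at hc
  rcases hc with rfl | rfl | rfl | rfl <;> norm_num

/-- The cumulative losses are close to their means, at every scale `k`. -/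
def Trajectory.Concentrated {𝒳 : Type*} [MeasurableSpace 𝒳] (T : Trajectory 𝒳) (p : Params)
    (H : Finset (𝒳 → Bool)) (D : Measure (𝒳 × Bool)) (hstar : 𝒳 → Bool) : Prop :=
  ∀ m ∈ Finset.Icc 1 p.M, ∀ k ∈ Finset.Icc 1 (3 * p.τ m), ∀ c ∈ coefficients, ∀ g ∈ H,
    T.invPmin p H m ≤ k →
    c.1 * (T.cumLoss p H m g - p.cumSum (fun j => T.meanLoss p H D j g) m)
        + c.2 * (T.cumLoss p H m hstar - p.cumSum (fun j => T.meanLoss p H D j hstar) m)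
      ≤ p.cumSum (T.secondMoment p H D c.1 c.2 g hstar) m / k + 3 * k * p.logTerm H.card m

/-- `τ_m ≥ m + 2` gives `1 / τ_m² ≤ 1 / (m (m + 1))`, which telescopes. -/
theorem Params.ScheduleOK.sum_inv_sq_tau_le {p : Params} (hs : p.ScheduleOK) :
    ∑ m ∈ Finset.Icc 1 p.M, 1 / (p.τ m : ℝ) ^ 2 ≤ 1 := by
  have key : ∀ M ≤ p.M, ∑ m ∈ Finset.Icc 1 M, 1 / (p.τ m : ℝ) ^ 2 ≤ 1 - 1 / ((M : ℝ) + 1) := by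
    intro M hM
    induction M with
    | zero => simp
    | succ M ih =>
      rw [Finset.sum_Icc_succ_top (by omega)]
      have h1 := ih (by omega)
      have h2 : ((M : ℝ) + 3) ≤ p.τ (M + 1) := by
        exact_mod_cast hs.add_two_le_tau (m := M + 1) (by omega) hM
      have h3 : 1 / (p.τ (M + 1) : ℝ) ^ 2 ≤ 1 / (((M : ℝ) + 1) * (M + 2)) := by
        apply one_div_le_one_div_of_le (by positivity)
        nlinarith [(Nat.cast_nonneg M : (0 : ℝ) ≤ M)]
      have h4 : 1 / (((M : ℝ) + 1) * (M + 2)) = 1 / ((M : ℝ) + 1) - 1 / ((M : ℝ) + 1 + 1) := by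
        field_simp
        ring
      push_cast
      linarith
  have := key p.M le_rfl
  have : (0 : ℝ) < 1 / ((p.M : ℝ) + 1) := by positivity
  linarith [key p.M le_rfl]

theorem Params.exp_neg_logTerm {p : Params} {N m : ℕ} (hs : p.ScheduleOK) (h1 : 1 ≤ m)
    (hm : m ≤ p.M) (hN : (0 : ℝ) < N / p.δ) :
    Real.exp (-(3 * p.logTerm N m)) = (p.δ / N) ^ 3 / (p.τ m : ℝ) ^ 3 := by
  have hτ := hs.three_le_tau h1 hm
  have : -(3 * p.logTerm N m) = 3 * (-(Real.log (N / p.δ)) + -(Real.log (p.τ m))) := by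
    rw [logTerm]; ring
  rw [this, show (3 : ℝ) = ((3 : ℕ) : ℝ) by norm_num, Real.exp_nat_mul, Real.exp_add,
    Real.exp_neg, Real.exp_neg, Real.exp_log hN, Real.exp_log (by linarith), inv_div, mul_pow,
    inv_pow, ← div_eq_mul_inv]

/-- In epoch `m` there are at most `3 τ_m` scales, 4 coefficient pairs and `N` classifiers, each
failing with probability at most `(δ/N)³ / τ_m³`. The total is `12 (δ/N)² · δ / τ_m²`, and `N/δ >
√192` makes the coefficient `12 (δ/N)²` less than one. -/
theorem IsRun.exists_event {𝒳 Ω : Type*} [MeasurableSpace 𝒳] [mΩ : MeasurableSpace Ω]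
    {D : Measure (𝒳 × Bool)} {H : Finset (𝒳 → Bool)} {p : Params}
    {μ : Measure Ω} {ℱ : Filtration ℕ mΩ} {T : Ω → Trajectory 𝒳}
    [IsProbabilityMeasure D] [IsProbabilityMeasure μ]
    (hrun : IsRun p H D μ ℱ T) (hH : ∀ h ∈ H, Measurable h) (hs : p.ScheduleOK)
    (hc : 1 ≤ p.c₃) {hstar : 𝒳 → Bool} (hstar_mem : hstar ∈ H)
    (hδ : 0 < p.δ) (hHδ : √192 < (H.card : ℝ) / p.δ) (hN : 2 ≤ Real.log (H.card / p.δ)) :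
    ∃ E : Set Ω, MeasurableSet E ∧ 1 - p.δ ≤ μ.real E ∧
      ∀ ω ∈ E, (T ω).Concentrated p H D hstar := by
  let bad : ℕ → ℕ → ℝ × ℝ → (𝒳 → Bool) → Set Ω := fun m k c g =>
    {ω | (T ω).invPmin p H m ≤ k ∧ 3 * p.logTerm H.card m ≤
      1 / k * (c.1 * ((T ω).cumLoss p H m g - p.cumSum (fun j => (T ω).meanLoss p H D j g) m)
        + c.2 * ((T ω).cumLoss p H m hstar
          - p.cumSum (fun j => (T ω).meanLoss p H D j hstar) m))
      - 1 / (k : ℝ) ^ 2 * p.cumSum ((T ω).secondMoment p H D c.1 c.2 g hstar) m}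
  let B : Set Ω := ⋃ m ∈ Finset.Icc 1 p.M, ⋃ k ∈ Finset.Icc 1 (3 * p.τ m),
    ⋃ c ∈ coefficients, ⋃ g ∈ H, bad m k c g
  have hpos : (0 : ℝ) < H.card / p.δ := (Real.sqrt_nonneg _).trans_lt hHδ
  have hNpos : (0 : ℝ) < H.card := by
    have : (0 : ℝ) < H.card / p.δ * p.δ := mul_pos hpos hδ
    rwa [div_mul_cancel₀ _ hδ.ne'] at this
  have hsq : (p.δ / H.card) ^ 2 ≤ 1 / 192 := by
    have h1 : (192 : ℝ) ≤ (H.card / p.δ) ^ 2 := by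
      rw [← Real.sq_sqrt (show (0 : ℝ) ≤ 192 by norm_num)]
      exact pow_le_pow_left₀ (Real.sqrt_nonneg _) hHδ.le 2
    have h2 : (p.δ / H.card) ^ 2 = 1 / (H.card / p.δ) ^ 2 := by field_simp
    rw [h2]
    exact one_div_le_one_div_of_le (by norm_num) h1
  have hB : μ.real B ≤ p.δ := by
    have hm : ∀ m ∈ Finset.Icc 1 p.M, μ.real (⋃ k ∈ Finset.Icc 1 (3 * p.τ m),
        ⋃ c ∈ coefficients, ⋃ g ∈ H, bad m k c g) ≤ p.δ * (1 / (p.τ m : ℝ) ^ 2) := by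
      intro m hm
      obtain ⟨hm1, hm2⟩ := Finset.mem_Icc.1 hm
      have hτ := hs.three_le_tau hm1 hm2
      have hexp := Params.exp_neg_logTerm hs hm1 hm2 hpos
      have hg : ∀ k ∈ Finset.Icc 1 (3 * p.τ m), ∀ c ∈ coefficients, μ.real (⋃ g ∈ H, bad m k c g)
          ≤ H.card * Real.exp (-(3 * p.logTerm H.card m)) := fun k hk c hcc => by
        obtain ⟨c1, c2, c3⟩ := abs_le_one_of_mem_coefficients hcc
        refine (measureReal_biUnion_finset_le _ _).trans ?_
        rw [← nsmul_eq_mul]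
        exact Finset.sum_le_card_nsmul _ _ _ fun g hg =>
          hrun.tail_bound hH hs hc hN hm2 (Finset.mem_Icc.1 hk).1 c1 c2 c3 hg hstar_mem _
      have hcf : ∀ k ∈ Finset.Icc 1 (3 * p.τ m), μ.real (⋃ c ∈ coefficients, ⋃ g ∈ H, bad m k c g)
          ≤ 4 * (H.card * Real.exp (-(3 * p.logTerm H.card m))) := fun k hk => by
        refine (measureReal_biUnion_finset_le _ _).trans
          ((Finset.sum_le_card_nsmul _ _ _ (hg k hk)).trans ?_)
        rw [nsmul_eq_mul]
        refine mul_le_mul_of_nonneg_right ?_ (by positivity)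
        exact_mod_cast card_coefficients_le
      refine (measureReal_biUnion_finset_le _ _).trans
          ((Finset.sum_le_card_nsmul _ _ _ hcf).trans ?_)
      rw [Nat.card_Icc, nsmul_eq_mul, hexp, Nat.add_sub_cancel]
      push_cast
      have e1 : 3 * (p.τ m : ℝ) * (4 * (H.card * ((p.δ / H.card) ^ 3 / (p.τ m : ℝ) ^ 3))) =
          12 * (p.δ / H.card) ^ 2 * (p.δ * (1 / (p.τ m : ℝ) ^ 2)) := by
        field_simp
        ring
      rw [e1]
      exact mul_le_of_le_one_left (by positivity) (by linarith)
    refine (measureReal_biUnion_finset_le _ _).trans ((Finset.sum_le_sum hm).trans ?_)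
    rw [← Finset.mul_sum]
    exact mul_le_of_le_one_right hδ.le hs.sum_inv_sq_tau_le
  -- Passing to the measurable hull keeps the probability and avoids proving that `B` is measurable.
  refine ⟨(toMeasurable μ B)ᶜ, (measurableSet_toMeasurable μ B).compl, ?_, fun ω hω => ?_⟩
  · rw [probReal_compl_eq_one_sub (measurableSet_toMeasurable μ B), measureReal_def,
      measure_toMeasurable]
    exact sub_le_sub_left hB 1
  · have hωB : ω ∉ B := fun h => hω (subset_toMeasurable μ B h)
    intro m hm k hk c hcc g hg hinv
    by_contra hcon
    push Not at hcon
    refine hωB ?_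
    simp only [B, Set.mem_iUnion]
    refine ⟨m, hm, k, hk, c, hcc, g, hg, hinv, ?_⟩
    have hk0 : (0 : ℝ) < k := by exact_mod_cast (Finset.mem_Icc.1 hk).1
    generalize c.1 * ((T ω).cumLoss p H m g - p.cumSum (fun j => (T ω).meanLoss p H D j g) m)
        + c.2 * ((T ω).cumLoss p H m hstar
          - p.cumSum (fun j => (T ω).meanLoss p H D j hstar) m) = x at *
    generalize p.cumSum ((T ω).secondMoment p H D c.1 c.2 g hstar) m = v at *
    have e : 1 / (k : ℝ) * x - 1 / (k : ℝ) ^ 2 * v = 1 / k * (x - v / k) := by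
      field_simp
    rw [e, one_div_mul_eq_div, le_div_iff₀ hk0]
    linarith

/-! ### Mean regrets and second moments in one epoch -/

theorem integrable_indicator_one {α : Type*} [MeasurableSpace α] {D : Measure α}
    [IsFiniteMeasure D] {S : Set α} (hS : MeasurableSet S) :
    Integrable (S.indicator fun _ => (1 : ℝ)) D :=
  (integrable_const 1).indicator hS

theorem integral_indicator_one_eq {α : Type*} [MeasurableSpace α] {D : Measure α} {S : Set α}
    (hS : MeasurableSet S) : ∫ z, S.indicator (fun _ => (1 : ℝ)) z ∂D = D.real S :=
  integral_indicator_one hS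

namespace Trajectory

variable {𝒳 : Type*} {T : Trajectory 𝒳} {p : Params} {H : Finset (𝒳 → Bool)} {j : ℕ}

theorem eq_of_notMem_region {x : 𝒳} (hx : x ∉ T.region p H j) {g g' : 𝒳 → Bool}
    (hg : g ∈ T.A p H j) (hg' : g' ∈ T.A p H j) : g x = g' x := by
  by_contra hne
  exact hx ⟨g, hg, g', hg', hne⟩

theorem mistake_of_le_one_or_mem {z : 𝒳 × Bool} (hz : j ≤ 1 ∨ z.1 ∈ T.region p H j)
    (g : 𝒳 → Bool) : T.mistake p H j g z = if g z.1 ≠ z.2 then 1 else 0 := by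
  simp [mistake, label, hz]

theorem mistake_of_notMem (hj : 2 ≤ j) {z : 𝒳 × Bool} (hz : z.1 ∉ T.region p H j)
    (g : 𝒳 → Bool) : T.mistake p H j g z = if g z.1 ≠ T.h j z.1 then 1 else 0 := by
  have : ¬ j ≤ 1 := by omega
  simp [mistake, label, hz, this]

variable [MeasurableSpace 𝒳] {D : Measure (𝒳 × Bool)} {hstar : 𝒳 → Bool}

/-- The error of `h` restricted to the disagreement region of epoch `j`. -/
def regionErr (T : Trajectory 𝒳) (p : Params) (H : Finset (𝒳 → Bool)) (D : Measure (𝒳 × Bool))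
    (h : 𝒳 → Bool) (j : ℕ) : ℝ :=
  D.real {z | h z.1 ≠ z.2 ∧ z.1 ∈ T.region p H j}

theorem measurableSet_err {g : 𝒳 → Bool} (hg : Measurable g) :
    MeasurableSet {z : 𝒳 × Bool | g z.1 ≠ z.2} :=
  measurableSet_ne_apply (hg.comp measurable_fst) measurable_snd

theorem measurableSet_regionErr (hH : ∀ h ∈ H, Measurable h) {g : 𝒳 → Bool} (hg : g ∈ H) :
    MeasurableSet {z : 𝒳 × Bool | g z.1 ≠ z.2 ∧ z.1 ∈ T.region p H j} :=
  (measurableSet_err (hH g hg)).inter (measurable_fst (measurableSet_region hH j))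

/-- The bias of the predicted labels is favourable: off `D_j` the label is that of `hstar` itself,
so `hstar` makes no mistake and `g` makes one exactly where it differs from `hstar`, which dominates
the true difference of errors. -/
theorem IsValid.reg_le_meanLoss_sub [IsProbabilityMeasure D] (hv : T.IsValid p H D)
    (hH : ∀ h ∈ H, Measurable h) (hstar_mem : hstar ∈ H) (hjM : j ≤ p.M)
    (hA : hstar ∈ T.A p H j) (hA' : 2 ≤ j → T.h j ∈ T.A p H j) {g : 𝒳 → Bool} (hg : g ∈ H) :
    reg D g hstar ≤ T.meanLoss p H D j g - T.meanLoss p H D j hstar := by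
  have i1 := integrable_indicator_one (D := D) (measurableSet_err (hH g hg))
  have i2 := integrable_indicator_one (D := D) (measurableSet_err (hH hstar hstar_mem))
  rw [reg, err, err, ← integral_indicator_one_eq (measurableSet_err (hH g hg)),
    ← integral_indicator_one_eq (measurableSet_err (hH hstar hstar_mem)), meanLoss, meanLoss,
    ← integral_sub i1 i2,
    ← integral_sub (hv.integrable_mistake hH hjM hg) (hv.integrable_mistake hH hjM hstar_mem)]
  refine integral_mono (i1.sub i2)
    ((hv.integrable_mistake hH hjM hg).sub (hv.integrable_mistake hH hjM hstar_mem)) fun z => ?_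
  by_cases hz : j ≤ 1 ∨ z.1 ∈ T.region p H j
  · rw [mistake_of_le_one_or_mem hz, mistake_of_le_one_or_mem hz]
    simp [Set.indicator]
  · push Not at hz
    have h2 : 2 ≤ j := hz.1
    rw [mistake_of_notMem h2 hz.2, mistake_of_notMem h2 hz.2,
      ← eq_of_notMem_region hz.2 hA (hA' h2)]
    simp only [Set.indicator, Set.mem_ofPred_eq]
    generalize g z.1 = b1
    generalize hstar z.1 = b2
    generalize z.2 = b3
    cases b1 <;> cases b2 <;> cases b3 <;> norm_num

/-- Off `D_j` the predicted label is that of `hstar`. In the first epoch true labels are used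
everywhere and this equality can fail. -/
theorem IsValid.meanLoss_eq_regionErr [IsProbabilityMeasure D]
    (hH : ∀ h ∈ H, Measurable h) (hstar_mem : hstar ∈ H) (hj : 2 ≤ j)
    (hA : hstar ∈ T.A p H j) (hA' : T.h j ∈ T.A p H j) :
    T.meanLoss p H D j hstar = T.regionErr p H D hstar j := by
  rw [regionErr, ← integral_indicator_one_eq (measurableSet_regionErr hH hstar_mem), meanLoss]
  congr 1
  funext z
  by_cases hz : z.1 ∈ T.region p H j
  · rw [mistake_of_le_one_or_mem (Or.inr hz)]
    simp [Set.indicator, hz]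
  · rw [mistake_of_notMem hj hz, ← eq_of_notMem_region hz hA hA']
    simp [Set.indicator, hz]

theorem meanLoss_one_eq_err (hH : ∀ h ∈ H, Measurable h) {g : 𝒳 → Bool} (hg : g ∈ H) :
    T.meanLoss p H D 1 g = err D g := by
  rw [err, ← integral_indicator_one_eq (measurableSet_err (hH g hg)), meanLoss]
  congr 1
  funext z
  rw [mistake_of_le_one_or_mem (Or.inl le_rfl)]
  simp [Set.indicator]

theorem IsValid.secondMoment_le_of_star [IsProbabilityMeasure D] (hv : T.IsValid p H D)
    (hs : p.ScheduleOK) (hc : 1 ≤ p.c₃) (hH : ∀ h ∈ H, Measurable h) (hstar_mem : hstar ∈ H)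
    (hjM : j ≤ p.M) {b : ℝ} (hb : b ^ 2 = 1) (g : 𝒳 → Bool) :
    T.secondMoment p H D 0 b g hstar j ≤ T.invPmin p H j * T.meanLoss p H D j hstar := by
  rw [secondMoment, meanLoss, ← integral_const_mul]
  refine integral_mono_of_nonneg (Filter.Eventually.of_forall fun z => ?_)
    ((hv.integrable_mistake hH hjM hstar_mem).const_mul _)
    (Filter.Eventually.of_forall fun z => ?_)
  · exact div_nonneg (sq_nonneg _) (hv.queryProb_mem_Icc hjM _).1
  · have h1 := (hv.queryProb_pos_and_inv_le hs hc hjM z.1).2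
    have h2 : (0 * T.mistake p H j g z + b * T.mistake p H j hstar z) ^ 2 =
        T.mistake p H j hstar z := by
      rw [zero_mul, zero_add, mul_pow, hb, one_mul]
      unfold mistake; split_ifs <;> norm_num
    simp only [h2]
    rw [div_eq_mul_one_div, mul_comm]
    exact mul_le_mul_of_nonneg_right h1 (mistake_nonneg _ _ _)

/-- All weights are one, and the squared difference of two 0-1 mistakes is at most their difference
plus twice the second. Off `D_1` all classifiers of `H` agree. -/
theorem IsValid.secondMoment_one_le [IsProbabilityMeasure D] (hv : T.IsValid p H D)
    (hH : ∀ h ∈ H, Measurable h) (hstar_mem : hstar ∈ H)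
    (hM : 1 ≤ p.M) {a b : ℝ} (hab : a ^ 2 = 1 ∧ b = -a) {g : 𝒳 → Bool} (hg : g ∈ H) :
    T.secondMoment p H D a b g hstar 1 ≤
      T.meanLoss p H D 1 g - T.meanLoss p H D 1 hstar + 2 * T.regionErr p H D hstar 1 := by
  have i1 := (hv.integrable_mistake hH hM hg).sub (hv.integrable_mistake hH hM hstar_mem)
  have i2 := (integrable_indicator_one (D := D) (measurableSet_regionErr (T := T) (p := p)
    (j := 1) hH hstar_mem)).const_mul 2
  rw [regionErr, ← integral_indicator_one_eq (measurableSet_regionErr hH hstar_mem), meanLoss,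
    meanLoss, secondMoment, ← integral_const_mul,
    ← integral_sub (hv.integrable_mistake hH hM hg) (hv.integrable_mistake hH hM hstar_mem)]
  have e := integral_add i1 i2
  simp only [Pi.sub_apply] at e
  rw [← e]
  refine integral_mono_of_nonneg (Filter.Eventually.of_forall fun z => ?_) (i1.add i2)
    (Filter.Eventually.of_forall fun z => ?_)
  · exact div_nonneg (sq_nonneg _) (hv.queryProb_mem_Icc hM _).1
  · have hp : T.queryProb p H 1 z.1 = 1 := by simp [queryProb, Querying]
    have hsq : (a * T.mistake p H 1 g z + b * T.mistake p H 1 hstar z) ^ 2 =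
        (T.mistake p H 1 g z - T.mistake p H 1 hstar z) ^ 2 := by
      rw [hab.2]; linear_combination
        (T.mistake p H 1 g z - T.mistake p H 1 hstar z) ^ 2 * hab.1
    simp only [hp, div_one, hsq]
    rw [mistake_of_le_one_or_mem (Or.inl le_rfl), mistake_of_le_one_or_mem (Or.inl le_rfl)]
    by_cases hz : z.1 ∈ T.region p H 1
    · simp only [Set.indicator, Set.mem_ofPred_eq, hz, and_true]
      generalize g z.1 = b1
      generalize hstar z.1 = b2
      generalize z.2 = b3
      cases b1 <;> cases b2 <;> cases b3 <;> norm_num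
    · rw [eq_of_notMem_region hz (mem_A_one.2 hg) (mem_A_one.2 hstar_mem)]
      simp [Set.indicator, hz]

theorem measurableSet_disagree (hH : ∀ h ∈ H, Measurable h) (hj : T.h j ∈ H) {g : 𝒳 → Bool}
    (hg : g ∈ H) : MeasurableSet (T.disagree p H j g) :=
  (measurableSet_ne_apply (hH g hg) (hH _ hj)).inter (measurableSet_region hH j)

theorem integral_comp_fst {f : 𝒳 → ℝ} (hf : Measurable f) :
    ∫ z, f z.1 ∂D = ∫ x, f x ∂D.fst := by
  rw [Measure.fst, integral_map measurable_fst.aemeasurable hf.aestronglyMeasurable]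

/-- On `D_j`, where `g` and `hstar` differ, one of them differs from `h_j`, so the variance is
covered by the constraints for `g` and for `hstar`. Off `D_j` the weight is one and the square is
the mistake of `g`. -/
theorem IsValid.secondMoment_le [IsProbabilityMeasure D] (hv : T.IsValid p H D)
    (hs : p.ScheduleOK) (hc : 1 ≤ p.c₃) (hα : 1 ≤ p.α)
    (hH : ∀ h ∈ H, Measurable h) (hstar_mem : hstar ∈ H)
    (hj : 2 ≤ j) (hjM : j ≤ p.M) (hA : hstar ∈ T.A p H j) (hA' : T.h j ∈ T.A p H j)
    {a b : ℝ} (hab : a ^ 2 = 1 ∧ b = -a) {g : 𝒳 → Bool} (hg : g ∈ H) :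
    T.secondMoment p H D a b g hstar j ≤
      2 * p.α ^ 2 * (T.meanLoss p H D j g - T.meanLoss p H D j hstar
        + 6 * T.regionErr p H D hstar j + 2 * reg D (T.h j) hstar)
      + 2 * p.β ^ 2 * p.γ * (empReg g (T.h j) (T.sample p H (j - 1))
        + empReg hstar (T.h j) (T.sample p H (j - 1))) * p.τ (j - 1) * T.Delta p H (j - 1)
      + 2 * (p.ξ * p.τ (j - 1) * T.Delta p H (j - 1) ^ 2) := by
  have hhj : T.h j ∈ H := A_subset hA'
  have hfeas := hv.feasible j (Finset.mem_Icc.2 ⟨hj, hjM⟩)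
  have hR := measurableSet_region (T := T) (p := p) hH j
  have hdis : ∀ {g}, g ∈ H → MeasurableSet (T.disagree p H j g) := fun hg =>
    measurableSet_disagree hH hhj hg
  have hPm : Measurable fun x => 1 / T.P j x := hfeas.measurable.const_div 1
  let V : (𝒳 → Bool) → 𝒳 → ℝ := fun g => (T.disagree p H j g).indicator (fun x => 1 / T.P j x)
  let I : (𝒳 → Bool) → 𝒳 × Bool → ℝ := fun g =>
    (Prod.fst ⁻¹' T.disagree p H j g).indicator fun _ => (1 : ℝ)
  let m : 𝒳 × Bool → ℝ := fun z => T.mistake p H j g z - T.mistake p H j hstar z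
  let O : 𝒳 × Bool → ℝ := (Prod.fst ⁻¹' T.region p H j)ᶜ.indicator m
  have hVm : ∀ {g}, g ∈ H → Measurable (V g) := fun hg => hPm.indicator (hdis hg)
  have hm : Integrable m D :=
    (hv.integrable_mistake hH hjM hg).sub (hv.integrable_mistake hH hjM hstar_mem)
  have hO : Integrable O D := hm.indicator (measurable_fst hR).compl
  have hI : ∀ {g}, g ∈ H → Integrable (I g) D := fun hg =>
    integrable_indicator_one (measurable_fst (hdis hg))
  have hIe : ∀ {g}, g ∈ H → ∫ z, I g z ∂D = D.fst.real (T.disagree p H j g) := fun hg => by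
    rw [integral_indicator_one_eq (measurable_fst (hdis hg)), measureReal_def, measureReal_def,
      Measure.fst_apply (hdis hg)]
  have hVi : ∀ {g}, g ∈ H → Integrable (fun z : 𝒳 × Bool => V g z.1) D := fun {g} hg =>
    integrable_of_measurable_of_abs_le ((hVm hg).comp measurable_fst)
      (C := T.invPmin p H j) fun z => by
        have h1 := one_le_invPmin (T := T) (H := H) hs hc hjM
        by_cases hz : z.1 ∈ T.disagree p H j g
        · have h2 := hv.queryProb_pos_and_inv_le hs hc hjM z.1
          have h3 : T.queryProb p H j z.1 = T.P j z.1 := by simp [queryProb, Querying, hj, hz.2]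
          rw [h3] at h2
          simp only [V, Set.indicator_of_mem hz]
          rw [abs_of_pos (one_div_pos.2 h2.1)]
          exact h2.2
        · simp only [V, Set.indicator_of_notMem hz, abs_zero]
          linarith
  have hVe : ∀ {g}, g ∈ H → ∫ z, V g z.1 ∂D ≤ T.b p H D j g := fun hg => by
    rw [integral_comp_fst (hVm hg)]
    exact hfeas.variance _ hg
  have s1 : T.secondMoment p H D a b g hstar j ≤
      ∫ z, V g z.1 ∂D + ∫ z, V hstar z.1 ∂D + ∫ z, O z ∂D := by
    rw [← integral_add (hVi hg) (hVi hstar_mem)]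
    have e := integral_add ((hVi hg).add (hVi hstar_mem)) hO
    simp only [Pi.add_apply] at e
    rw [← e, secondMoment]
    refine integral_mono_of_nonneg (Filter.Eventually.of_forall fun z => ?_)
      (((hVi hg).add (hVi hstar_mem)).add hO) (Filter.Eventually.of_forall fun z => ?_)
    · exact div_nonneg (sq_nonneg _) (hv.queryProb_mem_Icc hjM _).1
    · have hsq : (a * T.mistake p H j g z + b * T.mistake p H j hstar z) ^ 2 = m z ^ 2 := by
        rw [hab.2]; linear_combination
          (T.mistake p H j g z - T.mistake p H j hstar z) ^ 2 * hab.1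
      simp only [hsq]
      by_cases hz : z.1 ∈ T.region p H j
      · have h2 := (hv.queryProb_pos_and_inv_le hs hc hjM z.1).1
        have h3 : T.queryProb p H j z.1 = T.P j z.1 := by simp [queryProb, Querying, hj, hz]
        rw [h3] at h2 ⊢
        have hP := one_div_pos.2 h2
        rw [div_eq_mul_one_div]
        simp only [V, O, m, mistake_of_le_one_or_mem (Or.inr hz), disagree, Set.indicator,
          Set.mem_ofPred_eq, hz, and_true, Set.mem_compl_iff, Set.mem_preimage, not_true,
          if_false, add_zero]
        generalize 1 / T.P j z.1 = c at hP
        generalize g z.1 = b1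
        generalize hstar z.1 = b2
        generalize T.h j z.1 = b3
        generalize z.2 = b4
        cases b1 <;> cases b2 <;> cases b3 <;> cases b4 <;> norm_num <;> linarith
      · have h3 : T.queryProb p H j z.1 = 1 := by simp [queryProb, Querying, hz]
        rw [h3, div_one]
        simp only [V, O, m, mistake_of_notMem hj hz, ← eq_of_notMem_region hz hA hA', disagree,
          Set.indicator, Set.mem_ofPred_eq, hz, and_false, Set.mem_compl_iff, Set.mem_preimage,
          not_false_iff, if_true, if_false, zero_add, ne_eq, not_true]
        split_ifs <;> norm_num
  -- On `D_j`, `1(g ≠ h_j) + 1(hstar ≠ h_j) ≤ 1(g ≠ hstar) + 2 · 1(h_j ≠ hstar)`, and each `1(f ≠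
  -- hstar)` is at most the difference of mistakes plus twice the mistake of `hstar`; hence `6 = 2 +
  -- 4`.
  have s2 : ∫ z, I g z ∂D + ∫ z, I hstar z ∂D + ∫ z, O z ∂D ≤
      T.meanLoss p H D j g - T.meanLoss p H D j hstar
        + 6 * T.regionErr p H D hstar j + 2 * reg D (T.h j) hstar := by
    have hE := integrable_indicator_one (D := D) (measurableSet_regionErr (T := T) (p := p)
      (j := j) hH hstar_mem)
    have h1 := integrable_indicator_one (D := D) (measurableSet_err (hH _ hhj))
    have h2 := integrable_indicator_one (D := D) (measurableSet_err (hH hstar hstar_mem))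
    rw [regionErr, reg, err, err,
      ← integral_indicator_one_eq (measurableSet_regionErr hH hstar_mem),
      ← integral_indicator_one_eq (measurableSet_err (hH _ hhj)),
      ← integral_indicator_one_eq (measurableSet_err (hH hstar hstar_mem)), meanLoss, meanLoss,
      ← integral_sub (hv.integrable_mistake hH hjM hg) (hv.integrable_mistake hH hjM hstar_mem),
      ← integral_const_mul, ← integral_sub h1 h2, ← integral_const_mul]
    have e1 := integral_add ((hI hg).add (hI hstar_mem)) hO
    have e2 := integral_add (hI hg) (hI hstar_mem)
    have e3 := integral_add (hm.add (hE.const_mul 6)) ((h1.sub h2).const_mul 2)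
    have e4 := integral_add hm (hE.const_mul 6)
    simp only [Pi.add_apply, Pi.sub_apply] at e1 e2 e3 e4
    rw [← e2, ← e1, ← e4, ← e3]
    refine integral_mono (((hI hg).add (hI hstar_mem)).add hO)
      ((hm.add (hE.const_mul 6)).add ((h1.sub h2).const_mul 2)) fun z => ?_
    by_cases hz : z.1 ∈ T.region p H j
    · simp only [I, O, m, mistake_of_le_one_or_mem (Or.inr hz), disagree, Set.indicator,
        Set.mem_ofPred_eq, hz, and_true, Set.mem_compl_iff, Set.mem_preimage, not_true,
        if_false, add_zero]
      generalize g z.1 = b1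
      generalize hstar z.1 = b2
      generalize T.h j z.1 = b3
      generalize z.2 = b4
      cases b1 <;> cases b2 <;> cases b3 <;> cases b4 <;> norm_num
    · simp only [I, O, m, mistake_of_notMem hj hz, ← eq_of_notMem_region hz hA hA', disagree,
        Set.indicator, Set.mem_ofPred_eq, hz, and_false, Set.mem_compl_iff, Set.mem_preimage,
        not_false_iff, if_true, if_false, zero_add, ne_eq, not_true]
      generalize g z.1 = b1
      generalize hstar z.1 = b2
      generalize z.2 = b4
      cases b1 <;> cases b2 <;> cases b4 <;> norm_num
  have hO0 : 0 ≤ ∫ z, O z ∂D := integral_nonneg fun z => by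
    by_cases hz : z.1 ∈ T.region p H j
    · simp [O, hz]
    · simp only [O, m, mistake_of_notMem hj hz, ← eq_of_notMem_region hz hA hA', Set.indicator,
        Set.mem_compl_iff, Set.mem_preimage, hz, not_false_iff, if_true, ne_eq, not_true, if_false]
      split_ifs <;> simp
  -- The term `O` has coefficient one in `s1`; raising it to `2 α²` allows `s2` to be used as a
  -- whole.
  have hα2 : 1 ≤ 2 * p.α ^ 2 := by nlinarith
  have v1 := hVe hg
  have v2 := hVe hstar_mem
  rw [Trajectory.b, ← hIe hg] at v1
  rw [Trajectory.b, ← hIe hstar_mem] at v2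
  have h3 := mul_le_mul_of_nonneg_left s2 (zero_le_one.trans hα2)
  have h4 := mul_le_mul_of_nonneg_right hα2 hO0
  linarith

end Trajectory

/-! ### Numerical inequalities -/

/-- A scale `1 / k` that balances the two terms of the deviation bound. -/
theorem exists_balanced_scale {V L q : ℝ} {t : ℕ} (hV : 0 ≤ V) (hL : 1 ≤ L) (hq : 1 ≤ q)
    (hqt : q ≤ t) (hVq : V ≤ t * q) :
    ∃ k : ℕ, k ∈ Finset.Icc 1 (3 * t) ∧ q ≤ k ∧
      V / k + 3 * k * L ≤ 19 / 16 * √(32 * L * V) + 6 * L * q := by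
  -- The scale is `max q s` rounded up, which at most doubles it since `q ≥ 1`. With `r = √(32 L
  -- V)`, the choice of `s` gives `V = s r` and `32 L s = r`, so `V / k ≤ r` and `3 k L ≤ 6 L q +
  -- (6/32) r`; this is the source of `19/16`.
  set s := √(V / (32 * L)) with hs
  have hs0 : 0 ≤ s := Real.sqrt_nonneg _
  have hst : s ≤ t := by
    refine Real.sqrt_le_iff.2 ⟨by linarith, ?_⟩
    rw [div_le_iff₀ (by linarith)]
    nlinarith [mul_self_nonneg (t : ℝ), mul_le_mul_of_nonneg_left hqt (by linarith : (0 : ℝ) ≤ t),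
      mul_le_mul_of_nonneg_left hL (mul_self_nonneg (t : ℝ))]
  have hmax : max q s ≤ t := max_le hqt hst
  have hq1 : 1 ≤ max q s := hq.trans (le_max_left _ _)
  have hk1 : max q s ≤ ⌈max q s⌉₊ := Nat.le_ceil _
  have hk2 : (⌈max q s⌉₊ : ℝ) < max q s + 1 := Nat.ceil_lt_add_one (by linarith)
  generalize ⌈max q s⌉₊ = k at *
  have hmaxle : max q s ≤ q + s := max_le (by linarith) (by linarith)
  have hk3 : (k : ℝ) ≤ 2 * (q + s) := by linarith
  have hqk : q ≤ k := (le_max_left _ _).trans hk1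
  have hsk : s ≤ k := (le_max_right _ _).trans hk1
  have hk0 : (0 : ℝ) < k := by linarith
  refine ⟨k, Finset.mem_Icc.2 ⟨by exact_mod_cast hk0, ?_⟩, hqk, ?_⟩
  · have : (k : ℝ) ≤ ((3 * t : ℕ) : ℝ) := by push_cast; linarith
    exact_mod_cast this
  · set r := √(32 * L * V) with hr
    have hr0 : 0 ≤ r := Real.sqrt_nonneg _
    have hsr : s * r = V := by
      rw [hs, hr, ← Real.sqrt_mul (by positivity)]
      rw [show V / (32 * L) * (32 * L * V) = V ^ 2 by field_simp]
      exact Real.sqrt_sq hV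
    have hLs : 32 * L * s = r := by
      rw [hs, hr]
      conv_lhs => rw [← Real.sqrt_sq (show 0 ≤ 32 * L by linarith),
        ← Real.sqrt_mul (sq_nonneg _), Real.sqrt_sq (show 0 ≤ 32 * L by linarith)]
      congr 1
      field_simp
    have h1 : V / k ≤ r := by
      rw [div_le_iff₀ hk0, ← hsr, mul_comm]
      exact mul_le_mul_of_nonneg_left hsk hr0
    have h2 : 3 * (k : ℝ) * L ≤ 3 * (2 * (q + s)) * L := by
      nlinarith
    nlinarith

/-- Squaring the right side produces `0.0105` in front of `b R` and `b X`, and `0.042² = 0.001764`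
exceeds `7/4000`. The small coefficients `1/8` of `R` and `X` are what later permits their
absorption. -/
theorem sqrt_le_of_le_quadratic {A R X b : ℝ} (hR : 0 ≤ R) (hX : 0 ≤ X) (hb : 0 ≤ b)
    (hA : A ≤ 7 / 1000 * (b * R) + 1 / 10000 * (b * X) + 7 / 4000 * b ^ 2) :
    √A ≤ R / 8 + 42 / 1000 * b + X / 8 := by
  refine Real.sqrt_le_iff.2 ⟨by positivity, hA.trans ?_⟩
  have h1 := mul_nonneg hb hR
  have h2 := mul_nonneg hb hX
  have h3 := mul_nonneg hR hX
  nlinarith [sq_nonneg R, sq_nonneg X, sq_nonneg b]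

/-- The arithmetic relating the scaled variance bound to the scaled radius `B`. -/
theorem variance_le_quadratic {α η c₁ c₂ a ℓ ml q B R S X V : ℝ}
    (hη : 864 ≤ η) (hα : 1 ≤ α) (hc₁ : 24 * α ^ 2 ≤ c₁ ^ 2) (hc₁0 : 0 ≤ c₁)
    (hc₂ : η * c₁ ^ 2 / 4 ≤ c₂) (ha : 0 ≤ a) (hℓ : 1 ≤ ℓ) (hml : 0 ≤ ml)
    (hB : B = c₁ * √(a * ml) + c₂ * a * ℓ) (hq : a * q ≤ √(a * ml) + 2 * a * ℓ)
    (hS : S ≤ 2 * (ml + X) + 18 / 32 * (a * q)) (hX : 0 ≤ X) (hR : 0 ≤ R)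
    (hV : a * V ≤ 2 * α ^ 2 * a * (R + 6 * S) + η / 144 * (B * R) + η ^ 2 / 576 * B ^ 2
      + 5 / 6 * B ^ 2) :
    a * q ≤ B / 4 ∧
    a * V ≤ 7 / 1000 * (η * B * R) + 1 / 10000 * (η * B * X) + 7 / 4000 * (η * B) ^ 2 := by
  set r := √(a * ml) with hr
  have hr0 : 0 ≤ r := Real.sqrt_nonneg _
  have hr2 : r ^ 2 = a * ml := Real.sq_sqrt (mul_nonneg ha hml)
  have hα1 : 1 ≤ α ^ 2 := one_le_pow₀ hα
  have hc1sq : 24 ≤ c₁ ^ 2 := by linarith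
  have hc1 : 4 ≤ c₁ := by nlinarith
  have hc2 : 5184 ≤ c₂ := by
    have := mul_le_mul hη hc1sq (by norm_num) (by linarith)
    linarith
  have haℓ : a ≤ a * ℓ := le_mul_of_one_le_right ha hℓ
  have hc1r : 4 * r ≤ c₁ * r := mul_le_mul_of_nonneg_right hc1 hr0
  have hc2a : 5184 * (a * ℓ) ≤ c₂ * (a * ℓ) := mul_le_mul_of_nonneg_right hc2 (ha.trans haℓ)
  have hBeq : B = c₁ * r + c₂ * (a * ℓ) := by rw [hB]; ring
  have hB0 : 0 ≤ B := by linarith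
  have haq : a * q ≤ B / 4 := by linarith
  refine ⟨haq, ?_⟩
  -- The condition `c₂ ≥ η c₁² / 4` enters here: the second term of the radius dominates `c₁² a`.
  have hc1a : η * (c₁ ^ 2 * a) ≤ 4 * B := by
    have h1 : η * c₁ ^ 2 / 4 * a ≤ c₂ * (a * ℓ) :=
      mul_le_mul hc₂ haℓ ha (by linarith)
    linarith
  have hα2 : 2 * α ^ 2 * a ≤ c₁ ^ 2 * a / 12 := by
    have := mul_le_mul_of_nonneg_right hc₁ ha
    linarith
  have hc1a' : c₁ ^ 2 * a ≤ B / 216 := by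
    have h0 : 0 ≤ c₁ ^ 2 * a := mul_nonneg (sq_nonneg _) ha
    have := mul_le_mul_of_nonneg_right hη h0
    linarith
  have hc1r2 : (c₁ * r) ^ 2 ≤ B ^ 2 :=
    pow_le_pow_left₀ (by positivity) (by linarith) 2
  -- As `24 α² ≤ c₁²`, the main part `24 α² a ml` is at most `(c₁ r)²`, the square of the first term
  -- of the radius.
  have hαS : 12 * α ^ 2 * a * S ≤ B ^ 2 + B * X / 216 + 1 / 1000 * B ^ 2 := by
    have h1 : 12 * α ^ 2 * a * S ≤ 12 * α ^ 2 * a * (2 * (ml + X) + 18 / 32 * (B / 4)) :=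
      mul_le_mul_of_nonneg_left (hS.trans (by linarith)) (by positivity)
    have h2 : 12 * α ^ 2 * a * (2 * (ml + X) + 18 / 32 * (B / 4)) ≤
        c₁ ^ 2 * a / 2 * (2 * (ml + X) + 18 / 32 * (B / 4)) :=
      mul_le_mul_of_nonneg_right (by linarith) (by positivity)
    have h3 : c₁ ^ 2 * a / 2 * (2 * (ml + X) + 18 / 32 * (B / 4)) =
        (c₁ * r) ^ 2 + c₁ ^ 2 * a * X + 9 / 128 * (c₁ ^ 2 * a * B) := by
      rw [mul_pow, hr2]; ring
    have h4 : c₁ ^ 2 * a * X ≤ B / 216 * X := mul_le_mul_of_nonneg_right hc1a' hX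
    have h5 : c₁ ^ 2 * a * B ≤ B / 216 * B := mul_le_mul_of_nonneg_right hc1a' hB0
    have h6 := sq_nonneg B
    linarith
  have hαR : 2 * α ^ 2 * a * R ≤ B * R / 2592 := by
    have := mul_le_mul_of_nonneg_right (hα2.trans (by linarith : c₁ ^ 2 * a / 12 ≤ B / 2592)) hR
    linarith
  have hBR := mul_nonneg hB0 hR
  have hBX := mul_nonneg hB0 hX
  have hBB := sq_nonneg B
  have e1 : 864 * (B * R) ≤ η * (B * R) := mul_le_mul_of_nonneg_right hη hBR
  have e2 : 864 * (B * X) ≤ η * (B * X) := mul_le_mul_of_nonneg_right hη hBX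
  have e3 : 746496 * B ^ 2 ≤ η ^ 2 * B ^ 2 :=
    mul_le_mul_of_nonneg_right
      ((by norm_num : (746496 : ℝ) = 864 ^ 2).trans_le (pow_le_pow_left₀ (by norm_num) hη 2)) hBB
  have e4 : (η * B) ^ 2 = η ^ 2 * B ^ 2 := by ring
  rw [e4]
  linarith

/-- The arithmetic of the upper bound on the scaled radius by the scaled population radius. -/
theorem radius_le_two_mul {c₁ c₂ a ℓ ml q Mn S : ℝ}
    (hc₁ : 4 ≤ c₁) (hc₂ : 200 * c₁ ≤ c₂) (ha : 96 ≤ a) (hℓ : 1 ≤ ℓ) (hml : 0 ≤ ml)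
    (hq : a * q ≤ √(a * ml) + 2 * a * ℓ) (hS : 0 ≤ S) (hMn : Mn ≤ S + 3)
    (hml' : ml ≤ 3 / 2 * Mn + 9 / 32 * (a * q)) :
    c₁ * √(a * ml) + c₂ * a * ℓ ≤ 2 * (c₁ * √(a * S) + c₂ * a * ℓ) := by
  set r := √(a * ml) with hr
  have hr0 : 0 ≤ r := Real.sqrt_nonneg _
  have hr2 : r ^ 2 = a * ml := Real.sq_sqrt (by nlinarith)
  set u := √(a * S) with hu
  have hu0 : 0 ≤ u := Real.sqrt_nonneg _
  have hu2 : u ^ 2 = a * S := Real.sq_sqrt (by nlinarith)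
  have haℓ : a ≤ a * ℓ := le_mul_of_one_le_right (by linarith) hℓ
  -- The bound on the weights itself involves `r`, so `r` satisfies a quadratic inequality, which is
  -- solved here.
  have hru : r ≤ 2 * u + 4 * (a * ℓ) := by
    have h1 : r ^ 2 ≤ a * (3 / 2 * (S + 3) + 9 / 32 * (r + 2 * a * ℓ)) := by
      rw [hr2]; exact mul_le_mul_of_nonneg_left (by linarith) (by linarith)
    refine abs_le_of_sq_le_sq' ?_ (by nlinarith) |>.2
    nlinarith [mul_nonneg hu0 (ha.trans haℓ |>.trans' (by norm_num : (0 : ℝ) ≤ 96)),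
      sq_nonneg (r - a * ℓ), mul_le_mul_of_nonneg_right haℓ hr0,
      mul_le_mul haℓ haℓ (by linarith) (by linarith : 0 ≤ a * ℓ)]
  have h2 : c₁ * r ≤ c₁ * (2 * u + 4 * (a * ℓ)) := mul_le_mul_of_nonneg_left hru (by linarith)
  have h3 : 200 * c₁ * (a * ℓ) ≤ c₂ * (a * ℓ) := mul_le_mul_of_nonneg_right hc₂ (by linarith)
  have h4 : 0 ≤ c₁ * (a * ℓ) := mul_nonneg (by linarith) (by linarith)
  nlinarith

/-- Since epochs at most double, `(τ' - τ) / τ ≤ 2 (1 - τ / τ') ≤ 2 log (τ' / τ)`, and the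
logarithms telescope. -/
theorem Params.ScheduleOK.sum_increment_div_le {p : Params} (hs : p.ScheduleOK) {m : ℕ}
    (h1 : 1 ≤ m) (hm : m ≤ p.M) :
    p.cumSum (fun j => if j ≤ 1 then 0 else 1 / (p.τ (j - 1) : ℝ)) m
      ≤ 2 * Real.log (p.τ m) := by
  induction m, h1 using Nat.le_induction with
  | base =>
    have := hs.one_le_log_tau le_rfl hm
    simp [Params.cumSum]
    linarith
  | succ m h1 ih =>
    rw [Params.cumSum, Finset.sum_Icc_succ_top (by omega)]
    have h2 := ih (by omega)
    rw [Params.cumSum] at h2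
    have h3 := hs.three_le_tau h1 (by omega)
    have h3' := hs.three_le_tau (m := m + 1) (by omega) hm
    have h4 : (p.τ (m + 1) : ℝ) ≤ 2 * p.τ m := by exact_mod_cast hs.tau_le m h1 hm
    have h5 : (p.τ m : ℝ) < p.τ (m + 1) := by exact_mod_cast hs.tau_lt m hm
    have h6 := Real.one_sub_inv_le_log_of_pos (x := p.τ (m + 1) / p.τ m)
      (div_pos (by linarith) (by linarith))
    rw [Real.log_div (by linarith) (by linarith), inv_div] at h6
    have h7 : ((p.τ (m + 1) : ℝ) - p.τ m) * (1 / p.τ m) ≤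
        2 * (1 - p.τ m / p.τ (m + 1)) := by
      rw [mul_one_div, div_le_iff₀ (by linarith)]
      have : 2 * (1 - (p.τ m : ℝ) / p.τ (m + 1)) * p.τ m =
          (p.τ (m + 1) - p.τ m) * (2 * p.τ m / p.τ (m + 1)) := by
        field_simp
      rw [this]
      refine le_mul_of_one_le_right (by linarith) ?_
      rw [le_div_iff₀ (by linarith)]; linarith
    rw [if_neg (by omega), Nat.add_sub_cancel]
    linarith

/-! ### Calculus of epoch-weighted sums, and the constants -/

namespace Params

variable {p : Params} {N : ℕ}

theorem cumSum_const (hs : p.ScheduleOK) {m : ℕ} (hm : m ≤ p.M) (c : ℝ) :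
    p.cumSum (fun _ => c) m = p.τ m * c := by
  induction m with
  | zero => simp [cumSum, hs.tau_zero]
  | succ m ih =>
    rw [cumSum, Finset.sum_Icc_succ_top (by omega), ← cumSum, ih (by omega), Nat.add_sub_cancel]
    ring

theorem increment_nonneg (hs : p.ScheduleOK) {j : ℕ} (hj : j ≤ p.M) :
    0 ≤ (p.τ j : ℝ) - p.τ (j - 1) :=
  sub_nonneg.2 (by exact_mod_cast hs.tau_pred_le hj)

theorem cumSum_le_cumSum (hs : p.ScheduleOK) {m : ℕ} (hm : m ≤ p.M) {f g : ℕ → ℝ}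
    (h : ∀ j, 1 ≤ j → j ≤ m → f j ≤ g j) : p.cumSum f m ≤ p.cumSum g m :=
  Finset.sum_le_sum fun j hj => by
    obtain ⟨h1, h2⟩ := Finset.mem_Icc.1 hj
    exact mul_le_mul_of_nonneg_left (h j h1 h2) (increment_nonneg hs (h2.trans hm))

theorem cumSum_nonneg (hs : p.ScheduleOK) {m : ℕ} (hm : m ≤ p.M) {f : ℕ → ℝ}
    (h : ∀ j, 1 ≤ j → j ≤ m → 0 ≤ f j) : 0 ≤ p.cumSum f m :=
  Finset.sum_nonneg fun j hj => by
    obtain ⟨h1, h2⟩ := Finset.mem_Icc.1 hj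
    exact mul_nonneg (increment_nonneg hs (h2.trans hm)) (h j h1 h2)

theorem cumSum_mono (hs : p.ScheduleOK) {i m : ℕ} (him : i ≤ m) (hm : m ≤ p.M) {f : ℕ → ℝ}
    (h : ∀ j, 1 ≤ j → j ≤ m → 0 ≤ f j) : p.cumSum f i ≤ p.cumSum f m :=
  Finset.sum_le_sum_of_subset_of_nonneg (Finset.Icc_subset_Icc_right him) fun j hj _ => by
    obtain ⟨h1, h2⟩ := Finset.mem_Icc.1 hj
    exact mul_nonneg (increment_nonneg hs (h2.trans hm)) (h j h1 h2)

theorem cumSum_add (f g : ℕ → ℝ) (m : ℕ) :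
    p.cumSum (fun j => f j + g j) m = p.cumSum f m + p.cumSum g m := by
  simp [cumSum, mul_add, Finset.sum_add_distrib]

theorem cumSum_sub (f g : ℕ → ℝ) (m : ℕ) :
    p.cumSum (fun j => f j - g j) m = p.cumSum f m - p.cumSum g m := by
  simp [cumSum, mul_sub, Finset.sum_sub_distrib]

theorem cumSum_const_mul (c : ℝ) (f : ℕ → ℝ) (m : ℕ) :
    p.cumSum (fun j => c * f j) m = c * p.cumSum f m := by
  simp only [cumSum, Finset.mul_sum]
  exact Finset.sum_congr rfl fun _ _ => by ring

theorem tau_mul_radius (hs : p.ScheduleOK) {m : ℕ} (h1 : 1 ≤ m) (hm : m ≤ p.M) (x : ℝ) :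
    p.τ m * p.radius N m (x / p.τ m) =
      p.c₁ * √(32 * p.logTerm N m * x) + p.c₂ * (32 * p.logTerm N m) * Real.log (p.τ m) := by
  have hτ := hs.three_le_tau h1 hm
  rw [radius, if_neg (by omega), ← tau_mul_eps hs h1 hm]
  have : √(p.τ m * p.eps N m * x) = p.τ m * √(p.eps N m * (x / p.τ m)) := by
    conv_rhs => rw [← Real.sqrt_sq (show (0 : ℝ) ≤ p.τ m by linarith),
      ← Real.sqrt_mul (sq_nonneg _), Real.sqrt_sq (show (0 : ℝ) ≤ p.τ m by linarith)]
    congr 1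
    field_simp
  rw [this]
  ring

end Params

theorem Params.ConstantsOK.c₁_facts {p : Params} {N : ℕ} (hc : p.ConstantsOK N) :
    4 ≤ p.c₁ ∧ 24 * p.α ^ 2 ≤ p.c₁ ^ 2 ∧ 200 * p.c₁ ≤ p.c₂ := by
  have h1 := hc.c₁
  have hα := hc.alpha
  have h6 : (2 : ℝ) ≤ √6 := Real.le_sqrt_of_sq_le (by norm_num)
  have h66 : √6 ^ 2 = (6 : ℝ) := Real.sq_sqrt (by norm_num)
  have h4 : 4 ≤ p.c₁ := by nlinarith
  have hsq : (2 * p.α * √6) ^ 2 ≤ p.c₁ ^ 2 := pow_le_pow_left₀ (by positivity) h1 2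
  have e : (2 * p.α * √6) ^ 2 = 24 * p.α ^ 2 := by rw [mul_pow, h66]; ring
  refine ⟨h4, by linarith, ?_⟩
  have h5 := mul_le_mul_of_nonneg_right hc.eta (sq_nonneg p.c₁)
  have := hc.c₂
  nlinarith

/-! ### Induction over epochs on the good event -/

namespace Trajectory

variable {𝒳 : Type*} [MeasurableSpace 𝒳] {T : Trajectory 𝒳} {p : Params} {H : Finset (𝒳 → Bool)}
  {D : Measure (𝒳 × Bool)} {hstar : 𝒳 → Bool}

/-- The standing assumptions of the theorem for a single execution. -/
structure Setting (T : Trajectory 𝒳) (p : Params) (H : Finset (𝒳 → Bool))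
    (D : Measure (𝒳 × Bool)) (hstar : 𝒳 → Bool) : Prop where
  valid : T.IsValid p H D
  schedule : p.ScheduleOK
  const : p.ConstantsOK H.card
  measurable : ∀ h ∈ H, Measurable h
  star_mem : hstar ∈ H
  star_min : ∀ h ∈ H, err D hstar ≤ err D h
  two_le_log : 2 ≤ Real.log (H.card / p.δ)

/-- The cumulative weighted regret of `g`. -/
def lossGap (T : Trajectory 𝒳) (p : Params) (H : Finset (𝒳 → Bool)) (hstar : 𝒳 → Bool) (m : ℕ)
    (g : 𝒳 → Bool) : ℝ := T.cumLoss p H m g - T.cumLoss p H m hstar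

/-- The mean regret of `g` in epoch `j`, given the past. -/
def epochGap (T : Trajectory 𝒳) (p : Params) (H : Finset (𝒳 → Bool)) (D : Measure (𝒳 × Bool))
    (hstar g : 𝒳 → Bool) (j : ℕ) : ℝ := T.meanLoss p H D j g - T.meanLoss p H D j hstar

/-- The sum of the conditional means of the weighted regret of `g`. -/
def meanGap (T : Trajectory 𝒳) (p : Params) (H : Finset (𝒳 → Bool)) (D : Measure (𝒳 × Bool))
    (hstar : 𝒳 → Bool) (m : ℕ) (g : 𝒳 → Bool) : ℝ := p.cumSum (T.epochGap p H D hstar g) m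

/-- The radius `τ_m Δ_m` for cumulative losses. -/
def scaledDelta (T : Trajectory 𝒳) (p : Params) (H : Finset (𝒳 → Bool)) (m : ℕ) : ℝ :=
  p.τ m * T.Delta p H m

/-- The weighted regrets are close to their conditional means after `m` epochs. -/
def GapClose (T : Trajectory 𝒳) (p : Params) (H : Finset (𝒳 → Bool)) (D : Measure (𝒳 × Bool))
    (hstar : 𝒳 → Bool) (m : ℕ) : Prop :=
  ∀ g ∈ H, |T.lossGap p H hstar m g - T.meanGap p H D hstar m g|
    ≤ T.meanGap p H D hstar m g / 2 + p.η * T.scaledDelta p H m / 8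

namespace Setting

theorem scaledDelta_eq (h : T.Setting p H D hstar) {m : ℕ} (h1 : 1 ≤ m) (hm : m ≤ p.M) :
    T.scaledDelta p H m = p.c₁ * √(32 * p.logTerm H.card m * T.minLoss p H m)
      + p.c₂ * (32 * p.logTerm H.card m) * Real.log (p.τ m) := by
  rw [scaledDelta, Delta, empErr_sample h.schedule hm, Params.tau_mul_radius h.schedule h1 hm,
    minLoss]

theorem c₂_pos (h : T.Setting p H D hstar) : 0 < p.c₂ := by
  obtain ⟨h1, -, h3⟩ := h.const.c₁_facts
  linarith

theorem γ_pos (h : T.Setting p H D hstar) : 0 < p.γ := by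
  have := h.const.eta; have := h.const.gamma
  linarith

theorem scaledDelta_nonneg (h : T.Setting p H D hstar) {m : ℕ} (h1 : 1 ≤ m) (hm : m ≤ p.M) :
    0 ≤ T.scaledDelta p H m := by
  rw [h.scaledDelta_eq h1 hm]
  have := h.const.c₁_facts.1
  have := h.c₂_pos
  have := Params.three_le_logTerm h.schedule h.two_le_log h1 hm
  have := h.schedule.one_le_log_tau h1 hm
  positivity

theorem Delta_nonneg (h : T.Setting p H D hstar) {m : ℕ} (h1 : 1 ≤ m) (hm : m ≤ p.M) :
    0 ≤ T.Delta p H m :=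
  nonneg_of_mul_nonneg_right (h.scaledDelta_nonneg h1 hm)
    (by have := h.schedule.three_le_tau h1 hm; linarith)

theorem scaledDelta_mono (h : T.Setting p H D hstar) {i m : ℕ} (h1 : 1 ≤ i) (him : i ≤ m)
    (hm : m ≤ p.M) : T.scaledDelta p H i ≤ T.scaledDelta p H m := by
  rw [h.scaledDelta_eq h1 (him.trans hm), h.scaledDelta_eq (h1.trans him) hm]
  have e1 := h.const.c₁_facts.1
  have e2 := h.c₂_pos
  have e3 := Params.three_le_logTerm h.schedule h.two_le_log h1 (him.trans hm)
  have e4 := h.schedule.one_le_log_tau h1 (him.trans hm)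
  have e5 := h.schedule.log_tau_le h1 him hm
  have e6 : p.logTerm H.card i ≤ p.logTerm H.card m := by
    rw [Params.logTerm, Params.logTerm]; linarith
  have e7 := h.valid.minLoss_mono h.schedule h1 him hm
  have e8 : 0 ≤ T.minLoss p H i := h.valid.cumLoss_nonneg (him.trans hm) _
  have e9 : √(32 * p.logTerm H.card i * T.minLoss p H i) ≤
      √(32 * p.logTerm H.card m * T.minLoss p H m) :=
    Real.sqrt_le_sqrt (mul_le_mul (by linarith) e7 e8 (by linarith))
  refine add_le_add (mul_le_mul_of_nonneg_left e9 (by linarith)) ?_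
  exact mul_le_mul (mul_le_mul_of_nonneg_left (by linarith) e2.le) e5 (by linarith)
    (mul_nonneg e2.le (by linarith))

theorem erm_mem_A (h : T.Setting p H D hstar) {m : ℕ} (h1 : 1 ≤ m) (hm : m ≤ p.M) :
    T.h (m + 1) ∈ T.A p H (m + 1) := by
  obtain ⟨k, rfl⟩ : ∃ k, m = k + 1 := ⟨m - 1, by omega⟩
  rw [A_succ_succ]
  refine ⟨h.valid.erm_mem_succ h1 hm, ?_⟩
  rw [empReg, sub_self]
  exact mul_nonneg h.γ_pos.le (h.Delta_nonneg h1 hm)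

theorem lossGap_erm_nonpos (h : T.Setting p H D hstar) {m : ℕ} (h1 : 1 ≤ m) (hm : m ≤ p.M) :
    T.lossGap p H hstar m (T.h (m + 1)) ≤ 0 :=
  sub_nonpos.2 (h.valid.minLoss_le h.schedule h1 hm h.star_mem)

theorem empReg_star_eq (h : T.Setting p H D hstar) {m : ℕ} (hm : m ≤ p.M) (g : 𝒳 → Bool) :
    empReg g (T.h (m + 1)) (T.sample p H m) =
      (T.lossGap p H hstar m g - T.lossGap p H hstar m (T.h (m + 1))) / p.τ m := by
  rw [empReg, empErr_sample h.schedule hm, empErr_sample h.schedule hm, lossGap, lossGap]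
  ring

theorem meanGap_erm_le (h : T.Setting p H D hstar) {m : ℕ} (h1 : 1 ≤ m) (hm : m ≤ p.M)
    (hG : T.GapClose p H D hstar m) :
    T.meanGap p H D hstar m (T.h (m + 1)) ≤ p.η * T.scaledDelta p H m / 4 := by
  have hmem := h.valid.erm_mem_succ h1 hm
  have e1 := (abs_le.1 (hG _ hmem)).1
  have e2 := h.lossGap_erm_nonpos h1 hm
  linarith

variable [IsProbabilityMeasure D]

theorem reg_le_epochGap (h : T.Setting p H D hstar) {j : ℕ} (h1 : 1 ≤ j) (hj : j ≤ p.M)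
    (hA : hstar ∈ T.A p H j) {g : 𝒳 → Bool} (hg : g ∈ H) :
    reg D g hstar ≤ T.epochGap p H D hstar g j :=
  h.valid.reg_le_meanLoss_sub h.measurable h.star_mem hj hA (fun h2 => by
    obtain ⟨k, rfl⟩ : ∃ k, j = k + 1 := ⟨j - 1, by omega⟩
    exact h.erm_mem_A (by omega) (by omega)) hg

theorem epochGap_nonneg (h : T.Setting p H D hstar) {j : ℕ} (h1 : 1 ≤ j) (hj : j ≤ p.M)
    (hA : hstar ∈ T.A p H j) {g : 𝒳 → Bool} (hg : g ∈ H) :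
    0 ≤ T.epochGap p H D hstar g j :=
  (sub_nonneg.2 (h.star_min g hg)).trans (h.reg_le_epochGap h1 hj hA hg)

theorem tau_mul_reg_le (h : T.Setting p H D hstar) {m : ℕ} (hm : m ≤ p.M)
    (hA : ∀ j, 1 ≤ j → j ≤ m → hstar ∈ T.A p H j) {g : 𝒳 → Bool} (hg : g ∈ H) :
    p.τ m * reg D g hstar ≤ T.meanGap p H D hstar m g := by
  rw [← Params.cumSum_const h.schedule hm]
  exact Params.cumSum_le_cumSum h.schedule hm fun j h1 h2 =>
    h.reg_le_epochGap h1 (h2.trans hm) (hA j h1 h2) hg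

theorem meanGap_nonneg (h : T.Setting p H D hstar) {m : ℕ} (hm : m ≤ p.M)
    (hA : ∀ j, 1 ≤ j → j ≤ m → hstar ∈ T.A p H j) {g : 𝒳 → Bool} (hg : g ∈ H) :
    0 ≤ T.meanGap p H D hstar m g :=
  Params.cumSum_nonneg h.schedule hm fun j h1 h2 =>
    h.epochGap_nonneg h1 (h2.trans hm) (hA j h1 h2) hg

/-- The mean gap of the minimizer is nonnegative, so its loss gap can be negative only through
deviation. -/
theorem neg_lossGap_erm_le (h : T.Setting p H D hstar) {m : ℕ} (h1 : 1 ≤ m) (hm : m ≤ p.M)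
    (hA : ∀ j, 1 ≤ j → j ≤ m → hstar ∈ T.A p H j) (hG : T.GapClose p H D hstar m) :
    -T.lossGap p H hstar m (T.h (m + 1)) ≤ p.η * T.scaledDelta p H m / 8 := by
  have hmem := h.valid.erm_mem_succ h1 hm
  have e1 := (abs_le.1 (hG _ hmem)).1
  have e2 := h.meanGap_nonneg hm hA hmem
  linarith

theorem empReg_star_le (h : T.Setting p H D hstar) {m : ℕ} (h1 : 1 ≤ m) (hm : m ≤ p.M)
    (hA : ∀ j, 1 ≤ j → j ≤ m → hstar ∈ T.A p H j) (hG : T.GapClose p H D hstar m) :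
    empReg hstar (T.h (m + 1)) (T.sample p H m) ≤ p.η * T.Delta p H m / 8 := by
  have hτ := h.schedule.three_le_tau h1 hm
  have e1 := h.neg_lossGap_erm_le h1 hm hA hG
  have e2 : T.lossGap p H hstar m hstar = 0 := sub_self _
  rw [h.empReg_star_eq hm, div_le_iff₀ (by linarith), e2]
  rw [scaledDelta] at e1
  linarith

/-- The empirical regret of `hstar` is at most `η Δ_m / 8`, and `γ ≥ η / 4` admits twice that. -/
theorem star_mem_A_succ (h : T.Setting p H D hstar) {m : ℕ} (h1 : 1 ≤ m) (hm : m ≤ p.M)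
    (hA : ∀ j, 1 ≤ j → j ≤ m → hstar ∈ T.A p H j) (hG : T.GapClose p H D hstar m) :
    hstar ∈ T.A p H (m + 1) := by
  have e1 := h.empReg_star_le h1 hm hA hG
  have e2 := h.Delta_nonneg h1 hm
  have e3 := mul_le_mul_of_nonneg_right h.const.gamma e2
  have e4 : 0 ≤ p.η * T.Delta p H m := mul_nonneg (by linarith [h.const.eta]) e2
  obtain ⟨k, rfl⟩ : ∃ k, m = k + 1 := ⟨m - 1, by omega⟩
  rw [A_succ_succ]
  refine ⟨h.star_mem, e1.trans ?_⟩
  change _ ≤ p.γ * T.Delta p H (k + 1)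
  linarith

/-- The bound on the second moments in one epoch. -/
theorem secondMoment_le_epoch (h : T.Setting p H D hstar) {m j : ℕ} (hm : m ≤ p.M)
    (hA : ∀ j, 1 ≤ j → j ≤ m → hstar ∈ T.A p H j)
    (hG : ∀ j, 1 ≤ j → j < m → T.GapClose p H D hstar j) (h1 : 1 ≤ j) (hj : j ≤ m)
    {a b : ℝ} (hab : a ^ 2 = 1 ∧ b = -a) {g : 𝒳 → Bool} (hg : g ∈ H) {x : ℝ} (hx0 : 0 ≤ x)
    (hx : p.ξ ≤ x) :
    T.secondMoment p H D a b g hstar j ≤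
      2 * p.α ^ 2 * (T.epochGap p H D hstar g j + 6 * T.regionErr p H D hstar j)
      + (p.α ^ 2 * p.η * T.scaledDelta p H m
        + 2 * p.β ^ 2 * p.γ * T.scaledDelta p H m *
          (3 / 2 * T.meanGap p H D hstar m g + 3 / 8 * (p.η * T.scaledDelta p H m))
        + 2 * x * T.scaledDelta p H m ^ 2) * (if j ≤ 1 then 0 else 1 / (p.τ (j - 1) : ℝ)) := by
  have hα := h.const.alpha
  have hα2 : 1 ≤ p.α ^ 2 := one_le_pow₀ hα
  have hE0 : ∀ i, 0 ≤ T.regionErr p H D hstar i := fun i => measureReal_nonneg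
  have hρ := h.epochGap_nonneg h1 (hj.trans hm) (hA j h1 hj) hg
  obtain rfl | h2 := h1.eq_or_lt
  · rw [if_pos le_rfl, mul_zero, add_zero]
    refine (h.valid.secondMoment_one_le h.measurable h.star_mem (hj.trans hm) hab hg).trans ?_
    change T.epochGap p H D hstar g 1 + _ ≤ _
    nlinarith [hE0 1, mul_nonneg (sub_nonneg.2 hα2) hρ, mul_nonneg (sub_nonneg.2 hα2) (hE0 1)]
  · obtain ⟨i, rfl⟩ : ∃ k, j = k + 1 := ⟨j - 1, by omega⟩
    have hi1 : 1 ≤ i := by omega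
    have hiM : i ≤ p.M := by omega
    have hAi : ∀ j, 1 ≤ j → j ≤ i → hstar ∈ T.A p H j := fun j a b => hA j a (by omega)
    have hGi := hG i hi1 (by omega)
    have hτ := h.schedule.three_le_tau hi1 hiM
    have hsm := h.valid.secondMoment_le h.schedule h.const.c₃ hα h.measurable h.star_mem h2
      (hj.trans hm) (hA _ h1 hj) (h.erm_mem_A hi1 hiM) hab hg
    change _ ≤ 2 * p.α ^ 2 * (T.epochGap p H D hstar g (i + 1) + _ + _) + _ + _ at hsm
    rw [Nat.add_sub_cancel] at hsm ⊢
    rw [if_neg (by omega), mul_one_div]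
    rw [h.empReg_star_eq hiM, h.empReg_star_eq hiM] at hsm
    have e0 : T.lossGap p H hstar i hstar = 0 := sub_self _
    have e1 := h.neg_lossGap_erm_le hi1 hiM hAi hGi
    have e2 := (h.tau_mul_reg_le hiM hAi (h.valid.erm_mem_succ hi1 hiM)).trans
      (h.meanGap_erm_le hi1 hiM hGi)
    have e3 := (abs_le.1 (hGi g hg)).2
    have e4 : T.meanGap p H D hstar i g ≤ T.meanGap p H D hstar m g :=
      Params.cumSum_mono h.schedule (by omega) hm fun j a b =>
        h.epochGap_nonneg a (b.trans hm) (hA j a b) hg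
    have e5 := h.scaledDelta_mono hi1 (show i ≤ m by omega) hm
    have e6 := h.scaledDelta_nonneg hi1 hiM
    have e7 : T.Delta p H i = T.scaledDelta p H i / p.τ i := by
      rw [scaledDelta]; field_simp
    have e8 := h.meanGap_nonneg hm hA hg
    have hη := h.const.eta
    rw [e0, e7] at hsm
    refine hsm.trans ?_
    generalize T.scaledDelta p H i = Bi at *
    generalize T.scaledDelta p H m = B at *
    generalize T.meanGap p H D hstar m g = R at *
    generalize T.meanGap p H D hstar i g = Ri at *
    generalize T.lossGap p H hstar i g = Li at *
    generalize T.lossGap p H hstar i (T.h (i + 1)) = X at *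
    generalize reg D (T.h (i + 1)) hstar = r at *
    generalize T.epochGap p H D hstar g (i + 1) + 6 * T.regionErr p H D hstar (i + 1) = y at *
    generalize (p.τ i : ℝ) = t at *
    have ht : 0 < t := by linarith
    -- The true regret of `h_j` is controlled by `GapClose` in the preceding epoch: `t r ≤ η Bi /
    -- 4`.
    have f1 : 4 * p.α ^ 2 * r ≤ p.α ^ 2 * p.η * B / t := by
      rw [le_div_iff₀ ht]
      have : p.η * Bi ≤ p.η * B := mul_le_mul_of_nonneg_left e5 (by linarith)
      have := mul_le_mul_of_nonneg_left (show 4 * (t * r) ≤ p.η * B by linarith)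
        (by linarith : 0 ≤ p.α ^ 2)
      linarith
    -- `Li - X` and `-X` are the cumulative empirical regrets of `g` and `hstar`. `GapClose` gives
    -- `Li ≤ 3/2 Ri + η Bi / 8` and `-X ≤ η Bi / 8`, whence `3/8`.
    have f2 : 2 * p.β ^ 2 * p.γ * ((Li - X) / t + (0 - X) / t) * t * (Bi / t) ≤
        2 * p.β ^ 2 * p.γ * B * (3 / 2 * R + 3 / 8 * (p.η * B)) / t := by
      have hk : 0 ≤ 2 * p.β ^ 2 * p.γ := by have := h.γ_pos; positivity
      have : 2 * p.β ^ 2 * p.γ * ((Li - X) / t + (0 - X) / t) * t * (Bi / t) =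
        2 * p.β ^ 2 * p.γ * (Bi * (Li - 2 * X)) / t := by field_simp; ring
      rw [this]
      refine div_le_div_of_nonneg_right ?_ ht.le
      rw [mul_assoc _ B]
      refine mul_le_mul_of_nonneg_left ?_ hk
      have g0 : p.η * Bi ≤ p.η * B := mul_le_mul_of_nonneg_left e5 (by linarith)
      have g1 : Li - 2 * X ≤ 3 / 2 * R + 3 / 8 * (p.η * B) := by linarith
      have g2 : 0 ≤ p.η * B := mul_nonneg (by linarith) (e6.trans e5)
      calc Bi * (Li - 2 * X) ≤ Bi * (3 / 2 * R + 3 / 8 * (p.η * B)) :=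
            mul_le_mul_of_nonneg_left g1 e6
        _ ≤ _ := mul_le_mul_of_nonneg_right e5 (by linarith)
    -- `ξ` may be negative, so it is replaced by its nonnegative bound `x` before `Bi` is enlarged
    -- to `B`.
    have f3 : 2 * (p.ξ * t * (Bi / t) ^ 2) ≤ 2 * x * B ^ 2 / t := by
      have : 2 * (p.ξ * t * (Bi / t) ^ 2) = 2 * (p.ξ * Bi ^ 2) / t := by field_simp
      rw [this]
      refine div_le_div_of_nonneg_right ?_ ht.le
      have g1 := mul_le_mul_of_nonneg_right hx (sq_nonneg Bi)
      have g2 := mul_le_mul_of_nonneg_left (pow_le_pow_left₀ e6 e5 2) hx0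
      linarith
    rw [add_div, add_div]
    linarith

/-- Summing the terms in `1 / τ_{j-1}` costs a factor `2 log τ_m`, which the conditions on the
constants absorb: `c₂` handles the regret of `h_j` (giving `1/3 B²`), the bound on `β` the empirical
regrets (giving the terms in `η`), and the bound on `ξ` the last term (giving `1/2 B²`); `5/6 = 1/3
+ 1/2`. -/
theorem scaled_secondMoment_le (h : T.Setting p H D hstar) {m : ℕ} (h1 : 1 ≤ m) (hm : m ≤ p.M)
    (hA : ∀ j, 1 ≤ j → j ≤ m → hstar ∈ T.A p H j)
    (hG : ∀ j, 1 ≤ j → j < m → T.GapClose p H D hstar j)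
    {a b : ℝ} (hab : a ^ 2 = 1 ∧ b = -a) {g : 𝒳 → Bool} (hg : g ∈ H) :
    32 * p.logTerm H.card m * p.cumSum (T.secondMoment p H D a b g hstar) m ≤
      2 * p.α ^ 2 * (32 * p.logTerm H.card m) *
        (T.meanGap p H D hstar m g + 6 * p.cumSum (T.regionErr p H D hstar) m)
      + p.η / 144 * (T.scaledDelta p H m * T.meanGap p H D hstar m g)
      + p.η ^ 2 / 576 * T.scaledDelta p H m ^ 2 + 5 / 6 * T.scaledDelta p H m ^ 2 := by
  have hs := h.schedule
  have hL := Params.three_le_logTerm hs h.two_le_log h1 hm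
  have hℓ := hs.one_le_log_tau h1 hm
  have hnε := Params.le_n_mul_eps hs h.two_le_log
  have hLn : 32 * p.logTerm H.card m ≤ p.n * p.eps H.card p.M := by
    rw [← Params.tau_mul_eps hs h1 hm]
    exact Params.tau_mul_eps_le hs h.two_le_log h1 hm
  have hlogn : Real.log (p.τ m) ≤ Real.log p.n := by
    have := hs.three_le_tau h1 hm
    exact Real.log_le_log (by linarith)
      (by exact_mod_cast (hs.tau_mono hm le_rfl).trans hs.tau_M_le)
  have hc₁ := h.const.c₁_facts
  have hB := h.scaledDelta_eq h1 hm
  have hB0 := h.scaledDelta_nonneg h1 hm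
  have hR := h.meanGap_nonneg hm hA hg
  have hη := h.const.eta
  have hγ := h.γ_pos
  have hc₂ := h.const.c₂
  set G := p.n * p.eps H.card p.M * Real.log p.n with hGdef
  have hG0 : 0 < G := mul_pos (by linarith) (by linarith)
  have hx0 : 0 ≤ 1 / (8 * G) := by positivity
  have hx : p.ξ ≤ 1 / (8 * G) := by
    refine h.const.xi.trans (le_of_eq ?_)
    rw [hGdef]; congr 1; ring
  have hβ : p.β ^ 2 * p.γ * G ≤ p.η / 864 := by
    have e := mul_le_mul_of_nonneg_right h.const.beta (mul_pos hγ hG0).le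
    have e2 : p.η / (864 * p.γ * p.n * p.eps H.card p.M * Real.log p.n) * (p.γ * G) =
        p.η / 864 := by
      have : 864 * p.γ * p.n * p.eps H.card p.M * Real.log p.n = 864 * (p.γ * G) := by
        rw [hGdef]; ring
      rw [this]
      have := (mul_pos hγ hG0).ne'
      field_simp
    linarith
  have hαmono : 32 * p.logTerm H.card m * Real.log (p.τ m) ≤ G :=
    mul_le_mul hLn hlogn (by linarith) (by linarith)
  have hsum := Params.cumSum_le_cumSum hs hm fun j a b =>
    h.secondMoment_le_epoch hm hA hG a b hab hg hx0 hx
  rw [Params.cumSum_add, Params.cumSum_const_mul, Params.cumSum_const_mul, Params.cumSum_add,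
    Params.cumSum_const_mul] at hsum
  change _ ≤ 2 * p.α ^ 2 * (T.meanGap p H D hstar m g + _) + _ at hsum
  have hinc := hs.sum_increment_div_le h1 hm
  generalize p.cumSum (T.secondMoment p H D a b g hstar) m = V at *
  generalize p.cumSum (T.regionErr p H D hstar) m = S at *
  generalize T.meanGap p H D hstar m g = R at *
  generalize p.cumSum (fun j => if j ≤ 1 then 0 else 1 / (p.τ (j - 1) : ℝ)) m = w at *
  have hc2B : p.c₂ * (32 * p.logTerm H.card m * Real.log (p.τ m)) ≤ T.scaledDelta p H m := by
    rw [hB]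
    have : 0 ≤ p.c₁ * √(32 * p.logTerm H.card m * T.minLoss p H m) :=
      mul_nonneg (by linarith [hc₁.1]) (Real.sqrt_nonneg _)
    linarith
  have hu : 0 ≤ 32 * p.logTerm H.card m := by linarith
  generalize T.scaledDelta p H m = B at *
  generalize 32 * p.logTerm H.card m = u at *
  generalize Real.log (p.τ m) = ℓ at *
  have hηB : 0 ≤ p.η * B := mul_nonneg (by linarith) hB0
  set K := p.α ^ 2 * p.η * B + 2 * p.β ^ 2 * p.γ * B * (3 / 2 * R + 3 / 8 * (p.η * B))
    + 2 * (1 / (8 * G)) * B ^ 2 with hK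
  have hK0 : 0 ≤ K := by
    have := sq_nonneg p.α
    positivity
  have k1 : u * V ≤ u * (2 * p.α ^ 2 * (R + 6 * S) + K * (2 * ℓ)) :=
    mul_le_mul_of_nonneg_left (hsum.trans (by
      have := mul_le_mul_of_nonneg_left hinc hK0
      linarith)) hu
  have huℓ : 0 ≤ u * ℓ := mul_nonneg hu (by linarith)
  have k2 : 2 * (u * ℓ) * (p.α ^ 2 * p.η * B) ≤ 1 / 3 * B ^ 2 := by
    have g1 : p.η * (24 * p.α ^ 2) ≤ 4 * p.c₂ := by
      have := mul_le_mul_of_nonneg_left hc₁.2.1 (by linarith : 0 ≤ p.η)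
      linarith
    have g2 := mul_le_mul_of_nonneg_right g1 huℓ
    have g3 := mul_le_mul_of_nonneg_right (show p.η * (24 * p.α ^ 2) * (u * ℓ) ≤ 4 * B by linarith)
      hB0
    linarith
  have k3 : 2 * (u * ℓ) * (2 * p.β ^ 2 * p.γ * B * (3 / 2 * R + 3 / 8 * (p.η * B))) ≤
      p.η / 144 * (B * R) + p.η ^ 2 / 576 * B ^ 2 := by
    have g0 : 0 ≤ p.β ^ 2 * p.γ := by positivity
    have g1 : p.β ^ 2 * p.γ * (u * ℓ) ≤ p.η / 864 :=
      (mul_le_mul_of_nonneg_left hαmono g0).trans hβ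
    have g2 : 0 ≤ B * (6 * R + 3 / 2 * (p.η * B)) := by positivity
    have g3 := mul_le_mul_of_nonneg_right g1 g2
    linarith
  have k4 : 2 * (u * ℓ) * (2 * (1 / (8 * G)) * B ^ 2) ≤ 1 / 2 * B ^ 2 := by
    have g1 : u * ℓ * (1 / G) ≤ 1 := by rw [mul_one_div]; exact (div_le_one hG0).2 hαmono
    have g2 := mul_le_mul_of_nonneg_right g1 (sq_nonneg B)
    have g3 : 1 / (8 * G) = 1 / 8 * (1 / G) := by field_simp
    rw [g3]
    linarith
  have : u * (2 * p.α ^ 2 * (R + 6 * S) + K * (2 * ℓ)) = 2 * p.α ^ 2 * u * (R + 6 * S) +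
    2 * (u * ℓ) * (p.α ^ 2 * p.η * B) +
    2 * (u * ℓ) * (2 * p.β ^ 2 * p.γ * B * (3 / 2 * R + 3 / 8 * (p.η * B))) +
    2 * (u * ℓ) * (2 * (1 / (8 * G)) * B ^ 2) := by rw [hK]; ring
  linarith

end Setting

end Trajectory

namespace Trajectory

variable {𝒳 : Type*} [MeasurableSpace 𝒳] {T : Trajectory 𝒳} {p : Params} {H : Finset (𝒳 → Bool)}
  {D : Measure (𝒳 × Bool)} {hstar : 𝒳 → Bool}

theorem secondMoment_neg (a b : ℝ) (g g' : 𝒳 → Bool) :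
    T.secondMoment p H D (-a) (-b) g g' = T.secondMoment p H D a b g g' := by
  funext j
  simp only [secondMoment]
  congr 1
  funext z
  congr 1
  ring

namespace Setting

theorem scaled_invPmin_le (h : T.Setting p H D hstar) {m : ℕ} (h1 : 1 ≤ m) (hm : m ≤ p.M) :
    32 * p.logTerm H.card m * T.invPmin p H m ≤
      √(32 * p.logTerm H.card m * T.minLoss p H m)
        + 2 * (32 * p.logTerm H.card m) * Real.log (p.τ m) := by
  have hs := h.schedule
  have hτ := hs.three_le_tau h1 hm
  have e1 := mul_le_mul_of_nonneg_left (h.valid.eps_mul_invPmin_le hs h.const.c₃ h.two_le_log h1 hm)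
    (show (0 : ℝ) ≤ p.τ m by linarith)
  have e2 : √(32 * p.logTerm H.card m * T.minLoss p H m) =
      p.τ m * √(p.eps H.card m * (T.minLoss p H m / p.τ m)) := by
    rw [← Params.tau_mul_eps hs h1 hm]
    conv_rhs => rw [← Real.sqrt_sq (show (0 : ℝ) ≤ p.τ m by linarith),
      ← Real.sqrt_mul (sq_nonneg _), Real.sqrt_sq (show (0 : ℝ) ≤ p.τ m by linarith)]
    congr 1
    field_simp
  rw [e2, ← Params.tau_mul_eps hs h1 hm]
  linarith

end Setting

variable [IsProbabilityMeasure D]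

theorem IsValid.secondMoment_mem_Icc (hv : T.IsValid p H D) (hs : p.ScheduleOK) (hc : 1 ≤ p.c₃)
    {j : ℕ} (hj : j ≤ p.M) (g g' : 𝒳 → Bool) :
    0 ≤ T.secondMoment p H D 1 (-1) g g' j ∧
      T.secondMoment p H D 1 (-1) g g' j ≤ T.invPmin p H j := by
  have h0 : ∀ z, 0 ≤ (1 * T.mistake p H j g z + -1 * T.mistake p H j g' z) ^ 2 /
      T.queryProb p H j z.1 := fun z => div_nonneg (sq_nonneg _) (hv.queryProb_mem_Icc hj _).1
  refine ⟨integral_nonneg h0, ?_⟩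
  have := integral_mono_of_nonneg (μ := D) (Filter.Eventually.of_forall h0)
    (integrable_const (T.invPmin p H j)) (Filter.Eventually.of_forall fun z => by
      obtain ⟨h1, h2⟩ := hv.queryProb_pos_and_inv_le hs hc hj z.1
      change (1 * T.mistake p H j g z + -1 * T.mistake p H j g' z) ^ 2 /
        T.queryProb p H j z.1 ≤ T.invPmin p H j
      rw [div_eq_mul_one_div]
      refine (mul_le_of_le_one_left (one_div_pos.2 h1).le ?_).trans h2
      unfold mistake; split_ifs <;> norm_num)
  rwa [integral_const, probReal_univ, one_smul] at this

namespace Setting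

theorem regionErr_le_meanLoss (h : T.Setting p H D hstar) {j : ℕ} (h1 : 1 ≤ j) (hj : j ≤ p.M)
    (hA : hstar ∈ T.A p H j) :
    T.regionErr p H D hstar j ≤ T.meanLoss p H D j hstar ∧
      T.meanLoss p H D j hstar ≤ T.regionErr p H D hstar j + if j ≤ 1 then 1 else 0 := by
  obtain rfl | h2 := h1.eq_or_lt
  · rw [meanLoss_one_eq_err h.measurable h.star_mem, if_pos le_rfl]
    refine ⟨measureReal_mono fun z hz => hz.1, measureReal_le_one.trans ?_⟩
    have : 0 ≤ T.regionErr p H D hstar 1 := measureReal_nonneg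
    linarith
  · obtain ⟨i, rfl⟩ : ∃ k, j = k + 1 := ⟨j - 1, by omega⟩
    rw [IsValid.meanLoss_eq_regionErr h.measurable h.star_mem h2 hA
      (h.erm_mem_A (by omega) (by omega)), if_neg (by omega)]
    simp

/-- The two sums differ only in the first epoch, which has three examples. -/
theorem cumSum_regionErr_le (h : T.Setting p H D hstar) {m : ℕ} (h1 : 1 ≤ m) (hm : m ≤ p.M)
    (hA : ∀ j, 1 ≤ j → j ≤ m → hstar ∈ T.A p H j) :
    p.cumSum (T.regionErr p H D hstar) m ≤ p.cumSum (fun j => T.meanLoss p H D j hstar) m ∧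
      p.cumSum (fun j => T.meanLoss p H D j hstar) m ≤
        p.cumSum (T.regionErr p H D hstar) m + 3 := by
  have hs := h.schedule
  refine ⟨Params.cumSum_le_cumSum hs hm fun j a b =>
    (h.regionErr_le_meanLoss a (b.trans hm) (hA j a b)).1, ?_⟩
  refine (Params.cumSum_le_cumSum hs hm fun j a b =>
    (h.regionErr_le_meanLoss a (b.trans hm) (hA j a b)).2).trans ?_
  rw [Params.cumSum_add]
  refine add_le_add le_rfl (le_of_eq ?_)
  rw [Params.cumSum, Finset.sum_eq_single_of_mem 1 (Finset.mem_Icc.2 ⟨le_rfl, h1⟩)]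
  · simp [hs.tau_zero, hs.tau_one]
  · intro j hj hne
    have := (Finset.mem_Icc.1 hj).1
    rw [if_neg (by omega), mul_zero]

/-- The variance is at most `q` times the mean, where `q` is `invPmin`, so the scale `k = ⌈2 q⌉`
turns `V / k` into half the mean; and `k ≤ 3 q` gives `3 k L ≤ 9 q L`. -/
theorem abs_cumLoss_star_sub_le (h : T.Setting p H D hstar) (hconc : T.Concentrated p H D hstar)
    {m : ℕ} (h1 : 1 ≤ m) (hm : m ≤ p.M) :
    |T.cumLoss p H m hstar - p.cumSum (fun j => T.meanLoss p H D j hstar) m| ≤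
      p.cumSum (fun j => T.meanLoss p H D j hstar) m / 2
        + 9 / 32 * (32 * p.logTerm H.card m * T.invPmin p H m) := by
  have hs := h.schedule
  have hL := Params.three_le_logTerm hs h.two_le_log h1 hm
  have hq1 := one_le_invPmin (T := T) (H := H) hs h.const.c₃ hm
  have hqt := h.valid.invPmin_le_tau hs h.const.c₃ h.two_le_log h1 hm
  have hvar : ∀ b : ℝ, b ^ 2 = 1 → p.cumSum (T.secondMoment p H D 0 b hstar hstar) m ≤
      T.invPmin p H m * p.cumSum (fun j => T.meanLoss p H D j hstar) m := fun b hb => by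
    rw [← Params.cumSum_const_mul]
    refine Params.cumSum_le_cumSum hs hm fun j j1 jm => ?_
    refine (h.valid.secondMoment_le_of_star hs h.const.c₃ h.measurable h.star_mem
      (jm.trans hm) hb hstar).trans (mul_le_mul_of_nonneg_right
        (h.valid.invPmin_mono hs h.const.c₃ h.two_le_log j1 jm hm)
        (integral_nonneg fun z => mistake_nonneg _ _ _))
  have hMn : 0 ≤ p.cumSum (fun j => T.meanLoss p H D j hstar) m :=
    Params.cumSum_nonneg hs hm fun j _ _ => integral_nonneg fun z => mistake_nonneg _ _ _
  have hk1 : 2 * T.invPmin p H m ≤ ⌈2 * T.invPmin p H m⌉₊ := Nat.le_ceil _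
  have hk2 : (⌈2 * T.invPmin p H m⌉₊ : ℝ) < 2 * T.invPmin p H m + 1 :=
    Nat.ceil_lt_add_one (by linarith)
  generalize ⌈2 * T.invPmin p H m⌉₊ = k at *
  have hk0 : (0 : ℝ) < k := by linarith
  have hkmem : k ∈ Finset.Icc 1 (3 * p.τ m) := by
    refine Finset.mem_Icc.2 ⟨by exact_mod_cast hk0, ?_⟩
    have : (k : ℝ) ≤ ((3 * p.τ m : ℕ) : ℝ) := by push_cast; linarith
    exact_mod_cast this
  have hbound : ∀ b : ℝ, b ^ 2 = 1 → p.cumSum (T.secondMoment p H D 0 b hstar hstar) m / k +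
      3 * k * p.logTerm H.card m ≤ p.cumSum (fun j => T.meanLoss p H D j hstar) m / 2
        + 9 / 32 * (32 * p.logTerm H.card m * T.invPmin p H m) := fun b hb => by
    refine add_le_add ?_ ?_
    · rw [div_le_iff₀ hk0]
      have e1 := hvar b hb
      have e2 := mul_le_mul_of_nonneg_right hk1 hMn
      linarith
    · have := mul_le_mul_of_nonneg_right (show (k : ℝ) ≤ 3 * T.invPmin p H m by linarith)
        (show 0 ≤ p.logTerm H.card m by linarith)
      linarith
  have c1 := hconc m (Finset.mem_Icc.2 ⟨h1, hm⟩) k hkmem (0, 1) (by simp [coefficients])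
    hstar h.star_mem (by linarith)
  have c2 := hconc m (Finset.mem_Icc.2 ⟨h1, hm⟩) k hkmem (0, -1) (by simp [coefficients])
    hstar h.star_mem (by linarith)
  have b1 := hbound 1 (by norm_num)
  have b2 := hbound (-1) (by norm_num)
  simp only at c1 c2
  rw [abs_le]
  constructor <;> linarith

theorem abs_lossGap_sub_le (h : T.Setting p H D hstar) (hconc : T.Concentrated p H D hstar)
    {m : ℕ} (h1 : 1 ≤ m) (hm : m ≤ p.M) {g : 𝒳 → Bool} (hg : g ∈ H) :
    |T.lossGap p H hstar m g - T.meanGap p H D hstar m g| ≤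
      19 / 16 * √(32 * p.logTerm H.card m * p.cumSum (T.secondMoment p H D 1 (-1) g hstar) m)
        + 3 / 16 * (32 * p.logTerm H.card m * T.invPmin p H m) := by
  have hs := h.schedule
  have hL := Params.three_le_logTerm hs h.two_le_log h1 hm
  have hq1 := one_le_invPmin (T := T) (H := H) hs h.const.c₃ hm
  have hqt := h.valid.invPmin_le_tau hs h.const.c₃ h.two_le_log h1 hm
  have hV0 : 0 ≤ p.cumSum (T.secondMoment p H D 1 (-1) g hstar) m :=
    Params.cumSum_nonneg hs hm fun j j1 jm =>
      (h.valid.secondMoment_mem_Icc hs h.const.c₃ (jm.trans hm) g hstar).1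
  have hVq : p.cumSum (T.secondMoment p H D 1 (-1) g hstar) m ≤ p.τ m * T.invPmin p H m := by
    rw [← Params.cumSum_const hs hm]
    exact Params.cumSum_le_cumSum hs hm fun j j1 jm =>
      (h.valid.secondMoment_mem_Icc hs h.const.c₃ (jm.trans hm) g hstar).2.trans
        (h.valid.invPmin_mono hs h.const.c₃ h.two_le_log j1 jm hm)
  obtain ⟨k, hkmem, hqk, hk⟩ := exists_balanced_scale hV0 (show 1 ≤ p.logTerm H.card m by linarith)
    hq1 hqt hVq
  have c1 := hconc m (Finset.mem_Icc.2 ⟨h1, hm⟩) k hkmem (1, -1) (by simp [coefficients]) g hg hqk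
  have c2 := hconc m (Finset.mem_Icc.2 ⟨h1, hm⟩) k hkmem (-1, 1) (by simp [coefficients]) g hg hqk
  simp only at c1 c2
  have e := secondMoment_neg (T := T) (p := p) (H := H) (D := D) 1 (-1) g hstar
  rw [neg_neg] at e
  rw [e] at c2
  have hgap : T.meanGap p H D hstar m g = p.cumSum (fun j => T.meanLoss p H D j g) m
      - p.cumSum (fun j => T.meanLoss p H D j hstar) m := Params.cumSum_sub _ _ m
  rw [hgap, lossGap, abs_le]
  constructor <;> linarith

/-- The variance involves the error of `hstar`, whereas the radius only sees the minimizer; the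
discrepancy `X` is the excess loss of `hstar`, itself a deviation. The bound is therefore
self-referential in `X`, but with coefficient `19/128 < 1`. -/
theorem gapClose_of_forall_lt (h : T.Setting p H D hstar) (hconc : T.Concentrated p H D hstar)
    {m : ℕ} (h1 : 1 ≤ m) (hm : m ≤ p.M) (hA : ∀ j, 1 ≤ j → j ≤ m → hstar ∈ T.A p H j)
    (hG : ∀ j, 1 ≤ j → j < m → T.GapClose p H D hstar j) : T.GapClose p H D hstar m := by
  have hs := h.schedule
  have hL := Params.three_le_logTerm hs h.two_le_log h1 hm
  have hstarC := (abs_le.1 (h.abs_cumLoss_star_sub_le hconc h1 hm)).1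
  have hS := (h.cumSum_regionErr_le h1 hm hA).1
  have hB := h.scaledDelta_eq h1 hm
  have hB0 := h.scaledDelta_nonneg h1 hm
  have hX := h.lossGap_erm_nonpos h1 hm
  have hη := h.const.eta
  have hXeq : T.cumLoss p H m hstar = T.minLoss p H m + -T.lossGap p H hstar m (T.h (m + 1)) := by
    rw [lossGap, minLoss]; ring
  have hdev : ∀ g ∈ H, |T.lossGap p H hstar m g - T.meanGap p H D hstar m g| ≤
      19 / 16 * (T.meanGap p H D hstar m g / 8 + 42 / 1000 * (p.η * T.scaledDelta p H m)
        + -T.lossGap p H hstar m (T.h (m + 1)) / 8) + 1 / 1000 * (p.η * T.scaledDelta p H m) := by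
    intro g hg
    have hR := h.meanGap_nonneg hm hA hg
    have hV := h.scaled_secondMoment_le h1 hm hA hG (a := 1) (b := -1) (by norm_num) hg
    obtain ⟨q1, q2⟩ := variance_le_quadratic hη h.const.alpha h.const.c₁_facts.2.1
      (by linarith [h.const.c₁_facts.1]) h.const.c₂ (show 0 ≤ 32 * p.logTerm H.card m by linarith)
      (hs.one_le_log_tau h1 hm) (h.valid.cumLoss_nonneg hm (T.h (m + 1))) hB
      (h.scaled_invPmin_le h1 hm)
      (show p.cumSum (T.regionErr p H D hstar) m ≤ 2 * (T.minLoss p H m +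
        -T.lossGap p H hstar m (T.h (m + 1))) +
        18 / 32 * (32 * p.logTerm H.card m * T.invPmin p H m) by linarith)
      (neg_nonneg.2 hX) hR hV
    have hb0 : 0 ≤ p.η * T.scaledDelta p H m := mul_nonneg (by linarith) hB0
    have hsq := sqrt_le_of_le_quadratic hR (neg_nonneg.2 hX) hb0 q2
    have hBη := mul_le_mul_of_nonneg_right hη hB0
    refine (h.abs_lossGap_sub_le hconc h1 hm hg).trans ?_
    linarith
  have hmem := h.valid.erm_mem_succ h1 hm
  -- The deviation bound for the minimizer bounds `X` by less than `0.06 η B`; reinserting this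
  -- leaves coefficients below `1/2` and `1/8` for every `g`.
  have herm := (abs_le.1 (hdev _ hmem)).1
  have hRerm := h.meanGap_nonneg hm hA hmem
  intro g hg
  have hR := h.meanGap_nonneg hm hA hg
  have hb0 : 0 ≤ p.η * T.scaledDelta p H m := mul_nonneg (by linarith) hB0
  refine (hdev g hg).trans ?_
  linarith

theorem star_mem_A_and_gapClose (h : T.Setting p H D hstar) (hconc : T.Concentrated p H D hstar)
    {m : ℕ} (hm : m ≤ p.M) :
    (∀ j, 1 ≤ j → j ≤ m + 1 → hstar ∈ T.A p H j) ∧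
      ∀ j, 1 ≤ j → j ≤ m → T.GapClose p H D hstar j := by
  induction m with
  | zero =>
    refine ⟨fun j j1 j2 => ?_, fun j j1 j2 => by omega⟩
    obtain rfl : j = 1 := by omega
    exact mem_A_one.2 h.star_mem
  | succ m ih =>
    obtain ⟨hA, hG⟩ := ih (by omega)
    have hG' := h.gapClose_of_forall_lt hconc (by omega) hm hA
      fun j j1 j2 => hG j j1 (by omega)
    refine ⟨fun j j1 j2 => ?_, fun j j1 j2 => ?_⟩
    · rcases Nat.lt_or_ge j (m + 2) with hj | hj
      · exact hA j j1 (by omega)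
      · obtain rfl : j = m + 1 + 1 := by omega
        exact h.star_mem_A_succ (by omega) hm hA hG'
    · rcases Nat.lt_or_ge j (m + 1) with hj | hj
      · exact hG j j1 (by omega)
      · obtain rfl : j = m + 1 := by omega
        exact hG'

/-- The minimizer loses no more than `hstar`, whose cumulative loss concentrates around its mean,
and that mean is its cumulative error on the regions up to an additive 3. -/
theorem scaledDelta_le (h : T.Setting p H D hstar) (hconc : T.Concentrated p H D hstar)
    {m : ℕ} (h1 : 1 ≤ m) (hm : m ≤ p.M) (hA : ∀ j, 1 ≤ j → j ≤ m → hstar ∈ T.A p H j) :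
    T.scaledDelta p H m ≤ 2 * (p.τ m * T.DeltaStar p H D hstar m) := by
  have hs := h.schedule
  have hL := Params.three_le_logTerm hs h.two_le_log h1 hm
  have hErr : T.errAvg p H D m hstar = p.cumSum (T.regionErr p H D hstar) m / p.τ m :=
    one_div_mul_eq_div _ _
  rw [DeltaStar, hErr, Params.tau_mul_radius hs h1 hm, h.scaledDelta_eq h1 hm]
  have hstarC := (abs_le.1 (h.abs_cumLoss_star_sub_le hconc h1 hm)).2
  refine radius_le_two_mul h.const.c₁_facts.1 h.const.c₁_facts.2.2 (by linarith)
    (hs.one_le_log_tau h1 hm) (h.valid.cumLoss_nonneg hm _) (h.scaled_invPmin_le h1 hm)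
    (Params.cumSum_nonneg hs hm fun j _ _ => measureReal_nonneg)
    (h.cumSum_regionErr_le h1 hm hA).2 ?_
  have := h.valid.minLoss_le hs h1 hm h.star_mem
  linarith

/-- The loss gap of `g` is at most `γ B`, because the minimizer's is nonpositive. Then `GapClose`
gives a mean gap at most `2 γ B + η B / 4 ≤ 3 γ B`, and `B ≤ 2 τ_m Δ*_m`; the factor 16 is not
tight. -/
theorem reg_le (h : T.Setting p H D hstar) (hconc : T.Concentrated p H D hstar)
    {m : ℕ} (h1 : 1 ≤ m) (hm : m ≤ p.M) {g : 𝒳 → Bool} (hg : g ∈ T.A p H (m + 1)) :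
    reg D g hstar ≤ 16 * p.γ * T.DeltaStar p H D hstar m := by
  have hs := h.schedule
  have hτ := hs.three_le_tau h1 hm
  obtain ⟨hA', hG'⟩ := h.star_mem_A_and_gapClose hconc hm
  have hA : ∀ j, 1 ≤ j → j ≤ m → hstar ∈ T.A p H j := fun j j1 j2 => hA' j j1 (by omega)
  have hgH := A_subset hg
  have hemp : empReg g (T.h (m + 1)) (T.sample p H m) ≤ p.γ * T.Delta p H m := by
    obtain ⟨k, rfl⟩ : ∃ k, m = k + 1 := ⟨m - 1, by omega⟩
    rw [A_succ_succ] at hg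
    exact hg.2
  rw [h.empReg_star_eq hm, div_le_iff₀ (by linarith)] at hemp
  have e0 : T.Delta p H m * p.τ m = T.scaledDelta p H m := by rw [scaledDelta, mul_comm]
  rw [mul_assoc, e0] at hemp
  have e1 := h.lossGap_erm_nonpos h1 hm
  have e2 := (abs_le.1 (hG' m h1 le_rfl g hgH)).1
  have e3 := h.tau_mul_reg_le hm hA hgH
  have e4 := h.scaledDelta_le hconc h1 hm hA
  have e5 := h.scaledDelta_nonneg h1 hm
  have e6 := mul_le_mul_of_nonneg_right h.const.gamma e5
  have e7 := mul_le_mul_of_nonneg_left e4 h.γ_pos.le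
  have e8 := mul_nonneg h.γ_pos.le e5
  have e9 : p.τ m * reg D g hstar ≤ p.τ m * (16 * p.γ * T.DeltaStar p H D hstar m) := by
    linarith
  exact le_of_mul_le_mul_left e9 (by linarith)

end Setting

end Trajectory

end

end ActiveCover

/-! ### The main theorem -/

theorem theorem1 {𝒳 Ω : Type*} [MeasurableSpace 𝒳] [mΩ : MeasurableSpace Ω]
    (D : Measure (𝒳 × Bool)) [IsProbabilityMeasure D]
    (H : Finset (𝒳 → Bool)) (hH : ∀ h ∈ H, Measurable h)
    (hstar : 𝒳 → Bool) (hstar_mem : hstar ∈ H)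
    (hstar_min : ∀ h ∈ H, ActiveCover.err D hstar ≤ ActiveCover.err D h)
    (p : ActiveCover.Params) (hschedule : p.ScheduleOK) (hconst : p.ConstantsOK H.card)
    (hδ_pos : 0 < p.δ) (hδ_lt : p.δ < 1 / Real.exp 1) (hHδ : √192 < (H.card : ℝ) / p.δ)
    (μ : Measure Ω) [IsProbabilityMeasure μ] (ℱ : Filtration ℕ mΩ)
    (T : Ω → ActiveCover.Trajectory 𝒳) (hrun : ActiveCover.IsRun p H D μ ℱ T) :
    ∃ E : Set Ω, MeasurableSet E ∧ 1 - p.δ ≤ μ.real E ∧ ∀ ω ∈ E,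
      (∀ m ∈ Finset.Icc 1 p.M,
        (∀ h ∈ (T ω).A p H (m + 1),
          ActiveCover.reg D h hstar ≤ 16 * p.γ * (T ω).DeltaStar p H D hstar m) ∧
        ActiveCover.empReg hstar ((T ω).h (m + 1)) ((T ω).sample p H m)
          ≤ p.η * (T ω).Delta p H m / 4) ∧
      ∀ m ∈ Finset.Icc 1 (p.M + 1), hstar ∈ (T ω).A p H m := by
  -- `√192 > 8 > e²`.
  have hN : 2 ≤ Real.log (H.card / p.δ) := by
    have h1 : (8 : ℝ) ≤ H.card / p.δ :=
      (Real.le_sqrt_of_sq_le (by norm_num : (8 : ℝ) ^ 2 ≤ 192)).trans hHδ.le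
    rw [Real.le_log_iff_exp_le (by linarith), show (2 : ℝ) = 1 + 1 by norm_num, Real.exp_add]
    have h2 := Real.exp_one_lt_d9
    have h3 := Real.exp_pos 1
    nlinarith
  obtain ⟨E, hE, hμE, hconc⟩ := hrun.exists_event hH hschedule hconst.c₃ hstar_mem hδ_pos hHδ hN
  refine ⟨E, hE, hμE, fun ω hω => ?_⟩
  have hset : (T ω).Setting p H D hstar :=
    ⟨hrun.isValid ω, hschedule, hconst, hH, hstar_mem, hstar_min, hN⟩
  have hc := hconc ω hω
  obtain ⟨hA, hG⟩ := hset.star_mem_A_and_gapClose hc le_rfl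
  refine ⟨fun m hm => ?_, fun m hm => ?_⟩
  · obtain ⟨h1, h2⟩ := Finset.mem_Icc.1 hm
    refine ⟨fun h hh => hset.reg_le hc h1 h2 hh, ?_⟩
    have e1 := hset.empReg_star_le h1 h2 (fun j j1 j2 => hA j j1 (by omega)) (hG m h1 h2)
    have e2 : 0 ≤ p.η * (T ω).Delta p H m :=
      mul_nonneg (by linarith [hconst.eta]) (hset.Delta_nonneg h1 h2)
    linarith
  · obtain ⟨h1, h2⟩ := Finset.mem_Icc.1 hm
    exact hA m h1 h2
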